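/- Let $\Omega=\mathbb{H}_1\times\mathbb{H}_2\subset\mathbb{C}^2$, where $\mathbb{H}_j=\{z_j=x_j+iy_j : y_j>0\}$. Let $f=f_1\,d\bar z_1+f_2\,d\bar z_2$ be a $(0,1)$-form whose coefficients are Schwartz functions on $\overline\Omega$ (restrictions to $\overline\Omega$ of Schwartz functions on $\mathbb{C}^2$), and suppose $\bar\partial f=0$ in $\Omega$. Then there is $u\in C^\infty(\overline\Omega)$ with $\bar\partial u=f$ in $\Omega$, and one may take the Kohn solution $u=\bar\partial^*Nf=-2\left(\frac{\partial w_1}{\partial z_1}+\frac{\partial w_2}{\partial z_2}\right)$. Here $Nf=w=w_1\,d\bar z_1+w_2\,d\bar z_2$ denotes the solution of the $\bar\partial$-Neumann problem on $\Omega$ with data $f$, that is, $w_1,w_2\in C^2(\Omega)$ and: (i) $(\bar\partial\bar\partial^*+\bar\partial^*\bar\partial)w=f$ in $\Omega$, where $\bar\partial^*$ is the formal adjoint for the standard Hermitian metric (equivalently $\Delta w_j=-2f_j$ for $j=1,2$); (ii) $w_j$ and $\partial w_j/\partial\bar z_k$ $(k\neq j)$ belong to $L^p(\Omega)$ for every $p\in(2,\infty)$;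 (iii) $w_j=0$ on $y_j=0$, in the sense that the $L^q$ norm of $w_j$ on the slice $\{z\in\Omega: y_j=y\}$ tends to $0$ as $y\to0^+$, for every $q\in(2,4)$; (iv) for $k\ne j$, $\partial w_j/\partial\bar z_k=0$ on $y_k=0$, in the sense that the $L^q$ norm of $\partial w_j/\partial\bar z_k$ on the slice $\{z\in\Omega: y_k=y\}$ tends to $0$ as $y\to0^+$, for every $q\in(2,\infty)$. -/

import Mathlib

open MeasureTheory Filter Topology
open scoped ContDiff ENNReal SchwartzMap

/-- The product `Ω = ℍ₁ × ℍ₂ ⊆ ℂ²` of two upper half-planes. -/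
def halfPlanes : Set (Fin 2 → ℂ) := {z | ∀ j, 0 < (z j).im}

/-- `∂/∂z_j = (∂/∂x_j - i ∂/∂y_j) / 2`. -/
noncomputable def dz (j : Fin 2) (g : (Fin 2 → ℂ) → ℂ) (z : Fin 2 → ℂ) : ℂ :=
  (1 / 2 : ℂ) * (fderiv ℝ g z (Pi.single j 1) - Complex.I * fderiv ℝ g z (Pi.single j Complex.I))

/-- `∂/∂z̄_j = (∂/∂x_j + i ∂/∂y_j) / 2`. -/
noncomputable def dzbar (j : Fin 2) (g : (Fin 2 → ℂ) → ℂ) (z : Fin 2 → ℂ) : ℂ :=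
  (1 / 2 : ℂ) * (fderiv ℝ g z (Pi.single j 1) + Complex.I * fderiv ℝ g z (Pi.single j Complex.I))

/-- A `(0,1)`-form `w = w_1 dz̄_1 + w_2 dz̄_2` is given by its coefficients: `w z j = w_j(z)`. -/
abbrev Form01 : Type := (Fin 2 → ℂ) → Fin 2 → ℂ

/-- A `(0,2)`-form, given by its antisymmetric coefficients: `h z j k` is the coefficient of
`dz̄_j ∧ dz̄_k`. -/
abbrev Form02 : Type := (Fin 2 → ℂ) → Fin 2 → Fin 2 → ℂ

/-- `∂̄` on functions: `∂̄u = ∑ (∂u/∂z̄_j) dz̄_j`. -/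
noncomputable def dbar₀ (u : (Fin 2 → ℂ) → ℂ) : Form01 := fun z j => dzbar j u z

/-- `∂̄` on `(0,1)`-forms: the coefficient of `dz̄_j ∧ dz̄_k` is `∂w_k/∂z̄_j - ∂w_j/∂z̄_k`. -/
noncomputable def dbar₁ (w : Form01) : Form02 :=
  fun z j k => dzbar j (fun ζ => w ζ k) z - dzbar k (fun ζ => w ζ j) z

/-- The formal adjoint `∂̄*` on `(0,1)`-forms for the standard Hermitian metric (`|dz̄_j|² = 2`):
`∂̄*w = -2 ∑ ∂w_j/∂z_j`. -/
noncomputable def dbarStar₁ (w : Form01) (z : Fin 2 → ℂ) : ℂ :=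
  -2 * ∑ j, dz j (fun ζ => w ζ j) z

/-- The formal adjoint `∂̄*` on `(0,2)`-forms for the standard Hermitian metric. -/
noncomputable def dbarStar₂ (h : Form02) : Form01 :=
  fun z j => -2 * ∑ k, dz k (fun ζ => h ζ k j) z

/-- The complex Laplacian `□ = ∂̄∂̄* + ∂̄*∂̄` on `(0,1)`-forms. -/
noncomputable def boxLaplacian (w : Form01) : Form01 :=
  fun z j => dbar₀ (dbarStar₁ w) z j + dbarStar₂ (dbar₁ w) z j

/-- Schwartz functions on a closed set `s`: restrictions to `s` of Schwartz functions on `ℂ²`. -/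
def IsSchwartzOn (s : Set (Fin 2 → ℂ)) (g : (Fin 2 → ℂ) → ℂ) : Prop :=
  ∃ φ : 𝓢(Fin 2 → ℂ, ℂ), Set.EqOn g φ s

/-- The point of `ℂ²` whose `j`-th coordinate is `x + iy` and whose other coordinate is `ζ`,
where `s = (x, ζ)`. -/
noncomputable def slicePoint (j : Fin 2) (y : ℝ) (s : ℝ × ℂ) : Fin 2 → ℂ :=
  fun k => if k = j then (s.1 : ℂ) + y * Complex.I else s.2

/-- The `L^q` norm of `g` on the slice `{z ∈ Ω : y_j = y}` of `Ω`. -/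
noncomputable def sliceNorm (j : Fin 2) (q : ℝ≥0∞) (g : (Fin 2 → ℂ) → ℂ) (y : ℝ) : ℝ≥0∞ :=
  eLpNorm (fun s : ℝ × ℂ => g (slicePoint j y s)) q (volume.restrict {s | 0 < s.2.im})

/-- `w = Nf`: the form `w` solves the `∂̄`-Neumann problem on `Ω` with data `f`, in the class in
which the solution is unique. The equation `□w = f` holds in `Ω`; the boundary conditions are
`w_j = 0` on `y_j = 0` and `∂w_j/∂z̄_k = 0` on `y_k = 0` for `k ≠ j`, attained in the `L^q` sense. -/
structure IsDbarNeumannSolution (f w : Form01) : Prop where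
  contDiffOn : ∀ j, ContDiffOn ℝ 2 (fun z => w z j) halfPlanes
  box_eq : ∀ z ∈ halfPlanes, boxLaplacian w z = f z
  memLp : ∀ j, ∀ p : ℝ≥0∞, 2 < p → p < ⊤ →
    MemLp (fun z => w z j) p (volume.restrict halfPlanes)
  memLp_dzbar : ∀ j k, j ≠ k → ∀ p : ℝ≥0∞, 2 < p → p < ⊤ →
    MemLp (dzbar k (fun z => w z j)) p (volume.restrict halfPlanes)
  boundary : ∀ j, ∀ q : ℝ≥0∞, 2 < q → q < 4 →
    Tendsto (sliceNorm j q (fun z => w z j)) (𝓝[>] 0) (𝓝 0)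
  boundary_dzbar : ∀ j k, j ≠ k → ∀ q : ℝ≥0∞, 2 < q → q < ⊤ →
    Tendsto (sliceNorm k q (dzbar k (fun z => w z j))) (𝓝[>] 0) (𝓝 0)

/-! The solution is written down as convolutions of odd extensions of the data with explicit
kernels. With `(a, b)` for the two variables and `n = |a|² + |b|²`, the first component of `w` is
`-2 G f₁ + W (∂f₁/∂z̄₂)`. Here `G` is convolution in the first variable alone with `log |a|² /
(4π)`, applied to the extension odd in `y₁`, and `W` is convolution with `log n / (2π² b)`, applied
to the extension odd in both `y₁` and `y₂`. The second component is obtained by exchanging the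
variables.

The algebra rests on three kernel identities. Since `∂̄(1/b) = πδ`, `∂̄₂` of the kernel of `W` is
that of `V`, namely `1 / (2π² n)`, plus twice that of `G` (`kernelWd_kerW_snd`). The `G` terms
cancel, so `∂w₁/∂z̄₂ = V (∂f₁/∂z̄₂)`. As `V` is symmetric and `f` is closed, `∂̄w = 0` and only
`∂̄∂̄*w` remains of `□w`. Next, `∂₁` of the kernel of `W` is that of `Y`, `ā / (2π² b n)`, and `Y`
plus its transpose is half of the product Cauchy kernel `1 / (π² a b)` (`kerY_add_kerY_swap`).
Therefore `∂̄*w = T₁f₁ + T₂f₂ - T₁T₂(∂f₁/∂z̄₂)`, with `T_j` the Cauchy transform of the odd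
extension. Finally `∂̄_j T_j` is the identity on `Ω`, and closedness gives `∂̄(∂̄*w) = f`.

Smoothness up to the boundary: derivatives along `x_j` pass through the odd extension to the data,
and `∂̄_j` deletes a Cauchy factor, so the family of products of the `T_j` applied to Schwartz
functions is closed under all first derivatives. Each member is continuous on `ℂ²`, hence
`contDiffOn_opT` by induction. All derivatives are first found in the sense of distributions and
made classical by `hasFDerivAt_of_weakDir`.

Boundary values: the kernels of `G`, `W` and `V` are even under `a ↦ ā` while the density is odd, so
these operators vanish on `y₁ = 0`. Antisymmetrising the kernel against the odd density also gives
the bound `C (1 + |z₁|)⁻¹ (1 + |z₂|)⁻¹` (`exists_op_bound`). This bound yields `L^p` for `p > 2` and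
dominates the slices. -/

/-! ### Calculus of Wirtinger derivatives. -/

section Wirtinger

variable {E : Type*} [NormedAddCommGroup E] [NormedSpace ℝ E]

/-- The first-order operator `(∂_{e₁} + c ∂_{e₂}) / 2`; with `c = ± i` it is a Wirtinger derivative. -/
noncomputable def wd (c : ℂ) (e₁ e₂ : E) (g : E → ℂ) (z : E) : ℂ :=
  (1 / 2 : ℂ) * (fderiv ℝ g z e₁ + c * fderiv ℝ g z e₂)

theorem wd_mul {c : ℂ} {e₁ e₂ : E} {f g : E → ℂ} {z : E} (hf : DifferentiableAt ℝ f z)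
    (hg : DifferentiableAt ℝ g z) :
    wd c e₁ e₂ (fun x => f x * g x) z = f z * wd c e₁ e₂ g z + wd c e₁ e₂ f z * g z := by
  simp only [wd, fderiv_fun_mul hf hg, add_apply, smul_apply, smul_eq_mul]
  ring

theorem wd_add {c : ℂ} {e₁ e₂ : E} {f g : E → ℂ} {z : E} (hf : DifferentiableAt ℝ f z)
    (hg : DifferentiableAt ℝ g z) :
    wd c e₁ e₂ (fun x => f x + g x) z = wd c e₁ e₂ f z + wd c e₁ e₂ g z := by
  simp only [wd, fderiv_fun_add hf hg, add_apply]
  ring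

theorem wd_const (c : ℂ) (e₁ e₂ : E) (k : ℂ) (z : E) : wd c e₁ e₂ (fun _ => k) z = 0 := by
  simp [wd]

theorem wd_inv {c : ℂ} {e₁ e₂ : E} {f : E → ℂ} {z : E} (hf : DifferentiableAt ℝ f z)
    (h0 : f z ≠ 0) :
    wd c e₁ e₂ (fun x => (f x)⁻¹) z = - wd c e₁ e₂ f z / f z ^ 2 := by
  have h : HasFDerivAt (fun x => (f x)⁻¹) (-(f z ^ 2)⁻¹ • fderiv ℝ f z) z := by
    have h1 : HasDerivAt (fun y : ℂ => y⁻¹) (-(f z ^ 2)⁻¹) (f z) := hasDerivAt_inv h0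
    exact h1.comp_hasFDerivAt_of_eq z hf.hasFDerivAt rfl
  simp only [wd, h.fderiv, smul_apply, smul_eq_mul]
  field_simp
  ring

theorem wd_log {c : ℂ} {e₁ e₂ : E} {r : E → ℝ} {z : E} (hr : DifferentiableAt ℝ r z)
    (h0 : r z ≠ 0) :
    wd c e₁ e₂ (fun x => (Real.log (r x) : ℂ)) z = wd c e₁ e₂ (fun x => (r x : ℂ)) z / r z := by
  have h1 : HasFDerivAt (fun x => (r x : ℂ)) (Complex.ofRealCLM.comp (fderiv ℝ r z)) z :=
    Complex.ofRealCLM.hasFDerivAt.comp z hr.hasFDerivAt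
  have h2 : HasFDerivAt (fun x => (Real.log (r x) : ℂ))
      (Complex.ofRealCLM.comp ((r z)⁻¹ • fderiv ℝ r z)) z :=
    Complex.ofRealCLM.hasFDerivAt.comp z (hr.hasFDerivAt.log h0)
  simp only [wd, h1.fderiv, h2.fderiv, ContinuousLinearMap.comp_apply,
    smul_apply, smul_eq_mul, Complex.ofRealCLM_apply, Complex.ofReal_mul,
    Complex.ofReal_inv]
  ring

theorem continuous_wd {c : ℂ} {e₁ e₂ : E} {f : E → ℂ} (hf : ContDiff ℝ 1 f) :
    Continuous (wd c e₁ e₂ f) := by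
  have h := hf.continuous_fderiv (by simp)
  unfold wd
  fun_prop

theorem hasCompactSupport_wd {c : ℂ} {e₁ e₂ : E} {f : E → ℂ} (hf : HasCompactSupport f) :
    HasCompactSupport (wd c e₁ e₂ f) := by
  have h := hf.fderiv ℝ
  refine HasCompactSupport.intro h fun x hx => ?_
  simp [wd, image_eq_zero_of_notMem_tsupport hx]

theorem integral_mul_wd [FiniteDimensional ℝ E] [MeasurableSpace E] [BorelSpace E]
    {μ : Measure E} [μ.IsAddHaarMeasure] {c : ℂ} {e₁ e₂ : E} {m φ : E → ℂ} (hm : ContDiff ℝ 1 m)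
    (hφ : ContDiff ℝ 1 φ) (hc : HasCompactSupport φ) :
    ∫ x, m x * wd c e₁ e₂ φ x ∂μ = - ∫ x, wd c e₁ e₂ m x * φ x ∂μ := by
  have hm' := hm.continuous_fderiv (by simp)
  have hφ' := hφ.continuous_fderiv (by simp)
  have hcm := hm.continuous
  have hcφ := hφ.continuous
  have i1 : ∀ e, Integrable (fun x => m x * fderiv ℝ φ x e) μ := fun e =>
    Continuous.integrable_of_hasCompactSupport (by fun_prop)
      (HasCompactSupport.mul_left (hc.fderiv_apply ℝ e))
  have i2 : ∀ e, Integrable (fun x => fderiv ℝ m x e * φ x) μ := fun e =>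
    Continuous.integrable_of_hasCompactSupport (by fun_prop) hc.mul_left
  have i3 : Integrable (fun x => m x * φ x) μ :=
    Continuous.integrable_of_hasCompactSupport (by fun_prop) hc.mul_left
  have key : ∀ e, ∫ x, m x * fderiv ℝ φ x e ∂μ = - ∫ x, fderiv ℝ m x e * φ x ∂μ := fun e =>
    integral_mul_fderiv_eq_neg_fderiv_mul_of_integrable (i2 e) (i1 e) i3
      (fun x _ => hm.differentiable (by simp) x) (fun x _ => hφ.differentiable (by simp) x)
  have e1 : ∀ x, m x * wd c e₁ e₂ φ x
      = (1 / 2) * (m x * fderiv ℝ φ x e₁) + (c / 2) * (m x * fderiv ℝ φ x e₂) := fun x => by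
    simp only [wd]; ring
  have e2 : ∀ x, wd c e₁ e₂ m x * φ x
      = (1 / 2) * (fderiv ℝ m x e₁ * φ x) + (c / 2) * (fderiv ℝ m x e₂ * φ x) := fun x => by
    simp only [wd]; ring
  simp_rw [e1, e2]
  rw [integral_add ((i1 _).const_mul _) ((i1 _).const_mul _),
    integral_add ((i2 _).const_mul _) ((i2 _).const_mul _)]
  simp_rw [integral_const_mul, key]
  ring

end Wirtinger

/-! ### Integrable singular weights on the plane. -/

section Plane

open Complex

theorem wd_id (c : ℂ) (z : ℂ) : wd c 1 I (fun a => a) z = (1 + c * I) / 2 := by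
  simp [wd]; ring

theorem wd_conj (c : ℂ) (z : ℂ) :
    wd c 1 I (fun a => (starRingEnd ℂ) a) z = (1 - c * I) / 2 := by
  have h : HasFDerivAt (fun a : ℂ => (starRingEnd ℂ) a) (conjCLE : ℂ →L[ℝ] ℂ) z :=
    conjCLE.hasFDerivAt
  simp [wd, h.fderiv]; ring

theorem contDiff_conj {n : WithTop ℕ∞} : ContDiff ℝ n (fun a : ℂ => (starRingEnd ℂ) a) :=
  conjCLE.contDiff

theorem wd_mul_conj_add (c k z : ℂ) :
    wd c 1 I (fun a => a * (starRingEnd ℂ) a + k) z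
      = z * ((1 - c * I) / 2) + (1 + c * I) / 2 * (starRingEnd ℂ) z := by
  have h1 : DifferentiableAt ℝ (fun a : ℂ => (starRingEnd ℂ) a) z := differentiable_conj z
  rw [wd_add (by fun_prop) (by fun_prop), wd_mul (by fun_prop) (by fun_prop), wd_id, wd_conj,
    wd_const, add_zero]

/-- A locally integrable weight on the plane, singular at `0`. -/
noncomputable def sing (a : ℂ) : ℝ := 1 + ‖a‖ ^ (-(3 / 2) : ℝ)

/-- The weight `sing` with cubic decay at infinity. -/
noncomputable def singDecay (a : ℂ) : ℝ := sing a * ((1 + ‖a‖) ^ 3)⁻¹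

theorem one_le_sing (a : ℂ) : 1 ≤ sing a := by
  have : 0 ≤ ‖a‖ ^ (-(3 / 2) : ℝ) := by positivity
  unfold sing; linarith

theorem sing_zero : sing 0 = 1 := by
  simp [sing, Real.zero_rpow]

/-- The exponent `3/2` lies between `1`, so that the Cauchy kernel is dominated near the origin, and
`2`, so that the weight is locally integrable. It is also half the homogeneity degree `3` of the
most singular kernels on `ℂ²`. At the origin both `0⁻¹` and `0 ^ (-3/2)` are `0`, so the weight
stays finite for the Dirac mass. -/
theorem inv_norm_le_sing (a : ℂ) : ‖a‖⁻¹ ≤ sing a := by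
  have h0 : 0 ≤ ‖a‖ ^ (-(3 / 2) : ℝ) := by positivity
  rcases eq_or_ne a 0 with rfl | ha
  · simp [sing_zero]
  rcases le_total 1 ‖a‖ with h | h
  · have := inv_le_one_of_one_le₀ h
    unfold sing; linarith
  · have h1 : ‖a‖ ^ (-1 : ℝ) ≤ ‖a‖ ^ (-(3 / 2) : ℝ) :=
      Real.rpow_le_rpow_of_exponent_ge (norm_pos_iff.2 ha) h (by norm_num)
    rw [Real.rpow_neg_one] at h1
    unfold sing; linarith

theorem singDecay_nonneg (a : ℂ) : 0 ≤ singDecay a := by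
  have := one_le_sing a
  unfold singDecay; positivity

/-- In polar coordinates the radial density is of order `y ^ (-1/2)` on `(0, 1]` and at most `2 y ^
(-2)` beyond `1`. -/
theorem integrable_singDecay : Integrable singDecay := by
  have h : Integrable (fun a : ℂ =>
      (fun r : ℝ => (1 + r ^ (-(3 / 2) : ℝ)) * ((1 + r) ^ 3)⁻¹) ‖a‖) := by
    refine (integrable_fun_norm_addHaar (volume : Measure ℂ)
      (f := fun r : ℝ => (1 + r ^ (-(3 / 2) : ℝ)) * ((1 + r) ^ 3)⁻¹)).2 ?_
    have hm : Measurable (fun y : ℝ => y ^ (Module.finrank ℝ ℂ - 1) •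
        ((1 + y ^ (-(3 / 2) : ℝ)) * ((1 + y) ^ 3)⁻¹)) := by fun_prop
    rw [Complex.finrank_real_complex, ← Set.Ioc_union_Ioi_eq_Ioi zero_le_one] at *
    refine IntegrableOn.union ?_ ?_
    · have h1 : IntegrableOn (fun y : ℝ => 1 + y ^ (-(1 / 2) : ℝ)) (Set.Ioc 0 1) := by
        refine Integrable.add (by simp) ?_
        refine (intervalIntegrable_iff_integrableOn_Ioc_of_le zero_le_one).1 ?_
        exact intervalIntegral.intervalIntegrable_rpow' (by norm_num)
      refine Integrable.mono' h1 hm.aestronglyMeasurable ?_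
      filter_upwards [ae_restrict_mem measurableSet_Ioc] with y hy
      have hy0 := hy.1
      have e : y * y ^ (-(3 / 2) : ℝ) = y ^ (-(1 / 2) : ℝ) := by
        nth_rewrite 1 [← Real.rpow_one y]
        rw [← Real.rpow_add hy0]; norm_num
      have h2 : 0 ≤ y ^ (-(1 / 2) : ℝ) := by positivity
      have h3 : ((1 + y) ^ 3)⁻¹ ≤ 1 := inv_le_one_of_one_le₀ (one_le_pow₀ (by linarith))
      rw [Real.norm_of_nonneg (by positivity)]
      simp only [smul_eq_mul, Nat.add_one_sub_one, pow_one]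
      calc y * ((1 + y ^ (-(3 / 2) : ℝ)) * ((1 + y) ^ 3)⁻¹)
          = (y + y ^ (-(1 / 2) : ℝ)) * ((1 + y) ^ 3)⁻¹ := by rw [← e]; ring
        _ ≤ (y + y ^ (-(1 / 2) : ℝ)) * 1 := by gcongr
        _ ≤ _ := by linarith [hy.2]
    · have h1 : IntegrableOn (fun y : ℝ => 2 * y ^ (-2 : ℝ)) (Set.Ioi 1) :=
        (integrableOn_Ioi_rpow_of_lt (by norm_num) zero_lt_one).const_mul 2
      refine Integrable.mono' h1 hm.aestronglyMeasurable ?_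
      filter_upwards [ae_restrict_mem measurableSet_Ioi] with y (hy : 1 < y)
      have hy0 : 0 < y := by linarith
      have h2 : y ^ (-(3 / 2) : ℝ) ≤ 1 := Real.rpow_le_one_of_one_le_of_nonpos hy.le (by norm_num)
      have h3 : y ^ (-2 : ℝ) = (y ^ 2)⁻¹ := by
        rw [Real.rpow_neg hy0.le]; norm_cast
      rw [Real.norm_of_nonneg (by positivity), h3]
      simp only [smul_eq_mul, Nat.add_one_sub_one, pow_one]
      calc y * ((1 + y ^ (-(3 / 2) : ℝ)) * ((1 + y) ^ 3)⁻¹)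
          ≤ y * ((1 + 1) * (y ^ 3)⁻¹) := by gcongr; linarith
        _ = 2 * (y ^ 2)⁻¹ := by field_simp; norm_num
  exact h

theorem integrable_inv_mul {ψ : ℂ → ℂ} (hψ : Continuous ψ) (hc : HasCompactSupport ψ) :
    Integrable (fun a => a⁻¹ * ψ a) := by
  obtain ⟨C, hC⟩ := (hc.comp_left (g := fun x => ‖x‖) (by simp)).mul_left
    (f := fun a : ℂ => (1 + ‖a‖) ^ 3) |>.exists_bound_of_continuous (by fun_prop)
  refine (integrable_singDecay.const_mul C).mono' (by fun_prop) (ae_of_all _ fun a => ?_)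
  have h1 := inv_norm_le_sing a
  have h2 : (1 + ‖a‖) ^ 3 * ‖ψ a‖ ≤ C := by
    refine (le_abs_self _).trans ?_
    simpa using hC a
  have h3 := one_le_sing a
  rw [norm_mul, norm_inv]
  have hp : 0 < (1 + ‖a‖) ^ 3 := by positivity
  calc ‖a‖⁻¹ * ‖ψ a‖ ≤ sing a * ‖ψ a‖ := by gcongr
    _ = sing a * ((1 + ‖a‖) ^ 3)⁻¹ * ((1 + ‖a‖) ^ 3 * ‖ψ a‖) := by field_simp
    _ ≤ sing a * ((1 + ‖a‖) ^ 3)⁻¹ * C := by gcongr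
    _ = _ := by unfold singDecay; ring

end Plane

/-! ### The Cauchy–Pompeiu formula and the logarithmic potential. -/

section Pompeiu

open Complex

/-- Normalises the approximate identity used for `∂̄(1/a) = πδ₀`: the radial integral of `y / (1 +
y²)²` is `1/2`, and the circle contributes `2π`. -/
theorem integral_inv_one_add_sq_sq : ∫ a : ℂ, Real.pi⁻¹ * ((1 + ‖a‖ ^ 2) ^ 2)⁻¹ = 1 := by
  have hd : ∀ y ∈ Set.Ici (0 : ℝ),
      HasDerivAt (fun y : ℝ => -(1 / 2) * (1 + y ^ 2)⁻¹) (y * ((1 + y ^ 2) ^ 2)⁻¹) y := by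
    intro y _
    have h1 : HasDerivAt (fun y : ℝ => 1 + y ^ 2) (2 * y) y := by
      simpa using (hasDerivAt_pow 2 y).const_add 1
    have h2 := (h1.inv (by positivity)).const_mul (-(1 / 2))
    refine h2.congr_deriv ?_
    field_simp
  have hl : Tendsto (fun y : ℝ => -(1 / 2) * (1 + y ^ 2)⁻¹) atTop (𝓝 (-(1 / 2) * 0)) := by
    refine Tendsto.const_mul _ (tendsto_inv_atTop_zero.comp ?_)
    exact tendsto_atTop_add_const_left _ _ (tendsto_pow_atTop (by norm_num))
  have h := integral_Ioi_of_hasDerivAt_of_nonneg' hd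
    (fun y (hy : 0 < y) => by positivity) hl
  have e := integral_fun_norm_addHaar (volume : Measure ℂ)
    (fun r : ℝ => Real.pi⁻¹ * ((1 + r ^ 2) ^ 2)⁻¹)
  rw [e, Complex.finrank_real_complex]
  simp only [Nat.add_one_sub_one, pow_one, smul_eq_mul, nsmul_eq_mul, Nat.cast_ofNat]
  have e2 : ∀ y : ℝ, y * (Real.pi⁻¹ * ((1 + y ^ 2) ^ 2)⁻¹)
      = Real.pi⁻¹ * (y * ((1 + y ^ 2) ^ 2)⁻¹) := fun y => by ring
  simp_rw [e2, integral_const_mul, h, Measure.real, Complex.volume_ball]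
  have := Real.pi_pos
  simp

/-- The regularisation `ā / (|a|² + ε)` of `1 / a`. -/
noncomputable def regInv (ε : ℝ) (a : ℂ) : ℂ :=
  (starRingEnd ℂ) a * (a * (starRingEnd ℂ) a + ε)⁻¹

theorem mul_conj_add_ne_zero {ε : ℝ} (hε : 0 < ε) (a : ℂ) :
    a * (starRingEnd ℂ) a + ε ≠ 0 := by
  rw [mul_conj, normSq_eq_norm_sq]
  norm_cast
  positivity

theorem contDiff_regInv {ε : ℝ} (hε : 0 < ε) : ContDiff ℝ 1 (regInv ε) := by
  have h1 : ContDiff ℝ 1 (fun a : ℂ => (starRingEnd ℂ) a) := contDiff_conj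
  unfold regInv
  exact h1.mul (((contDiff_id.mul h1).add contDiff_const).inv fun a => mul_conj_add_ne_zero hε a)

/-- For small `ε` the result is a bump of mass `π` concentrating at the origin, which is where the
Dirac mass comes from. -/
theorem wd_regInv {ε : ℝ} (hε : 0 < ε) (a : ℂ) :
    wd I 1 I (regInv ε) a = ε * ((a * (starRingEnd ℂ) a + ε)⁻¹) ^ 2 := by
  have h1 : DifferentiableAt ℝ (fun a : ℂ => (starRingEnd ℂ) a) a := differentiable_conj a
  have h2 : DifferentiableAt ℝ (fun a : ℂ => a * (starRingEnd ℂ) a + (ε : ℂ)) a := by fun_prop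
  have h0 := mul_conj_add_ne_zero hε a
  unfold regInv
  rw [wd_mul h1 (h2.fun_inv h0), wd_inv h2 h0, wd_mul_conj_add, wd_conj]
  simp only [I_mul_I]
  field_simp
  ring

theorem norm_regInv_le {ε : ℝ} (hε : 0 < ε) (a : ℂ) : ‖regInv ε a‖ ≤ ‖a‖⁻¹ := by
  have e : regInv ε a = (starRingEnd ℂ) a * (((‖a‖ ^ 2 + ε : ℝ) : ℂ))⁻¹ := by
    unfold regInv
    rw [mul_conj, normSq_eq_norm_sq]
    push_cast; rfl
  have h : 0 < ‖a‖ ^ 2 + ε := by positivity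
  rw [e, norm_mul, norm_inv, Complex.norm_real, Real.norm_of_nonneg h.le, RCLike.norm_conj]
  rcases eq_or_ne a 0 with rfl | ha
  · simp
  have := norm_pos_iff.2 ha
  rw [← div_eq_mul_inv, div_le_iff₀ h, inv_mul_eq_div, le_div_iff₀ this]
  nlinarith

/-- With `ε = (n + 1)⁻²` the `∂̄`-derivative of the regularisation is `π` times the dilate by `c = n
+ 1` of one fixed bump, as `tendsto_integral_peak` requires. -/
theorem tendsto_regInv (a : ℂ) : Tendsto (fun n : ℕ => regInv (((n : ℝ) + 1) ^ 2)⁻¹ a) atTop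
    (𝓝 a⁻¹) := by
  rcases eq_or_ne a 0 with rfl | ha
  · simp [regInv]
  have h1 : Tendsto (fun n : ℕ => ((((n : ℝ) + 1) ^ 2)⁻¹ : ℝ)) atTop (𝓝 0) :=
    tendsto_inv_atTop_zero.comp ((tendsto_pow_atTop two_ne_zero).comp
      (tendsto_atTop_add_const_right _ _ tendsto_natCast_atTop_atTop))
  have h2 := (Complex.continuous_ofReal.tendsto 0).comp h1
  have h3 : a * (starRingEnd ℂ) a + ((0 : ℝ) : ℂ) ≠ 0 := by simp [ha]
  have h4 := ((h2.const_add (a * (starRingEnd ℂ) a)).inv₀ h3).const_mul ((starRingEnd ℂ) a)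
  have e : (starRingEnd ℂ) a * (a * (starRingEnd ℂ) a + ((0 : ℝ) : ℂ))⁻¹ = a⁻¹ := by
    have : (starRingEnd ℂ) a ≠ 0 := by simpa using ha
    simp only [ofReal_zero, add_zero]
    field_simp
  rw [e] at h4
  exact h4

theorem tendsto_integral_regInv_mul {ψ : ℂ → ℂ} (hψ : Continuous ψ) (hc : HasCompactSupport ψ) :
    Tendsto (fun n : ℕ => ∫ a, regInv (((n : ℝ) + 1) ^ 2)⁻¹ a * ψ a) atTop
      (𝓝 (∫ a, a⁻¹ * ψ a)) := by
  refine tendsto_integral_of_dominated_convergence (fun a => ‖a⁻¹ * ψ a‖) (fun n => ?_)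
    (integrable_inv_mul hψ hc).norm (fun n => ae_of_all _ fun a => ?_) (ae_of_all _ fun a => ?_)
  · have := (contDiff_regInv (ε := (((n : ℝ) + 1) ^ 2)⁻¹) (by positivity)).continuous
    exact (this.mul hψ).aestronglyMeasurable
  · rw [norm_mul, norm_mul, norm_inv]
    gcongr
    exact norm_regInv_le (by positivity) a
  · exact (tendsto_regInv a).mul_const _

theorem tendsto_integral_peak {φ : ℂ → ℂ} (hφ : Continuous φ) (hc : HasCompactSupport φ) :
    Tendsto (fun c : ℝ => ∫ a, (c ^ 2 * (Real.pi⁻¹ * ((1 + ‖c • a‖ ^ 2) ^ 2)⁻¹)) • φ a) atTop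
      (𝓝 (φ 0)) := by
  have h := tendsto_integral_comp_smul_smul_of_integrable (μ := (volume : Measure ℂ))
    (φ := fun a : ℂ => Real.pi⁻¹ * ((1 + ‖a‖ ^ 2) ^ 2)⁻¹) (g := φ)
    (fun a => by have := Real.pi_pos; positivity) integral_inv_one_add_sq_sq ?_
    (hφ.integrable_of_hasCompactSupport hc) hφ.continuousAt
  · simpa only [Complex.finrank_real_complex] using h
  · rw [Complex.finrank_real_complex]
    have h1 : Tendsto (fun r : ℝ => Real.pi⁻¹ * (r ^ 2)⁻¹) atTop (𝓝 (Real.pi⁻¹ * 0)) :=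
      (tendsto_inv_atTop_zero.comp (tendsto_pow_atTop two_ne_zero)).const_mul _
    rw [mul_zero] at h1
    have h2 := h1.comp (tendsto_norm_cobounded_atTop (E := ℂ))
    have := Real.pi_pos
    refine squeeze_zero (fun a => by positivity) (fun a => ?_) h2
    rcases eq_or_ne a 0 with rfl | ha
    · simp
    have ha := norm_pos_iff.2 ha
    simp only [Function.comp_apply]
    have h3 : ‖a‖ ^ 2 * ‖a‖ ^ 2 ≤ (1 + ‖a‖ ^ 2) ^ 2 := by nlinarith
    calc ‖a‖ ^ 2 * (Real.pi⁻¹ * ((1 + ‖a‖ ^ 2) ^ 2)⁻¹)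
        ≤ ‖a‖ ^ 2 * (Real.pi⁻¹ * (‖a‖ ^ 2 * ‖a‖ ^ 2)⁻¹) := by gcongr
      _ = _ := by field_simp

/-- **Cauchy–Pompeiu formula** for compactly supported functions: `∂̄(1/a) = π δ₀`. -/
theorem integral_inv_mul_wd {φ : ℂ → ℂ} (hφ : ContDiff ℝ 1 φ) (hc : HasCompactSupport φ) :
    ∫ a, a⁻¹ * wd I 1 I φ a = - (Real.pi * φ 0) := by
  have h1 := tendsto_integral_regInv_mul (continuous_wd (c := I) (e₁ := 1) (e₂ := I) hφ)
    (hasCompactSupport_wd hc)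
  have hs : Tendsto (fun n : ℕ => (n : ℝ) + 1) atTop atTop :=
    tendsto_atTop_add_const_right _ _ tendsto_natCast_atTop_atTop
  have h2 := (((tendsto_integral_peak hφ.continuous hc).comp hs).const_mul (Real.pi : ℂ)).neg
  refine tendsto_nhds_unique h1 (h2.congr fun n => ?_)
  rw [integral_mul_wd (contDiff_regInv (by positivity)) hφ hc]
  simp only [Function.comp_apply]
  rw [← integral_const_mul]
  congr 2
  ext a
  rw [wd_regInv (by positivity), real_smul, mul_conj, normSq_eq_norm_sq, norm_smul,
    Real.norm_of_nonneg (by positivity)]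
  have hp : (Real.pi : ℂ) ≠ 0 := by exact_mod_cast Real.pi_ne_zero
  have e : ((((n : ℝ) + 1) ^ 2)⁻¹ : ℝ) * ((‖a‖ ^ 2 + (((n : ℝ) + 1) ^ 2)⁻¹)⁻¹) ^ 2
      = ((n : ℝ) + 1) ^ 2 * ((1 + (((n : ℝ) + 1) * ‖a‖) ^ 2) ^ 2)⁻¹ := by
    have : 0 < (n : ℝ) + 1 := by positivity
    field_simp
    ring
  have e' := congrArg (fun r : ℝ => (r : ℂ)) e
  push_cast at e' ⊢
  rw [e']
  field_simp

/-- Cauchy–Pompeiu applied to the product `m φ`. A smooth factor `m` in front of `1/a` is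
differentiated classically and leaves the extra mass `π m(0)` at the origin. -/
theorem integral_inv_mul_mul_wd {m φ : ℂ → ℂ} (hm : ContDiff ℝ 1 m) (hφ : ContDiff ℝ 1 φ)
    (hc : HasCompactSupport φ) :
    ∫ a, a⁻¹ * m a * wd I 1 I φ a
      = - (∫ a, a⁻¹ * wd I 1 I m a * φ a) - Real.pi * (m 0 * φ 0) := by
  have h := integral_inv_mul_wd (hm.mul hφ) hc.mul_left
  have e : ∀ a, a⁻¹ * wd I 1 I (fun a => m a * φ a) a
      = a⁻¹ * (m a * wd I 1 I φ a) + a⁻¹ * (wd I 1 I m a * φ a) := fun a => by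
    rw [wd_mul (hm.differentiable (by simp) a) (hφ.differentiable (by simp) a)]; ring
  have c1 := continuous_wd (c := I) (e₁ := 1) (e₂ := I) hφ
  have c2 := continuous_wd (c := I) (e₁ := 1) (e₂ := I) hm
  have c3 := hm.continuous
  have c4 := hφ.continuous
  have i1 : Integrable (fun a => a⁻¹ * (m a * wd I 1 I φ a)) :=
    integrable_inv_mul (by fun_prop) (hasCompactSupport_wd hc).mul_left
  have i2 : Integrable (fun a => a⁻¹ * (wd I 1 I m a * φ a)) :=
    integrable_inv_mul (by fun_prop) hc.mul_left
  simp_rw [e] at h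
  rw [integral_add i1 i2] at h
  simp_rw [mul_assoc]
  rw [eq_sub_iff_add_eq, eq_neg_iff_add_eq_zero]
  linear_combination h

theorem contDiff_log_normSq_add {ε : ℝ} (hε : 0 < ε) :
    ContDiff ℝ 1 (fun a : ℂ => (Real.log (‖a‖ ^ 2 + ε) : ℂ)) := by
  refine ofRealCLM.contDiff.comp (ContDiff.log ?_ fun a => by positivity)
  exact (contDiff_norm_sq ℝ).add contDiff_const

theorem wd_log_normSq_add {ε : ℝ} (hε : 0 < ε) (c a : ℂ) :
    wd c 1 I (fun a : ℂ => (Real.log (‖a‖ ^ 2 + ε) : ℂ)) a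
      = (a * ((1 - c * I) / 2) + (1 + c * I) / 2 * (starRingEnd ℂ) a)
        * (a * (starRingEnd ℂ) a + ε)⁻¹ := by
  have hd : DifferentiableAt ℝ (fun a : ℂ => ‖a‖ ^ 2 + ε) a :=
    ((contDiff_norm_sq ℝ (n := 1)).differentiable (by simp) a).add_const _
  have e : ∀ a : ℂ, ((‖a‖ ^ 2 + ε : ℝ) : ℂ) = a * (starRingEnd ℂ) a + ε := fun a => by
    rw [mul_conj, normSq_eq_norm_sq]
    push_cast; rfl
  rw [wd_log hd (by positivity)]
  simp_rw [e]
  rw [wd_mul_conj_add, div_eq_mul_inv]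

theorem abs_log_le {x : ℝ} (hx : 0 < x) : |Real.log x| ≤ x + x⁻¹ := by
  have h1 := Real.log_le_sub_one_of_pos hx
  have h2 := Real.log_le_sub_one_of_pos (inv_pos.2 hx)
  rw [Real.log_inv] at h2
  have h3 := inv_pos.2 hx
  rw [abs_le]
  constructor <;> linarith

theorem abs_log_sq_le {x : ℝ} (hx : 0 < x) : |Real.log (x ^ 2)| ≤ 2 * (x + x⁻¹) := by
  rw [Real.log_pow, abs_mul]
  have := abs_log_le hx
  push_cast
  rw [abs_of_pos (by norm_num : (0 : ℝ) < 2)]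
  linarith

/-- In the plane, `∂ log |a|² = 1 / a` in the sense of distributions. -/
theorem integral_log_mul_wd {φ : ℂ → ℂ} (hφ : ContDiff ℝ 1 φ) (hc : HasCompactSupport φ) :
    ∫ a, (Real.log (‖a‖ ^ 2) : ℂ) * wd (-I) 1 I φ a = - ∫ a, a⁻¹ * φ a := by
  have h1 := (tendsto_integral_regInv_mul hφ.continuous hc).neg
  have hψ := continuous_wd (c := -I) (e₁ := 1) (e₂ := I) hφ
  have hψc := hasCompactSupport_wd (c := -I) (e₁ := 1) (e₂ := I) hc
  set ψ := wd (-I) 1 I φ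
  have h2 : Tendsto (fun n : ℕ => ∫ a, (Real.log (‖a‖ ^ 2 + (((n : ℝ) + 1) ^ 2)⁻¹) : ℂ) * ψ a)
      atTop (𝓝 (∫ a, (Real.log (‖a‖ ^ 2) : ℂ) * ψ a)) := by
    -- The majorant comes from `|log x²| ≤ 2 (x + 1/x)` at `x = √(|a|² + ε)`, which lies between
    -- `|a|` and `|a| + 1` because `ε ≤ 1`.
    refine tendsto_integral_of_dominated_convergence
      (fun a => ‖(((2 * (‖a‖ + 1) : ℝ) : ℂ)) * ψ a‖ + ‖a⁻¹ * ((2 : ℂ) * ψ a)‖)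
      (fun n => ?_) ?_ (fun n => ?_) ?_
    · have := (contDiff_log_normSq_add (ε := (((n : ℝ) + 1) ^ 2)⁻¹) (by positivity)).continuous
      exact (this.mul hψ).aestronglyMeasurable
    · refine Integrable.add (Integrable.norm ?_) (integrable_inv_mul (by fun_prop) hψc.mul_left).norm
      exact Continuous.integrable_of_hasCompactSupport (by fun_prop) hψc.mul_left
    · filter_upwards [compl_mem_ae_iff.2 (measure_singleton (0 : ℂ))] with a ha
      have ha : 0 < ‖a‖ := norm_pos_iff.2 ha
      have hε : 0 < (((n : ℝ) + 1) ^ 2)⁻¹ := by positivity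
      have hε1 : (((n : ℝ) + 1) ^ 2)⁻¹ ≤ 1 :=
        inv_le_one_of_one_le₀ (one_le_pow₀ (by linarith [n.cast_nonneg (α := ℝ)]))
      set ε := (((n : ℝ) + 1) ^ 2)⁻¹
      have hs : 0 < ‖a‖ ^ 2 + ε := by positivity
      have h3 := abs_log_sq_le (Real.sqrt_pos.2 hs)
      rw [Real.sq_sqrt hs.le] at h3
      have h4 : √(‖a‖ ^ 2 + ε) ≤ ‖a‖ + 1 := by
        rw [Real.sqrt_le_left (by positivity)]; nlinarith
      have h5 : (√(‖a‖ ^ 2 + ε))⁻¹ ≤ ‖a‖⁻¹ := by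
        gcongr
        exact Real.le_sqrt_of_sq_le (by linarith)
      rw [norm_mul, norm_mul, norm_mul, norm_mul, norm_inv, norm_real, norm_real, Real.norm_eq_abs,
        Real.norm_of_nonneg (by positivity : 0 ≤ 2 * (‖a‖ + 1))]
      simp only [Complex.norm_ofNat]
      calc |Real.log (‖a‖ ^ 2 + ε)| * ‖ψ a‖ ≤ 2 * ((‖a‖ + 1) + ‖a‖⁻¹) * ‖ψ a‖ := by
            gcongr; linarith
        _ = _ := by ring
    · filter_upwards [compl_mem_ae_iff.2 (measure_singleton (0 : ℂ))] with a ha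
      have ha : 0 < ‖a‖ := norm_pos_iff.2 ha
      have hl : Tendsto (fun n : ℕ => ((((n : ℝ) + 1) ^ 2)⁻¹ : ℝ)) atTop (𝓝 0) :=
        tendsto_inv_atTop_zero.comp ((tendsto_pow_atTop two_ne_zero).comp
          (tendsto_atTop_add_const_right _ _ tendsto_natCast_atTop_atTop))
      have hl2 := hl.const_add (‖a‖ ^ 2)
      rw [add_zero] at hl2
      have hl3 := (Real.continuousAt_log (by positivity : ‖a‖ ^ 2 ≠ 0)).tendsto.comp hl2
      exact ((continuous_ofReal.tendsto _).comp hl3).mul_const _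
  refine tendsto_nhds_unique h2 (h1.congr fun n => ?_)
  rw [integral_mul_wd (contDiff_log_normSq_add (by positivity)) hφ hc]
  congr 2
  ext a
  rw [wd_log_normSq_add (by positivity)]
  simp only [regInv, neg_mul, I_mul_I]
  ring

end Pompeiu

/-! ### Convolution with tempered kernels and weak derivatives. -/

section Convolution

set_option linter.unusedSectionVars false

variable {E : Type*} [NormedAddCommGroup E] [NormedSpace ℝ E] [FiniteDimensional ℝ E]
  [MeasureSpace E] [BorelSpace E] [(volume : Measure E).IsAddHaarMeasure]

/-- The convolution of `h` with the complex measure `K dμ`. -/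
noncomputable def conv (μ : Measure E) (K h : E → ℂ) (z : E) : ℂ := ∫ η, K η * h (z - η) ∂μ

/-- Measurable functions of rapid decay. -/
structure Rapid (h : E → ℂ) : Prop where
  measurable : Measurable h
  decay : ∀ k : ℕ, ∃ C, ∀ ζ, (1 + ‖ζ‖) ^ k * ‖h ζ‖ ≤ C

/-- Kernels of moderate growth. -/
structure Tempered (μ : Measure E) (K : E → ℂ) : Prop where
  aesm : AEStronglyMeasurable K μ
  integrable : Integrable (fun η => ((1 + ‖η‖) ^ 7)⁻¹ * ‖K η‖) μ

/-- A Peetre inequality: it trades decay in `z - η` for decay in `η`, at the price of polynomial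
growth in `z`. -/
theorem one_add_norm_le_mul (z η : E) : 1 + ‖η‖ ≤ (1 + ‖z‖) * (1 + ‖z - η‖) := by
  have h := norm_sub_le z (z - η)
  rw [sub_sub_cancel] at h
  nlinarith [norm_nonneg z, norm_nonneg (z - η), mul_nonneg (norm_nonneg z) (norm_nonneg (z - η))]

theorem Rapid.exists_decay {h : E → ℂ} (hh : Rapid h) (k : ℕ) :
    ∃ C, 0 ≤ C ∧ ∀ ζ, ‖h ζ‖ ≤ C * ((1 + ‖ζ‖) ^ k)⁻¹ := by
  obtain ⟨C, hC⟩ := hh.decay k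
  refine ⟨C, le_trans (by positivity) (hC 0), fun ζ => ?_⟩
  have hp : 0 < (1 + ‖ζ‖) ^ k := by positivity
  rw [← div_eq_mul_inv, le_div_iff₀ hp, mul_comm]
  exact hC ζ

theorem Rapid.exists_decay_sub {h : E → ℂ} (hh : Rapid h) :
    ∃ C, 0 ≤ C ∧ ∀ z η, ‖h (z - η)‖ ≤ C * (1 + ‖z‖) ^ 7 * ((1 + ‖η‖) ^ 7)⁻¹ := by
  obtain ⟨C, hC0, hC⟩ := hh.exists_decay 7
  refine ⟨C, hC0, fun z η => (hC _).trans ?_⟩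
  rw [mul_assoc]
  gcongr
  have h1 : (1 + ‖η‖) ^ 7 ≤ (1 + ‖z‖) ^ 7 * (1 + ‖z - η‖) ^ 7 := by
    rw [← mul_pow]; gcongr; exact one_add_norm_le_mul z η
  have hp : 0 < (1 + ‖z - η‖) ^ 7 := by positivity
  have hp' : 0 < (1 + ‖η‖) ^ 7 := by positivity
  rw [← div_eq_mul_inv, le_div_iff₀ hp', inv_mul_eq_div, div_le_iff₀ hp]
  exact h1


theorem Rapid.integrable_pow_mul {h : E → ℂ} (hh : Rapid h) (k : ℕ) :
    Integrable (fun ζ => (1 + ‖ζ‖) ^ k * ‖h ζ‖) := by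
  obtain ⟨C, hC0, hC⟩ := hh.exists_decay (k + (Module.finrank ℝ E + 1))
  have hi : Integrable (fun ζ : E => (1 + ‖ζ‖) ^ (-((Module.finrank ℝ E + 1 : ℕ) : ℝ))) :=
    integrable_one_add_norm (by push_cast; linarith)
  have hm := hh.measurable
  refine (hi.const_mul C).mono' (by fun_prop) (ae_of_all _ fun ζ => ?_)
  rw [Real.norm_of_nonneg (by positivity), Real.rpow_neg (by positivity), Real.rpow_natCast]
  calc (1 + ‖ζ‖) ^ k * ‖h ζ‖
      ≤ (1 + ‖ζ‖) ^ k * (C * ((1 + ‖ζ‖) ^ (k + (Module.finrank ℝ E + 1)))⁻¹) := by gcongr; exact hC ζ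
    _ = _ := by rw [pow_add]; field_simp

theorem Rapid.integrable {h : E → ℂ} (hh : Rapid h) : Integrable h := by
  have := hh.integrable_pow_mul 0
  simp only [pow_zero, one_mul] at this
  exact (integrable_norm_iff hh.measurable.aestronglyMeasurable).1 this

variable {μ : Measure E} {K h : E → ℂ}

theorem Tempered.conv_integrable (hK : Tempered μ K) (hh : Rapid h) (z : E) :
    Integrable (fun η => K η * h (z - η)) μ := by
  obtain ⟨C, hC0, hC⟩ := hh.exists_decay_sub
  have hm := hh.measurable
  refine (hK.integrable.const_mul (C * (1 + ‖z‖) ^ 7)).mono'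
    (hK.aesm.mul (by fun_prop : Measurable fun η => h (z - η)).aestronglyMeasurable)
    (ae_of_all _ fun η => ?_)
  rw [norm_mul]
  calc ‖K η‖ * ‖h (z - η)‖ ≤ ‖K η‖ * (C * (1 + ‖z‖) ^ 7 * ((1 + ‖η‖) ^ 7)⁻¹) := by
        gcongr; exact hC z η
    _ = _ := by ring

/-- Dominated convergence. Continuity of `h` is asked for only almost everywhere, since odd
extensions jump across the real axes. -/
theorem continuousAt_conv (hK : Tempered μ K) (hh : Rapid h) {z : E}
    (hc : ∀ᵐ η ∂μ, ContinuousAt h (z - η)) : ContinuousAt (conv μ K h) z := by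
  obtain ⟨C, hC0, hC⟩ := hh.exists_decay_sub
  have hm := hh.measurable
  refine continuousAt_of_dominated
    (bound := fun η => (C * (1 + (‖z‖ + 1)) ^ 7) * (((1 + ‖η‖) ^ 7)⁻¹ * ‖K η‖))
    (Eventually.of_forall fun w => (hK.conv_integrable hh w).aestronglyMeasurable) ?_
    (hK.integrable.const_mul _) ?_
  · have : ∀ᶠ w in 𝓝 z, ‖w‖ < ‖z‖ + 1 := continuous_norm.continuousAt.eventually_lt
      continuousAt_const (by linarith)
    filter_upwards [this] with w hw
    refine ae_of_all _ fun η => ?_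
    rw [norm_mul]
    calc ‖K η‖ * ‖h (w - η)‖ ≤ ‖K η‖ * (C * (1 + (‖z‖ + 1)) ^ 7 * ((1 + ‖η‖) ^ 7)⁻¹) := by
          gcongr
          refine (hC w η).trans ?_
          gcongr
      _ = _ := by ring
  · filter_upwards [hc] with η hη
    exact continuousAt_const.mul (ContinuousAt.comp' (f := fun w => w - η) hη (by fun_prop))

theorem exists_decay_of_hasCompactSupport {ψ : E → ℂ} (hψ : Continuous ψ)
    (hc : HasCompactSupport ψ) (k : ℕ) :
    ∃ C, 0 ≤ C ∧ ∀ z, ‖ψ z‖ ≤ C * ((1 + ‖z‖) ^ k)⁻¹ := by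
  obtain ⟨C, hC⟩ := (hc.comp_left (g := fun x => ‖x‖) (by simp)).mul_left
    (f := fun a : E => (1 + ‖a‖) ^ k) |>.exists_bound_of_continuous (by fun_prop)
  refine ⟨C, (norm_nonneg _).trans (hC 0), fun z => ?_⟩
  have hp : 0 < (1 + ‖z‖) ^ k := by positivity
  rw [← div_eq_mul_inv, le_div_iff₀ hp, mul_comm]
  refine (le_abs_self _).trans ?_
  simpa using hC z

theorem Tempered.integrable_mul (hK : Tempered μ K) {ψ : E → ℂ} (hψ : Continuous ψ)
    (hc : HasCompactSupport ψ) : Integrable (fun η => K η * ψ η) μ := by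
  obtain ⟨C, hC0, hC⟩ := exists_decay_of_hasCompactSupport hψ hc 7
  refine (hK.integrable.const_mul C).mono' (hK.aesm.mul hψ.aestronglyMeasurable)
    (ae_of_all _ fun η => ?_)
  rw [norm_mul]
  calc ‖K η‖ * ‖ψ η‖ ≤ ‖K η‖ * (C * ((1 + ‖η‖) ^ 7)⁻¹) := by gcongr; exact hC η
    _ = _ := by ring

variable [SFinite μ]

theorem integrable_conv_prod (hK : Tempered μ K) (hh : Rapid h) {ψ : E → ℂ} (hψ : Continuous ψ)
    (hc : HasCompactSupport ψ) :
    Integrable (fun p : E × E => K p.2 * h (p.1 - p.2) * ψ p.1) (volume.prod μ) := by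
  obtain ⟨C, hC0, hC⟩ := hh.exists_decay_sub
  have hm := hh.measurable
  have i1 : Integrable (fun z => (1 + ‖z‖) ^ 7 * ‖ψ z‖) :=
    Continuous.integrable_of_hasCompactSupport (by fun_prop)
      (hc.comp_left (g := fun x => ‖x‖) (by simp)).mul_left
  refine ((i1.mul_prod hK.integrable).const_mul C).mono' ?_ (ae_of_all _ fun p => ?_)
  · refine (hK.aesm.comp_snd.mul ?_).mul (hψ.comp continuous_fst).aestronglyMeasurable
    exact (hm.comp (measurable_fst.sub measurable_snd)).aestronglyMeasurable
  · rw [norm_mul, norm_mul]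
    calc ‖K p.2‖ * ‖h (p.1 - p.2)‖ * ‖ψ p.1‖
        ≤ ‖K p.2‖ * (C * (1 + ‖p.1‖) ^ 7 * ((1 + ‖p.2‖) ^ 7)⁻¹) * ‖ψ p.1‖ := by
          gcongr; exact hC _ _
      _ = _ := by ring

theorem integrable_conv_prod' (hK : Tempered μ K) (hh : Rapid h) {ψ : E → ℂ} (hψ : Continuous ψ)
    (hc : HasCompactSupport ψ) :
    Integrable (fun p : E × E => h p.1 * (K p.2 * ψ (p.1 + p.2))) (volume.prod μ) := by
  obtain ⟨C, hC0, hC⟩ := exists_decay_of_hasCompactSupport hψ hc 7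
  have hm := hh.measurable
  refine (((hh.integrable_pow_mul 7).mul_prod hK.integrable).const_mul C).mono' ?_
    (ae_of_all _ fun p => ?_)
  · refine (hm.comp measurable_fst).aestronglyMeasurable.mul (hK.aesm.comp_snd.mul ?_)
    exact (hψ.comp (continuous_fst.add continuous_snd)).aestronglyMeasurable
  · rw [norm_mul, norm_mul]
    have h1 : ((1 + ‖p.1 + p.2‖) ^ 7)⁻¹ ≤ (1 + ‖p.1‖) ^ 7 * ((1 + ‖p.2‖) ^ 7)⁻¹ := by
      have h2 : 1 + ‖p.2‖ ≤ (1 + ‖p.1‖) * (1 + ‖p.1 + p.2‖) := by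
        have := one_add_norm_le_mul (-p.1) p.2
        rwa [norm_neg, ← norm_neg (-p.1 - p.2), neg_sub, sub_neg_eq_add, add_comm p.2] at this
      have h3 : (1 + ‖p.2‖) ^ 7 ≤ (1 + ‖p.1‖) ^ 7 * (1 + ‖p.1 + p.2‖) ^ 7 := by
        rw [← mul_pow]; gcongr
      have hp : 0 < (1 + ‖p.1 + p.2‖) ^ 7 := by positivity
      have hp' : 0 < (1 + ‖p.2‖) ^ 7 := by positivity
      rw [← div_eq_mul_inv, le_div_iff₀ hp', inv_mul_eq_div, div_le_iff₀ hp]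
      exact h3
    calc ‖h p.1‖ * (‖K p.2‖ * ‖ψ (p.1 + p.2)‖)
        ≤ ‖h p.1‖ * (‖K p.2‖ * (C * ((1 + ‖p.1‖) ^ 7 * ((1 + ‖p.2‖) ^ 7)⁻¹))) := by
          gcongr
          refine (hC _).trans ?_
          gcongr
      _ = _ := by ring

/-- Fubini and a translation. This form keeps `h` next to the test function, for derivatives that
fall on `h`; `integral_conv_mul'` keeps the kernel next to it, for derivatives that fall on the
kernel. -/
theorem integral_conv_mul (hK : Tempered μ K) (hh : Rapid h) {ψ : E → ℂ} (hψ : Continuous ψ)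
    (hc : HasCompactSupport ψ) :
    ∫ z, conv μ K h z * ψ z = ∫ η, K η * (∫ ζ, h ζ * ψ (ζ + η)) ∂μ := by
  simp only [conv]
  simp_rw [← integral_mul_const]
  rw [integral_integral_swap (integrable_conv_prod hK hh hψ hc)]
  congr 1
  ext η
  rw [← integral_const_mul, ← integral_add_right_eq_self _ η]
  congr 1
  ext ζ
  rw [add_sub_cancel_right]
  ring

theorem integral_conv_mul' (hK : Tempered μ K) (hh : Rapid h) {ψ : E → ℂ} (hψ : Continuous ψ)
    (hc : HasCompactSupport ψ) :
    ∫ z, conv μ K h z * ψ z = ∫ ζ, h ζ * ∫ η, K η * ψ (ζ + η) ∂μ := by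
  rw [integral_conv_mul hK hh hψ hc]
  simp_rw [← integral_const_mul]
  rw [integral_integral_swap (f := fun ζ η => h ζ * (K η * ψ (ζ + η)))
    (integrable_conv_prod' hK hh hψ hc)]
  congr 1
  ext η
  congr 1
  ext ζ
  ring

/-- `G` is the derivative of `F` in direction `e` on `U`, in the sense of distributions. -/
def WeakDir (U : Set E) (e : E) (F G : E → ℂ) : Prop :=
  ∀ φ : E → ℂ, ContDiff ℝ 1 φ → HasCompactSupport φ → tsupport φ ⊆ U →
    ∫ z, F z * fderiv ℝ φ z e = - ∫ z, G z * φ z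

/-- `G = (∂_{e₁} F + c ∂_{e₂} F) / 2` on `U`, in the sense of distributions. -/
def WeakWd (U : Set E) (c : ℂ) (e₁ e₂ : E) (F G : E → ℂ) : Prop :=
  ∀ φ : E → ℂ, ContDiff ℝ 1 φ → HasCompactSupport φ → tsupport φ ⊆ U →
    ∫ z, F z * wd c e₁ e₂ φ z = - ∫ z, G z * φ z

/-- `(∂_{e₁} + c ∂_{e₂}) / 2` maps the measure `K dμ` to `K₁ dμ₁ + K₂ dμ₂`, in the sense of
distributions. -/
def KernelWd (c : ℂ) (e₁ e₂ : E) (μ : Measure E) (K : E → ℂ) (μ₁ : Measure E) (K₁ : E → ℂ)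
    (μ₂ : Measure E) (K₂ : E → ℂ) : Prop :=
  ∀ φ : E → ℂ, ContDiff ℝ 1 φ → HasCompactSupport φ →
    ∫ z, K z * wd c e₁ e₂ φ z ∂μ = - (∫ z, K₁ z * φ z ∂μ₁ + ∫ z, K₂ z * φ z ∂μ₂)

/-- Translation invariance: for each `ζ` the kernel identity is tested on `η ↦ φ (ζ + η)`, then
integrated against `h`. -/
theorem weakWd_conv {c : ℂ} {e₁ e₂ : E} {μ₁ μ₂ : Measure E} [SFinite μ₁] [SFinite μ₂]
    {K₁ K₂ : E → ℂ} (hw : KernelWd c e₁ e₂ μ K μ₁ K₁ μ₂ K₂) (hK : Tempered μ K)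
    (hK₁ : Tempered μ₁ K₁) (hK₂ : Tempered μ₂ K₂) (hh : Rapid h) :
    WeakWd Set.univ c e₁ e₂ (conv μ K h) (fun z => conv μ₁ K₁ h z + conv μ₂ K₂ h z) := by
  intro φ hφ hc _
  have i1 := (integrable_conv_prod hK₁ hh hφ.continuous hc).integral_prod_left
  have i2 := (integrable_conv_prod hK₂ hh hφ.continuous hc).integral_prod_left
  have j1 := (integrable_conv_prod' hK₁ hh hφ.continuous hc).integral_prod_left
  have j2 := (integrable_conv_prod' hK₂ hh hφ.continuous hc).integral_prod_left
  simp only [integral_mul_const, integral_const_mul] at i1 i2 j1 j2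
  rw [integral_conv_mul' hK hh (continuous_wd hφ) (hasCompactSupport_wd hc)]
  simp_rw [add_mul]
  rw [integral_add (f := fun z => conv μ₁ K₁ h z * φ z) (g := fun z => conv μ₂ K₂ h z * φ z) i1 i2,
    integral_conv_mul' hK₁ hh hφ.continuous hc, integral_conv_mul' hK₂ hh hφ.continuous hc,
    ← integral_add j1 j2, ← integral_neg]
  congr 1
  ext ζ
  have h1 := hw (fun η => φ (ζ + η)) (by fun_prop) (hc.comp_homeomorph (Homeomorph.addLeft ζ))
  have h2 : ∀ η, wd c e₁ e₂ (fun η => φ (ζ + η)) η = wd c e₁ e₂ φ (ζ + η) := fun η => by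
    simp only [wd, fderiv_comp_add_left]
  simp_rw [h2] at h1
  rw [h1]
  ring

/-- Only a derivative of `h` along the single direction `e` is used, because odd extensions are
differentiable along the boundary but not across it. -/
theorem weakDir_conv {e : E} {h' : E → ℂ} (hK : Tempered μ K) (hh : Rapid h) (hh' : Rapid h')
    (hd : ∀ z, HasLineDerivAt ℝ h (h' z) z e) :
    WeakDir Set.univ e (conv μ K h) (conv μ K h') := by
  intro φ hφ hc _
  have hφ' := hφ.continuous_fderiv (by simp)
  have hφc := hφ.continuous
  rw [integral_conv_mul hK hh (by fun_prop) (hc.fderiv_apply ℝ e),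
    integral_conv_mul hK hh' hφ.continuous hc, ← integral_neg]
  congr 1
  ext η
  rw [← mul_neg]
  congr 1
  obtain ⟨C, hC⟩ := hc.exists_bound_of_continuous hφc
  obtain ⟨C', hC'⟩ := (hc.fderiv_apply ℝ e).exists_bound_of_continuous (by fun_prop)
  refine integral_bilinear_hasLineDerivAt_right_eq_neg_left_of_integrable (v := e)
    (B := ContinuousLinearMap.mul ℝ ℂ) (f := h) (f' := h') (g := fun ζ => φ (ζ + η))
    (g' := fun ζ => fderiv ℝ φ (ζ + η) e) ?_ ?_ ?_ (fun x _ => hd x) (fun x _ => ?_)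
  · exact hh'.integrable.mul_bdd (c := C) (by fun_prop) (ae_of_all _ fun x => hC _)
  · exact hh.integrable.mul_bdd (c := C') (by fun_prop) (ae_of_all _ fun x => hC' _)
  · exact hh.integrable.mul_bdd (c := C) (by fun_prop) (ae_of_all _ fun x => hC _)
  · have h1 : HasFDerivAt (fun ζ => φ (ζ + η)) (fderiv ℝ φ (x + η)) x := by
      exact (hasFDerivAt_comp_add_right η).2 (hφ.differentiable (by simp) (x + η)).hasFDerivAt
    exact h1.hasLineDerivAt e

end Convolution

/-! ### From distributional to classical derivatives. -/

section WeakToClassical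

set_option linter.unusedSectionVars false

variable {E : Type*} [NormedAddCommGroup E] [NormedSpace ℝ E] [FiniteDimensional ℝ E]
  [MeasureSpace E] [BorelSpace E] [(volume : Measure E).IsAddHaarMeasure]

/-- A continuous function whose distributional derivatives are continuous is differentiable. -/
theorem hasFDerivAt_of_weakDir {U : Set E} (hU : IsOpen U) {F : E → ℂ} (hF : Continuous F)
    {L : E → E →L[ℝ] ℂ} (hL : Continuous L) (h : ∀ e, WeakDir U e F (fun z => L z e)) {z : E}
    (hz : z ∈ U) : HasFDerivAt F (L z) z := by
  obtain ⟨r, hr, hrU⟩ := Metric.isOpen_iff.1 hU z hz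
  let ρ : ℕ → ContDiffBump (0 : E) := fun n =>
    { rIn := 1 / ((n : ℝ) + 1) / 2, rOut := 1 / ((n : ℝ) + 1), rIn_pos := by positivity,
      rIn_lt_rOut := by
        have : 0 < 1 / ((n : ℝ) + 1) := by positivity
        linarith }
  have hρ : Tendsto (fun n => (ρ n).rOut) atTop (𝓝 0) := tendsto_one_div_add_atTop_nhds_zero_nat
  let f : ℕ → E → ℂ := fun n =>
    convolution ((ρ n).normed volume) F (ContinuousLinearMap.lsmul ℝ ℝ) volume
  let f' : ℕ → E → E →L[ℝ] ℂ := fun n =>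
    convolution ((ρ n).normed volume) L (ContinuousLinearMap.lsmul ℝ ℝ) volume
  -- The mollifications satisfy `D(ρ * F) = ρ * L` wherever the bump fits inside `U`: the weak
  -- derivative is tested against the reflected bump `w ↦ g (x - w)`. The factor `2` leaves room for
  -- the closed support.
  have hmain : ∀ n x, Metric.ball x (2 * (ρ n).rOut) ⊆ U → HasFDerivAt (f n) (f' n x) x := by
    intro n x hx
    have hsm : ContDiff ℝ 1 ((ρ n).normed (volume : Measure E)) := (ρ n).contDiff_normed
    have hcs : HasCompactSupport ((ρ n).normed (volume : Measure E)) :=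
      (ρ n).hasCompactSupport_normed
    have h1 := hcs.hasFDerivAt_convolution_left (ContinuousLinearMap.lsmul ℝ ℝ) hsm
      (hF.locallyIntegrable (μ := volume)) x
    refine h1.congr_fderiv ?_
    ext e
    set g := (ρ n).normed (volume : Measure E) with hg
    have hg' := hsm.continuous_fderiv (by simp)
    have hgc := hsm.continuous
    have a1 : Integrable (fun t => ((ContinuousLinearMap.lsmul ℝ ℝ).precompL E)
        (fderiv ℝ g t) (F (x - t))) :=
      (HasCompactSupport.convolutionExists_left _ (hcs.fderiv ℝ) hg'
        (hF.locallyIntegrable (μ := volume))) x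
    have a2 : Integrable (fun t => (ContinuousLinearMap.lsmul ℝ ℝ) (g t) (L (x - t))) :=
      (HasCompactSupport.convolutionExists_left _ hcs hgc
        (hL.locallyIntegrable (μ := volume))) x
    simp only [f', convolution]
    rw [ContinuousLinearMap.integral_apply a1, ContinuousLinearMap.integral_apply a2]
    simp only [ContinuousLinearMap.precompL_apply, ContinuousLinearMap.lsmul_apply, smul_apply]
    have hφ1 : ContDiff ℝ 1 (fun w => ((g (x - w) : ℝ) : ℂ)) :=
      Complex.ofRealCLM.contDiff.comp (hsm.comp (contDiff_const.sub contDiff_id))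
    have hφ2 : HasCompactSupport (fun w => ((g (x - w) : ℝ) : ℂ)) :=
      (hcs.comp_homeomorph (Homeomorph.subLeft x)).comp_left (g := fun r : ℝ => (r : ℂ)) (by simp)
    have hφ3 : tsupport (fun w => ((g (x - w) : ℝ) : ℂ)) ⊆ U := by
      refine Set.Subset.trans ?_ hx
      have : Function.support (fun w => ((g (x - w) : ℝ) : ℂ)) ⊆
          Metric.closedBall x (ρ n).rOut := by
        intro w hw
        have hw' : x - w ∈ Function.support g := by
          simpa using hw
        rw [hg, (ρ n).support_normed_eq, Metric.mem_ball, dist_zero_right] at hw'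
        rw [Metric.mem_closedBall, dist_eq_norm, norm_sub_rev]
        exact hw'.le
      refine (closure_minimal this Metric.isClosed_closedBall).trans
        (Metric.closedBall_subset_ball ?_)
      linarith [(ρ n).rOut_pos]
    have h2 := h e _ hφ1 hφ2 hφ3
    have hder : ∀ w, fderiv ℝ (fun w => ((g (x - w) : ℝ) : ℂ)) w e
        = -((fderiv ℝ g (x - w) e : ℝ) : ℂ) := by
      intro w
      have b1 : HasFDerivAt (fun w => x - w) (-(ContinuousLinearMap.id ℝ E)) w := by
        simpa using (hasFDerivAt_id w).const_sub x
      have b2 := (hsm.differentiable (by simp) (x - w)).hasFDerivAt.comp w b1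
      have b3 : HasFDerivAt (fun w => ((g (x - w) : ℝ) : ℂ)) _ w :=
        Complex.ofRealCLM.hasFDerivAt.comp w b2
      rw [b3.fderiv]
      simp
    simp_rw [hder, mul_neg] at h2
    rw [integral_neg, neg_inj] at h2
    have s1 := integral_sub_left_eq_self
      (fun w => F w * ((fderiv ℝ g (x - w) e : ℝ) : ℂ)) volume x
    have s2 := integral_sub_left_eq_self
      (fun w => L w e * ((g (x - w) : ℝ) : ℂ)) volume x
    rw [← s1, ← s2] at h2
    simp only [sub_sub_cancel] at h2
    simp only [Complex.real_smul]
    simp_rw [mul_comm _ (F _), mul_comm _ (L _ e)]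
    exact h2
  -- The mollified derivatives converge uniformly near `z` because `L` is continuous, so the limit
  -- may be differentiated.
  refine hasFDerivAt_of_tendstoUniformlyOnFilter (l := atTop) (f := f) (f' := f') ?_ ?_ ?_
  · rw [tendstoUniformlyOnFilter_iff_tendsto]
    have t1 : Tendsto (fun q : ℕ × E => f' q.1 q.2) (atTop ×ˢ 𝓝 z) (𝓝 (L z)) :=
      ContDiffBump.convolution_tendsto_right (φ := fun q : ℕ × E => ρ q.1)
        (hρ.comp tendsto_fst) (Eventually.of_forall fun _ => hL.aestronglyMeasurable)
        ((hL.tendsto z).comp tendsto_snd) tendsto_snd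
    have t2 : Tendsto (fun q : ℕ × E => L q.2) (atTop ×ˢ 𝓝 z) (𝓝 (L z)) :=
      (hL.tendsto z).comp tendsto_snd
    exact (t2.prodMk_nhds t1).mono_right (nhds_le_uniformity _)
  · have h1 : ∀ᶠ n in atTop, 2 * (ρ n).rOut < r / 2 := by
      have := hρ.const_mul 2
      rw [mul_zero] at this
      exact this.eventually_lt_const (by linarith)
    have h2 : ∀ᶠ x in 𝓝 z, dist x z < r / 2 := Metric.ball_mem_nhds z (by linarith)
    filter_upwards [h1.prod_mk h2] with p hp
    refine hmain _ _ ((Metric.ball_subset_ball' ?_).trans hrU)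
    linarith [hp.1, hp.2]
  · exact Eventually.of_forall fun y =>
      ContDiffBump.convolution_tendsto_right hρ
        (Eventually.of_forall fun _ => hF.aestronglyMeasurable)
        ((hF.tendsto y).comp tendsto_snd) tendsto_const_nhds

/-- Solves `(∂_{e₁} + c ∂_{e₂}) F = 2H` for `∂_{e₂} F`. This is how derivatives across the boundary
are reached: the tangential derivative and a Wirtinger derivative are known, the normal one is not.
-/
theorem WeakDir.of_wd {U : Set E} {c : ℂ} (hc : c ≠ 0) {e₁ e₂ : E} {F G H : E → ℂ}
    (hF : Continuous F) (hG : Continuous G) (hH : Continuous H) (h₁ : WeakDir U e₁ F G)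
    (h₂ : WeakWd U c e₁ e₂ F H) : WeakDir U e₂ F (fun z => c⁻¹ * (2 * H z - G z)) := by
  intro φ hφ hcs hs
  have hφ' := hφ.continuous_fderiv (by simp)
  have hφc := hφ.continuous
  have a1 := h₁ φ hφ hcs hs
  have a2 := h₂ φ hφ hcs hs
  have w := continuous_wd (c := c) (e₁ := e₁) (e₂ := e₂) hφ
  have e : ∀ z, F z * fderiv ℝ φ z e₂
      = (2 * c⁻¹) * (F z * wd c e₁ e₂ φ z) - c⁻¹ * (F z * fderiv ℝ φ z e₁) := fun z => by
    simp only [wd]; field_simp; ring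
  have e' : ∀ z, c⁻¹ * (2 * H z - G z) * φ z
      = (2 * c⁻¹) * (H z * φ z) - c⁻¹ * (G z * φ z) := fun z => by ring
  simp_rw [e, e']
  rw [integral_sub, integral_sub]
  · simp_rw [integral_const_mul, a1, a2]
    ring
  · exact (Continuous.integrable_of_hasCompactSupport (by fun_prop) hcs.mul_left).const_mul _
  · exact (Continuous.integrable_of_hasCompactSupport (by fun_prop) hcs.mul_left).const_mul _
  · exact (Continuous.integrable_of_hasCompactSupport (by fun_prop)
      (hasCompactSupport_wd hcs).mul_left).const_mul _
  · exact (Continuous.integrable_of_hasCompactSupport (by fun_prop)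
      (hcs.fderiv_apply ℝ e₁).mul_left).const_mul _

end WeakToClassical

/-! ### Gradients on `ℂ²` and regularity up to the closure. -/

section Gradient

open Complex

/-- The real linear map on `ℂ²` with prescribed values on the standard real basis. -/
noncomputable def gradCLM (X₁ Y₁ X₂ Y₂ : ℂ) : ℂ × ℂ →L[ℝ] ℂ :=
  (reCLM.comp (.fst ℝ ℂ ℂ)).smulRight X₁ + (imCLM.comp (.fst ℝ ℂ ℂ)).smulRight Y₁
    + (reCLM.comp (.snd ℝ ℂ ℂ)).smulRight X₂ + (imCLM.comp (.snd ℝ ℂ ℂ)).smulRight Y₂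

theorem gradCLM_apply (X₁ Y₁ X₂ Y₂ : ℂ) (e : ℂ × ℂ) :
    gradCLM X₁ Y₁ X₂ Y₂ e = e.1.re * X₁ + e.1.im * Y₁ + e.2.re * X₂ + e.2.im * Y₂ := by
  simp [gradCLM]

theorem contDiffOn_gradCLM {n : WithTop ℕ∞} {s : Set (ℂ × ℂ)} {X₁ Y₁ X₂ Y₂ : ℂ × ℂ → ℂ}
    (h₁ : ContDiffOn ℝ n X₁ s) (h₂ : ContDiffOn ℝ n Y₁ s) (h₃ : ContDiffOn ℝ n X₂ s)
    (h₄ : ContDiffOn ℝ n Y₂ s) :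
    ContDiffOn ℝ n (fun z => gradCLM (X₁ z) (Y₁ z) (X₂ z) (Y₂ z)) s := by
  rw [contDiffOn_clm_apply]
  intro e
  simp_rw [gradCLM_apply]
  exact (((contDiffOn_const.mul h₁).add (contDiffOn_const.mul h₂)).add
    (contDiffOn_const.mul h₃)).add (contDiffOn_const.mul h₄)

instance isAddHaarMeasure_volume_complex_prod :
    (volume : Measure (ℂ × ℂ)).IsAddHaarMeasure :=
  inferInstanceAs ((volume : Measure ℂ).prod (volume : Measure ℂ)).IsAddHaarMeasure

/-- A continuous function on `ℂ²` with continuous distributional partial derivatives on `U`. -/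
structure WeakGrad (U : Set (ℂ × ℂ)) (F X₁ Y₁ X₂ Y₂ : ℂ × ℂ → ℂ) : Prop where
  cont : Continuous F
  contX₁ : Continuous X₁
  contY₁ : Continuous Y₁
  contX₂ : Continuous X₂
  contY₂ : Continuous Y₂
  weakX₁ : WeakDir U (1, 0) F X₁
  weakY₁ : WeakDir U (I, 0) F Y₁
  weakX₂ : WeakDir U (0, 1) F X₂
  weakY₂ : WeakDir U (0, I) F Y₂

variable {U : Set (ℂ × ℂ)} {F X₁ Y₁ X₂ Y₂ : ℂ × ℂ → ℂ}

theorem WeakGrad.continuous_gradCLM (h : WeakGrad U F X₁ Y₁ X₂ Y₂) :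
    Continuous (fun z => gradCLM (X₁ z) (Y₁ z) (X₂ z) (Y₂ z)) :=
  contDiff_zero.1 (contDiffOn_univ.1 (contDiffOn_gradCLM (contDiff_zero.2 h.contX₁).contDiffOn
    (contDiff_zero.2 h.contY₁).contDiffOn (contDiff_zero.2 h.contX₂).contDiffOn
    (contDiff_zero.2 h.contY₂).contDiffOn))

theorem integral_add₄ {α : Type*} [MeasurableSpace α] {μ : Measure α} {f₁ f₂ f₃ f₄ : α → ℂ}
    (h₁ : Integrable f₁ μ) (h₂ : Integrable f₂ μ) (h₃ : Integrable f₃ μ) (h₄ : Integrable f₄ μ) :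
    ∫ x, f₁ x + f₂ x + f₃ x + f₄ x ∂μ
      = ∫ x, f₁ x ∂μ + ∫ x, f₂ x ∂μ + ∫ x, f₃ x ∂μ + ∫ x, f₄ x ∂μ := by
  have h₁₂ : Integrable (fun x => f₁ x + f₂ x) μ := h₁.add h₂
  have h₁₃ : Integrable (fun x => f₁ x + f₂ x + f₃ x) μ := h₁₂.add h₃
  rw [integral_add h₁₃ h₄, integral_add h₁₂ h₃, integral_add h₁ h₂]

theorem WeakGrad.hasFDerivAt (h : WeakGrad U F X₁ Y₁ X₂ Y₂) (hU : IsOpen U) {z : ℂ × ℂ}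
    (hz : z ∈ U) : HasFDerivAt F (gradCLM (X₁ z) (Y₁ z) (X₂ z) (Y₂ z)) z := by
  refine hasFDerivAt_of_weakDir hU h.cont h.continuous_gradCLM (fun e φ hφ hc hs => ?_) hz
  have c1 := h.contX₁
  have c2 := h.contY₁
  have c3 := h.contX₂
  have c4 := h.contY₂
  have c5 := h.cont
  have hφ' := hφ.continuous_fderiv (by simp)
  have hφc := hφ.continuous
  have i : ∀ {G : ℂ × ℂ → ℂ}, Continuous G → ∀ k : ℂ, Integrable (fun z => k * (G z * φ z)) :=
    fun hG k => (Continuous.integrable_of_hasCompactSupport (by fun_prop) hc.mul_left).const_mul _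
  have j : ∀ (v : ℂ × ℂ) (k : ℂ), Integrable (fun z => k * (F z * fderiv ℝ φ z v)) :=
    fun v k => (Continuous.integrable_of_hasCompactSupport (by fun_prop)
      (hc.fderiv_apply ℝ v).mul_left).const_mul _
  have e1 : ∀ z, F z * fderiv ℝ φ z e = (e.1.re : ℂ) * (F z * fderiv ℝ φ z (1, 0))
      + (e.1.im : ℂ) * (F z * fderiv ℝ φ z (I, 0)) + (e.2.re : ℂ) * (F z * fderiv ℝ φ z (0, 1))
      + (e.2.im : ℂ) * (F z * fderiv ℝ φ z (0, I)) := by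
    intro z
    have he : e = e.1.re • ((1, 0) : ℂ × ℂ) + e.1.im • ((I, 0) : ℂ × ℂ)
        + e.2.re • ((0, 1) : ℂ × ℂ) + e.2.im • ((0, I) : ℂ × ℂ) := by
      ext <;> simp
    conv_lhs => rw [he]
    simp only [map_add, map_smul, real_smul]
    ring
  have e2 : ∀ z, gradCLM (X₁ z) (Y₁ z) (X₂ z) (Y₂ z) e * φ z = (e.1.re : ℂ) * (X₁ z * φ z)
      + (e.1.im : ℂ) * (Y₁ z * φ z) + (e.2.re : ℂ) * (X₂ z * φ z)
      + (e.2.im : ℂ) * (Y₂ z * φ z) := by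
    intro z
    rw [gradCLM_apply]
    ring
  simp_rw [e1, e2]
  rw [integral_add₄ (j _ _) (j _ _) (j _ _) (j _ _), integral_add₄ (i c1 _) (i c2 _) (i c3 _)
    (i c4 _)]
  simp_rw [integral_const_mul, h.weakX₁ φ hφ hc hs, h.weakX₂ φ hφ hc hs, h.weakY₁ φ hφ hc hs,
    h.weakY₂ φ hφ hc hs]
  ring

theorem WeakGrad.contDiffOn_succ (h : WeakGrad U F X₁ Y₁ X₂ Y₂) (hU : IsOpen U) {n : ℕ}
    (h₁ : ContDiffOn ℝ n X₁ U) (h₂ : ContDiffOn ℝ n Y₁ U) (h₃ : ContDiffOn ℝ n X₂ U)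
    (h₄ : ContDiffOn ℝ n Y₂ U) : ContDiffOn ℝ (n + 1) F U := by
  rw [contDiffOn_succ_iff_hasFDerivWithinAt_of_uniqueDiffOn hU.uniqueDiffOn]
  refine ⟨by simp, _, ?_, fun z hz => (h.hasFDerivAt hU hz).hasFDerivWithinAt⟩
  exact contDiffOn_gradCLM h₁ h₂ h₃ h₄

/-- The weak identities are known on `U` only, but the candidate gradient is continuous everywhere.
On a convex open set, limits of the derivative at boundary points are derivatives within the
closure. -/
theorem WeakGrad.contDiffOn_closure_succ (h : WeakGrad U F X₁ Y₁ X₂ Y₂) (hU : IsOpen U)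
    (hc : Convex ℝ U) (hne : U.Nonempty) {n : ℕ}
    (h₁ : ContDiffOn ℝ n X₁ (closure U)) (h₂ : ContDiffOn ℝ n Y₁ (closure U))
    (h₃ : ContDiffOn ℝ n X₂ (closure U)) (h₄ : ContDiffOn ℝ n Y₂ (closure U)) :
    ContDiffOn ℝ (n + 1) F (closure U) := by
  have hu : UniqueDiffOn ℝ (closure U) :=
    uniqueDiffOn_convex hc.closure (hne.mono (interior_maximal subset_closure hU))
  rw [contDiffOn_succ_iff_hasFDerivWithinAt_of_uniqueDiffOn hu]
  refine ⟨by simp, fun z => gradCLM (X₁ z) (Y₁ z) (X₂ z) (Y₂ z), ?_, fun z hz => ?_⟩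
  · exact contDiffOn_gradCLM h₁ h₂ h₃ h₄
  · refine hasFDerivWithinAt_closure_of_tendsto_fderiv
      (fun w hw => (h.hasFDerivAt hU hw).differentiableAt.differentiableWithinAt) hc hU
      (fun w _ => h.cont.continuousWithinAt) ?_
    refine (h.continuous_gradCLM.continuousWithinAt (s := U) (x := z)).tendsto.congr' ?_
    filter_upwards [self_mem_nhdsWithin] with w hw
    exact (h.hasFDerivAt hU hw).fderiv.symm

end Gradient

/-! ### The kernels and their size. -/

section Kernels

open Complex

/-- Lebesgue measure or the Dirac mass at the origin. -/
noncomputable def axisMeasure : Bool → Measure ℂ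
  | true => volume
  | false => Measure.dirac 0

instance sigmaFinite_axisMeasure (s : Bool) : SigmaFinite (axisMeasure s) := by
  cases s
  · exact inferInstanceAs (SigmaFinite (Measure.dirac (0 : ℂ)))
  · exact inferInstanceAs (SigmaFinite (volume : Measure ℂ))

/-- Lebesgue measure on a coordinate subspace of `ℂ²`. -/
noncomputable def axesMeasure (s₁ s₂ : Bool) : Measure (ℂ × ℂ) :=
  (axisMeasure s₁).prod (axisMeasure s₂)

instance sigmaFinite_axesMeasure (s₁ s₂ : Bool) : SigmaFinite (axesMeasure s₁ s₂) :=
  inferInstanceAs (SigmaFinite ((axisMeasure s₁).prod (axisMeasure s₂)))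

theorem integrable_singDecay_axisMeasure (s : Bool) : Integrable singDecay (axisMeasure s) := by
  cases s
  · exact integrable_dirac (by simp)
  · exact integrable_singDecay

theorem ae_ne_zero_volume : ∀ᵐ a : ℂ ∂(axisMeasure true), a ≠ 0 :=
  compl_mem_ae_iff.2 (measure_singleton (μ := (volume : Measure ℂ)) (0 : ℂ))

theorem ae_fst_ne_zero (s : Bool) : ∀ᵐ η ∂(axesMeasure true s), η.1 ≠ 0 :=
  Measure.quasiMeasurePreserving_fst.ae ae_ne_zero_volume

theorem ae_snd_ne_zero (s : Bool) : ∀ᵐ η ∂(axesMeasure s true), η.2 ≠ 0 :=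
  Measure.quasiMeasurePreserving_snd.ae ae_ne_zero_volume

/-- Accounts for the exponent `7` in `Tempered`: one power absorbs the growth `1 + ‖η‖`, and three
powers in each variable turn `sing` into the integrable `singDecay`. -/
theorem tempered_of_le {s₁ s₂ : Bool} {K : ℂ × ℂ → ℂ} (hK : Measurable K) (C : ℝ)
    (h : ∀ᵐ η ∂(axesMeasure s₁ s₂), ‖K η‖ ≤ C * ((1 + ‖η‖) * (sing η.1 * sing η.2))) :
    Tempered (axesMeasure s₁ s₂) K := by
  refine ⟨hK.aestronglyMeasurable, ?_⟩
  have hi : Integrable (fun η : ℂ × ℂ => singDecay η.1 * singDecay η.2) (axesMeasure s₁ s₂) :=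
    (integrable_singDecay_axisMeasure s₁).mul_prod (integrable_singDecay_axisMeasure s₂)
  refine (hi.const_mul |C|).mono' (by fun_prop) ?_
  filter_upwards [h] with η hη
  rw [Real.norm_of_nonneg (by positivity)]
  have h1 : ‖η.1‖ ≤ ‖η‖ := norm_fst_le η
  have h2 : ‖η.2‖ ≤ ‖η‖ := norm_snd_le η
  have p1 := one_le_sing η.1
  have p2 := one_le_sing η.2
  have h3 : ‖K η‖ ≤ |C| * ((1 + ‖η‖) * (sing η.1 * sing η.2)) := by
    refine hη.trans ?_
    gcongr
    exact le_abs_self C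
  calc ((1 + ‖η‖) ^ 7)⁻¹ * ‖K η‖
      ≤ ((1 + ‖η‖) ^ 7)⁻¹ * (|C| * ((1 + ‖η‖) * (sing η.1 * sing η.2))) := by gcongr
    _ = |C| * ((((1 + ‖η‖) ^ 3)⁻¹ * ((1 + ‖η‖) ^ 3)⁻¹) * (sing η.1 * sing η.2)) := by
        have : 0 < 1 + ‖η‖ := by positivity
        field_simp
    _ ≤ |C| * ((((1 + ‖η.1‖) ^ 3)⁻¹ * ((1 + ‖η.2‖) ^ 3)⁻¹) * (sing η.1 * sing η.2)) := by
        gcongr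
    _ = _ := by unfold singDecay; ring

theorem tempered_zero (s₁ s₂ : Bool) : Tempered (axesMeasure s₁ s₂) (fun _ => 0) :=
  tempered_of_le measurable_const 0 (ae_of_all _ fun _ => by simp)

theorem Tempered.const_mul {s₁ s₂ : Bool} {K : ℂ × ℂ → ℂ} (hK : Tempered (axesMeasure s₁ s₂) K)
    (k : ℂ) : Tempered (axesMeasure s₁ s₂) (fun η => k * K η) := by
  refine ⟨hK.aesm.const_mul k, (hK.integrable.const_mul ‖k‖).congr (ae_of_all _ fun η => ?_)⟩
  simp only [norm_mul]
  ring

theorem wd_fst (c : ℂ) {φ : ℂ × ℂ → ℂ} (hφ : ContDiff ℝ 1 φ) (a b : ℂ) :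
    wd c (1, 0) (I, 0) φ (a, b) = wd c 1 I (fun x => φ (x, b)) a := by
  have h : HasFDerivAt (fun x : ℂ => (x, b)) (ContinuousLinearMap.inl ℝ ℂ ℂ) a :=
    hasFDerivAt_prodMk_left a b
  have h2 : HasFDerivAt (fun x => φ (x, b)) _ a :=
    ((hφ.differentiable (by simp) (a, b)).hasFDerivAt).comp a h
  simp [wd, h2.fderiv]

theorem wd_snd (c : ℂ) {φ : ℂ × ℂ → ℂ} (hφ : ContDiff ℝ 1 φ) (a b : ℂ) :
    wd c (0, 1) (0, I) φ (a, b) = wd c 1 I (fun x => φ (a, x)) b := by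
  have h : HasFDerivAt (fun x : ℂ => (a, x)) (ContinuousLinearMap.inr ℝ ℂ ℂ) b :=
    hasFDerivAt_prodMk_right a b
  have h2 : HasFDerivAt (fun x => φ (a, x)) _ b :=
    ((hφ.differentiable (by simp) (a, b)).hasFDerivAt).comp b h
  simp [wd, h2.fderiv]

theorem hasCompactSupport_slice_fst {φ : ℂ × ℂ → ℂ} (hc : HasCompactSupport φ) (b : ℂ) :
    HasCompactSupport (fun a => φ (a, b)) := by
  refine HasCompactSupport.intro (hc.isCompact.image continuous_fst) fun a ha => ?_
  by_contra h
  exact ha ⟨(a, b), subset_tsupport _ h, rfl⟩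

theorem hasCompactSupport_slice_snd {φ : ℂ × ℂ → ℂ} (hc : HasCompactSupport φ) (a : ℂ) :
    HasCompactSupport (fun b => φ (a, b)) := by
  refine HasCompactSupport.intro (hc.isCompact.image continuous_snd) fun b hb => ?_
  by_contra h
  exact hb ⟨(a, b), subset_tsupport _ h, rfl⟩

/-- By Fubini a kernel identity in one variable need only hold on almost every slice. The measure in
the differentiated variable may change from Lebesgue to Dirac, the other one is kept. -/
theorem kernelWd_fst {c : ℂ} {s t u r : Bool} {K K₁ K₂ : ℂ × ℂ → ℂ}
    (hK : Tempered (axesMeasure s r) K) (hK₁ : Tempered (axesMeasure t r) K₁)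
    (hK₂ : Tempered (axesMeasure u r) K₂)
    (h : ∀ᵐ b ∂(axisMeasure r), ∀ ψ : ℂ → ℂ, ContDiff ℝ 1 ψ → HasCompactSupport ψ →
      ∫ a, K (a, b) * wd c 1 I ψ a ∂(axisMeasure s)
        = - (∫ a, K₁ (a, b) * ψ a ∂(axisMeasure t) + ∫ a, K₂ (a, b) * ψ a ∂(axisMeasure u))) :
    KernelWd c (1, 0) (I, 0) (axesMeasure s r) K (axesMeasure t r) K₁ (axesMeasure u r) K₂ := by
  intro φ hφ hc
  have i0 := hK.integrable_mul (continuous_wd (c := c) (e₁ := (1, 0)) (e₂ := (I, 0)) hφ)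
    (hasCompactSupport_wd hc)
  have i1 := hK₁.integrable_mul hφ.continuous hc
  have i2 := hK₂.integrable_mul hφ.continuous hc
  simp only [axesMeasure] at i0 i1 i2 ⊢
  rw [integral_prod_symm _ i0, integral_prod_symm _ i1, integral_prod_symm _ i2,
    ← integral_add i1.integral_prod_right i2.integral_prod_right, ← integral_neg]
  refine integral_congr_ae ?_
  filter_upwards [h] with b hb
  simp_rw [wd_fst c hφ]
  exact hb _ (by fun_prop) (hasCompactSupport_slice_fst hc b)

theorem kernelWd_snd {c : ℂ} {s t u r : Bool} {K K₁ K₂ : ℂ × ℂ → ℂ}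
    (hK : Tempered (axesMeasure r s) K) (hK₁ : Tempered (axesMeasure r t) K₁)
    (hK₂ : Tempered (axesMeasure r u) K₂)
    (h : ∀ᵐ a ∂(axisMeasure r), ∀ ψ : ℂ → ℂ, ContDiff ℝ 1 ψ → HasCompactSupport ψ →
      ∫ b, K (a, b) * wd c 1 I ψ b ∂(axisMeasure s)
        = - (∫ b, K₁ (a, b) * ψ b ∂(axisMeasure t) + ∫ b, K₂ (a, b) * ψ b ∂(axisMeasure u))) :
    KernelWd c (0, 1) (0, I) (axesMeasure r s) K (axesMeasure r t) K₁ (axesMeasure r u) K₂ := by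
  intro φ hφ hc
  have i0 := hK.integrable_mul (continuous_wd (c := c) (e₁ := (0, 1)) (e₂ := (0, I)) hφ)
    (hasCompactSupport_wd hc)
  have i1 := hK₁.integrable_mul hφ.continuous hc
  have i2 := hK₂.integrable_mul hφ.continuous hc
  simp only [axesMeasure] at i0 i1 i2 ⊢
  rw [integral_prod _ i0, integral_prod _ i1, integral_prod _ i2,
    ← integral_add i1.integral_prod_left i2.integral_prod_left, ← integral_neg]
  refine integral_congr_ae ?_
  filter_upwards [h] with a ha
  simp_rw [wd_snd c hφ]
  exact ha _ (by fun_prop) (hasCompactSupport_slice_snd hc a)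

/-- The Cauchy kernel `1 / (π a)`, or `1` for the Dirac mass. -/
noncomputable def cauchyKer : Bool → ℂ → ℂ
  | true => fun a => (Real.pi : ℂ)⁻¹ * a⁻¹
  | false => fun _ => 1

/-- The kernel of the product of the canonical solution operators of the half-planes. -/
noncomputable def kerT (s₁ s₂ : Bool) (η : ℂ × ℂ) : ℂ := cauchyKer s₁ η.1 * cauchyKer s₂ η.2

/-- `|a|² + |b|²`. -/
noncomputable def nsq (η : ℂ × ℂ) : ℝ := ‖η.1‖ ^ 2 + ‖η.2‖ ^ 2

/-- The constant `1 / (2 π²)`. -/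
noncomputable def kerConst : ℂ := (2 * (Real.pi : ℂ) ^ 2)⁻¹

/-- The kernel `log |a|² / (4 π)` of the Green operator of the first variable. -/
noncomputable def kerG (η : ℂ × ℂ) : ℂ := (4 * (Real.pi : ℂ))⁻¹ * (Real.log (‖η.1‖ ^ 2) : ℂ)

/-- The kernel `log (|a|² + |b|²) / (2 π² b)`. -/
noncomputable def kerW (η : ℂ × ℂ) : ℂ := kerConst * (η.2⁻¹ * (Real.log (nsq η) : ℂ))

/-- The kernel `1 / (2 π² (|a|² + |b|²))`, twice the fundamental solution of `-Δ` on `ℂ²`. -/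
noncomputable def kerV (η : ℂ × ℂ) : ℂ := kerConst * (nsq η : ℂ)⁻¹

/-- The kernel `ā / (2 π² b (|a|² + |b|²))`. -/
noncomputable def kerY (η : ℂ × ℂ) : ℂ :=
  kerConst * (η.2⁻¹ * ((starRingEnd ℂ) η.1 * (nsq η : ℂ)⁻¹))

/-- The kernel `b̄ / (2 π² (|a|² + |b|²)²)`. -/
noncomputable def kerZ (η : ℂ × ℂ) : ℂ := kerConst * ((starRingEnd ℂ) η.2 * ((nsq η : ℂ)⁻¹) ^ 2)

theorem sqrt_pow_bound {s t : ℝ} (hs : 0 ≤ s) (ht : 0 ≤ t) : s ^ 3 * t ^ 5 ≤ (s ^ 4 + t ^ 4) ^ 2 := by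
  rcases le_total s t with h | h
  · have h1 : s ^ 3 * t ^ 5 ≤ t ^ 3 * t ^ 5 := by gcongr
    have : 0 ≤ s ^ 8 := by positivity
    have : 0 ≤ s ^ 4 * t ^ 4 := by positivity
    nlinarith
  · have h1 : s ^ 3 * t ^ 5 ≤ s ^ 4 * t ^ 4 := by
      have : 0 ≤ s ^ 3 * t ^ 4 := by positivity
      nlinarith
    have : 0 ≤ s ^ 8 := by positivity
    have : 0 ≤ t ^ 8 := by positivity
    nlinarith

theorem inv_sqrt_pow_le_sing (a : ℂ) : (√‖a‖ ^ 3)⁻¹ ≤ sing a := by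
  have e : ‖a‖ ^ (-(3 / 2) : ℝ) = (√‖a‖ ^ 3)⁻¹ := by
    rw [Real.rpow_neg (norm_nonneg a), Real.sqrt_eq_rpow, ← Real.rpow_natCast,
      ← Real.rpow_mul (norm_nonneg a)]
    norm_num
  unfold sing
  rw [e]
  linarith

/-- Both sides scale with degree `-3`. In the variables `s = √x`, `t = √y` the bound is `s³ t⁵ ≤ (s⁴
+ t⁴)²`, which is `sqrt_pow_bound`. -/
theorem norm_mul_inv_sq_le {x y : ℝ} {sx sy : ℝ} (hx : 0 < x) (hy : 0 < y)
    (h1 : (√x ^ 3)⁻¹ ≤ sx) (h2 : (√y ^ 3)⁻¹ ≤ sy) :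
    y * ((x ^ 2 + y ^ 2)⁻¹) ^ 2 ≤ sx * sy := by
  have hsx := Real.sqrt_pos.2 hx
  have hsy := Real.sqrt_pos.2 hy
  have h3 := sqrt_pow_bound hsx.le hsy.le
  have ex : x = √x ^ 2 := (Real.sq_sqrt hx.le).symm
  have ey : y = √y ^ 2 := (Real.sq_sqrt hy.le).symm
  calc y * ((x ^ 2 + y ^ 2)⁻¹) ^ 2 = √y ^ 2 * ((√x ^ 4 + √y ^ 4) ^ 2)⁻¹ := by
        rw [← inv_pow]; nth_rewrite 1 [ey]; rw [show x ^ 2 = √x ^ 4 by nth_rewrite 1 [ex]; ring,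
          show y ^ 2 = √y ^ 4 by nth_rewrite 1 [ey]; ring]
    _ ≤ √y ^ 2 * (√x ^ 3 * √y ^ 5)⁻¹ := by gcongr
    _ = (√x ^ 3)⁻¹ * (√y ^ 3)⁻¹ := by field_simp
    _ ≤ sx * sy := by gcongr; exact le_trans (by positivity) h1

theorem nsq_nonneg (η : ℂ × ℂ) : 0 ≤ nsq η := by unfold nsq; positivity

theorem norm_ofReal_nsq (η : ℂ × ℂ) : ‖(nsq η : ℂ)‖ = nsq η := by
  rw [norm_real, Real.norm_of_nonneg (nsq_nonneg η)]

theorem norm_kerConst_le : ‖kerConst‖ ≤ 1 := by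
  unfold kerConst
  rw [norm_inv, norm_mul, norm_pow, norm_real, Real.norm_of_nonneg Real.pi_pos.le]
  refine inv_le_one_of_one_le₀ ?_
  have := Real.two_le_pi
  simp only [norm_ofNat]
  nlinarith

theorem measurable_nsq : Measurable nsq := by unfold nsq; fun_prop

theorem norm_cauchyKer_le (s : Bool) (a : ℂ) : ‖cauchyKer s a‖ ≤ sing a := by
  cases s
  · simpa [cauchyKer] using one_le_sing a
  · simp only [cauchyKer, norm_mul, norm_inv, norm_real, Real.norm_of_nonneg Real.pi_pos.le]
    have h1 : Real.pi⁻¹ ≤ 1 := inv_le_one_of_one_le₀ (by linarith [Real.two_le_pi])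
    calc Real.pi⁻¹ * ‖a‖⁻¹ ≤ 1 * ‖a‖⁻¹ := by gcongr
      _ ≤ _ := by rw [one_mul]; exact inv_norm_le_sing a

theorem measurable_cauchyKer (s : Bool) : Measurable (cauchyKer s) := by
  cases s <;> unfold cauchyKer <;> fun_prop

theorem tempered_kerT (s₁ s₂ : Bool) : Tempered (axesMeasure s₁ s₂) (kerT s₁ s₂) := by
  have m1 := measurable_cauchyKer s₁
  have m2 := measurable_cauchyKer s₂
  refine tempered_of_le (by unfold kerT; fun_prop) 1 (ae_of_all _ fun η => ?_)
  have h1 := norm_cauchyKer_le s₁ η.1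
  have h2 := norm_cauchyKer_le s₂ η.2
  have p1 := one_le_sing η.1
  have p2 := one_le_sing η.2
  rw [kerT, norm_mul, one_mul]
  calc ‖cauchyKer s₁ η.1‖ * ‖cauchyKer s₂ η.2‖ ≤ 1 * (sing η.1 * sing η.2) := by
        rw [one_mul]; gcongr
    _ ≤ _ := by gcongr; linarith [norm_nonneg η]

theorem tempered_kerG : Tempered (axesMeasure true false) kerG := by
  refine tempered_of_le (by unfold kerG; fun_prop) 2 ?_
  filter_upwards [ae_fst_ne_zero false] with η hη
  have h0 := norm_pos_iff.2 hη
  have h1 := abs_log_sq_le h0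
  have p1 := one_le_sing η.1
  have p2 := one_le_sing η.2
  have h2 := inv_norm_le_sing η.1
  have h3 := norm_fst_le η
  have hc : ‖(4 * (Real.pi : ℂ))⁻¹‖ ≤ 1 := by
    rw [norm_inv, norm_mul, norm_real, Real.norm_of_nonneg Real.pi_pos.le]
    refine inv_le_one_of_one_le₀ ?_
    have := Real.two_le_pi
    simp only [norm_ofNat]
    linarith
  rw [kerG, norm_mul, norm_real, Real.norm_eq_abs]
  calc _ ≤ 1 * (2 * (‖η.1‖ + ‖η.1‖⁻¹)) := by gcongr
    _ ≤ 2 * ((1 + ‖η‖) * sing η.1) := by nlinarith [norm_nonneg η]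
    _ ≤ 2 * ((1 + ‖η‖) * (sing η.1 * sing η.2)) := by gcongr; nlinarith

theorem tempered_kerW : Tempered (axesMeasure true true) kerW := by
  have := measurable_nsq
  refine tempered_of_le (by unfold kerW; fun_prop) 4 ?_
  filter_upwards [ae_fst_ne_zero true] with η hη
  have h0 := norm_pos_iff.2 hη
  have hs : 0 < nsq η := by unfold nsq; positivity
  have h1 := abs_log_sq_le (Real.sqrt_pos.2 hs)
  rw [Real.sq_sqrt hs.le] at h1
  have p1 := one_le_sing η.1
  have p2 := one_le_sing η.2
  have h2 := inv_norm_le_sing η.1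
  have h3 := norm_fst_le η
  have h4 := norm_snd_le η
  have h5 := inv_norm_le_sing η.2
  have h6 : √(nsq η) ≤ 2 * ‖η‖ := by
    rw [Real.sqrt_le_left (by positivity), nsq]
    nlinarith [norm_nonneg η.1, norm_nonneg η.2]
  have h7 : (√(nsq η))⁻¹ ≤ sing η.1 := by
    refine le_trans ?_ h2
    gcongr
    refine Real.le_sqrt_of_sq_le ?_
    rw [nsq]
    nlinarith [norm_nonneg η.2]
  have hc := norm_kerConst_le
  rw [kerW, norm_mul, norm_mul, norm_inv, norm_real, Real.norm_eq_abs]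
  calc _ ≤ 1 * (sing η.2 * (2 * (2 * ‖η‖ + sing η.1))) := by
        gcongr; linarith
    _ ≤ 1 * (sing η.2 * (2 * (2 * ((1 + ‖η‖) * sing η.1)))) := by
        gcongr; nlinarith [norm_nonneg η]
    _ = _ := by ring

theorem tempered_of_le_sing_mul {s₁ s₂ : Bool} {K : ℂ × ℂ → ℂ} (hK : Measurable K)
    (h : ∀ᵐ η ∂(axesMeasure s₁ s₂), ‖K η‖ ≤ sing η.1 * sing η.2) :
    Tempered (axesMeasure s₁ s₂) (fun η => kerConst * K η) := by
  refine tempered_of_le (by fun_prop) 1 ?_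
  filter_upwards [h] with η hη
  have p1 := one_le_sing η.1
  have p2 := one_le_sing η.2
  rw [norm_mul, one_mul]
  calc ‖kerConst‖ * ‖K η‖ ≤ 1 * (sing η.1 * sing η.2) := by
        gcongr; exact norm_kerConst_le
    _ ≤ _ := by gcongr; linarith [norm_nonneg η]

theorem tempered_kerV : Tempered (axesMeasure true true) kerV := by
  have := measurable_nsq
  refine tempered_of_le_sing_mul (by fun_prop) ?_
  filter_upwards [ae_fst_ne_zero true, ae_snd_ne_zero true] with η h1 h2
  have h1 := norm_pos_iff.2 h1
  have h2 := norm_pos_iff.2 h2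
  have p1 := one_le_sing η.1
  rw [norm_inv, norm_ofReal_nsq]
  calc (nsq η)⁻¹ ≤ (‖η.1‖ * ‖η.2‖)⁻¹ := by
        gcongr; rw [nsq]; nlinarith [sq_nonneg (‖η.1‖ - ‖η.2‖), mul_pos h1 h2]
    _ = ‖η.1‖⁻¹ * ‖η.2‖⁻¹ := by rw [mul_inv]
    _ ≤ _ := by gcongr <;> exact inv_norm_le_sing _

theorem tempered_kerY : Tempered (axesMeasure true true) kerY := by
  have := measurable_nsq
  have hc : Measurable (fun a : ℂ => (starRingEnd ℂ) a) := continuous_conj.measurable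
  refine tempered_of_le_sing_mul (by fun_prop) ?_
  filter_upwards [ae_fst_ne_zero true] with η h1
  have h1 := norm_pos_iff.2 h1
  have p2 := one_le_sing η.2
  rw [norm_mul, norm_mul, norm_inv, norm_inv, norm_ofReal_nsq, RCLike.norm_conj]
  calc ‖η.2‖⁻¹ * (‖η.1‖ * (nsq η)⁻¹) ≤ ‖η.2‖⁻¹ * (‖η.1‖ * (‖η.1‖ ^ 2)⁻¹) := by
        gcongr; rw [nsq]; nlinarith [norm_nonneg η.2]
    _ = ‖η.1‖⁻¹ * ‖η.2‖⁻¹ := by field_simp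
    _ ≤ _ := by gcongr <;> first | exact inv_norm_le_sing _ | exact (zero_le_one.trans (one_le_sing _))

/-- Covers the most singular kernels, those of size `|a| / n²` or `|b| / n²`, which arise as first
derivatives of `kerV` and `kerY`. -/
theorem tempered_sq {p : ℂ × ℂ → ℂ} (hp : Measurable p)
    (h : ∀ η : ℂ × ℂ, ‖p η‖ = ‖η.1‖ ∨ ‖p η‖ = ‖η.2‖) :
    Tempered (axesMeasure true true) (fun η => kerConst * (p η * ((nsq η : ℂ)⁻¹) ^ 2)) := by
  have := measurable_nsq
  refine tempered_of_le_sing_mul (by fun_prop) ?_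
  filter_upwards [ae_fst_ne_zero true, ae_snd_ne_zero true] with η h1 h2
  have h1 := norm_pos_iff.2 h1
  have h2 := norm_pos_iff.2 h2
  rw [norm_mul, norm_pow, norm_inv, norm_ofReal_nsq]
  rcases h η with e | e
  · rw [e, mul_comm (sing _), nsq, add_comm]
    exact norm_mul_inv_sq_le h2 h1 (inv_sqrt_pow_le_sing _) (inv_sqrt_pow_le_sing _)
  · rw [e, nsq]
    exact norm_mul_inv_sq_le h1 h2 (inv_sqrt_pow_le_sing _) (inv_sqrt_pow_le_sing _)

theorem tempered_kerZ : Tempered (axesMeasure true true) kerZ := by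
  have hc : Measurable (fun a : ℂ => (starRingEnd ℂ) a) := continuous_conj.measurable
  exact tempered_sq (p := fun η => (starRingEnd ℂ) η.2) (by fun_prop) fun η =>
    Or.inr (RCLike.norm_conj _)

end Kernels

/-! ### Distributional derivatives of the kernels. -/

section KernelDerivatives

open Complex

theorem integral_cauchyKer_mul_wd {ψ : ℂ → ℂ} (hψ : ContDiff ℝ 1 ψ) (hc : HasCompactSupport ψ) :
    ∫ a, cauchyKer true a * wd I 1 I ψ a = - ψ 0 := by
  simp only [cauchyKer, mul_assoc]
  rw [integral_const_mul, integral_inv_mul_wd hψ hc]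
  have : (Real.pi : ℂ) ≠ 0 := by exact_mod_cast Real.pi_ne_zero
  field_simp

theorem kernelWd_kerT_fst (s : Bool) :
    KernelWd I (1, 0) (I, 0) (axesMeasure true s) (kerT true s) (axesMeasure false s)
      (kerT false s) (axesMeasure false s) (fun _ => 0) := by
  refine kernelWd_fst (tempered_kerT _ _) (tempered_kerT _ _) (tempered_zero _ _)
    (ae_of_all _ fun b ψ hψ hc => ?_)
  have e : ∀ a, kerT true s (a, b) * wd I 1 I ψ a
      = cauchyKer s b * (cauchyKer true a * wd I 1 I ψ a) := fun a => by simp only [kerT]; ring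
  simp_rw [e]
  rw [integral_const_mul]
  have h := integral_cauchyKer_mul_wd hψ hc
  simp only [axisMeasure, zero_mul, integral_zero, add_zero, integral_dirac] at h ⊢
  rw [h]
  simp [kerT, cauchyKer]

theorem kernelWd_kerT_snd (s : Bool) :
    KernelWd I (0, 1) (0, I) (axesMeasure s true) (kerT s true) (axesMeasure s false)
      (kerT s false) (axesMeasure s false) (fun _ => 0) := by
  refine kernelWd_snd (tempered_kerT _ _) (tempered_kerT _ _) (tempered_zero _ _)
    (ae_of_all _ fun a ψ hψ hc => ?_)
  have e : ∀ b, kerT s true (a, b) * wd I 1 I ψ b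
      = cauchyKer s a * (cauchyKer true b * wd I 1 I ψ b) := fun b => by simp only [kerT]; ring
  simp_rw [e]
  rw [integral_const_mul]
  have h := integral_cauchyKer_mul_wd hψ hc
  simp only [axisMeasure, zero_mul, integral_zero, add_zero, integral_dirac] at h ⊢
  rw [h]
  simp [kerT, cauchyKer]

/-- From `∂ log |a|² = 1/a` one gets `1 / (4π a)`, a quarter of the Cauchy kernel. -/
theorem kernelWd_kerG :
    KernelWd (-I) (1, 0) (I, 0) (axesMeasure true false) kerG (axesMeasure true false)
      (fun η => (1 / 4 : ℂ) * kerT true false η) (axesMeasure true false) (fun _ => 0) := by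
  refine kernelWd_fst tempered_kerG ((tempered_kerT _ _).const_mul _) (tempered_zero _ _)
    (ae_of_all _ fun b ψ hψ hc => ?_)
  have h := integral_log_mul_wd hψ hc
  simp only [axisMeasure, zero_mul, integral_zero, add_zero, kerG, kerT, cauchyKer, mul_assoc,
    one_mul, integral_const_mul, h]
  have : (Real.pi : ℂ) ≠ 0 := by exact_mod_cast Real.pi_ne_zero
  field_simp

theorem ofReal_nsq_fst (a b : ℂ) :
    (nsq (a, b) : ℂ) = a * (starRingEnd ℂ) a + ((‖b‖ ^ 2 : ℝ) : ℂ) := by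
  rw [mul_conj, normSq_eq_norm_sq, nsq]
  push_cast; rfl

theorem ofReal_nsq_snd (a b : ℂ) :
    (nsq (a, b) : ℂ) = b * (starRingEnd ℂ) b + ((‖a‖ ^ 2 : ℝ) : ℂ) := by
  rw [mul_conj, normSq_eq_norm_sq, nsq]
  push_cast; ring

/-- Kernels that are smooth in the first variable may be differentiated classically. -/
theorem kernelWd_fst_of_contDiff {c : ℂ} {K K₁ : ℂ × ℂ → ℂ} {m : ℂ → ℂ → ℂ} {k : ℂ → ℂ}
    (hK : Tempered (axesMeasure true true) K) (hK₁ : Tempered (axesMeasure true true) K₁)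
    (hm : ∀ b, b ≠ 0 → ContDiff ℝ 1 (m b)) (hKm : ∀ a b, K (a, b) = k b * m b a)
    (hK₁m : ∀ a b, b ≠ 0 → K₁ (a, b) = k b * wd c 1 I (m b) a) :
    KernelWd c (1, 0) (I, 0) (axesMeasure true true) K (axesMeasure true true) K₁
      (axesMeasure true true) (fun _ => 0) := by
  refine kernelWd_fst hK hK₁ (tempered_zero _ _) ?_
  filter_upwards [ae_ne_zero_volume] with b hb ψ hψ hc
  have h := integral_mul_wd (μ := volume) (c := c) (e₁ := 1) (e₂ := I) (hm b hb) hψ hc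
  simp_rw [hKm, hK₁m _ _ hb, mul_assoc, zero_mul, axisMeasure, integral_const_mul, h]
  simp

/-- Kernels that are smooth in the second variable may be differentiated classically. -/
theorem kernelWd_snd_of_contDiff {c : ℂ} {K K₁ : ℂ × ℂ → ℂ} {m : ℂ → ℂ → ℂ} {k : ℂ → ℂ}
    (hK : Tempered (axesMeasure true true) K) (hK₁ : Tempered (axesMeasure true true) K₁)
    (hm : ∀ a, a ≠ 0 → ContDiff ℝ 1 (m a)) (hKm : ∀ a b, K (a, b) = k a * m a b)
    (hK₁m : ∀ a b, a ≠ 0 → K₁ (a, b) = k a * wd c 1 I (m a) b) :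
    KernelWd c (0, 1) (0, I) (axesMeasure true true) K (axesMeasure true true) K₁
      (axesMeasure true true) (fun _ => 0) := by
  refine kernelWd_snd hK hK₁ (tempered_zero _ _) ?_
  filter_upwards [ae_ne_zero_volume] with a ha ψ hψ hc
  have h := integral_mul_wd (μ := volume) (c := c) (e₁ := 1) (e₂ := I) (hm a ha) hψ hc
  simp_rw [hKm, hK₁m _ _ ha, mul_assoc, zero_mul, axisMeasure, integral_const_mul, h]
  simp

/-- Kernels with a Cauchy singularity in the second variable. -/
theorem kernelWd_snd_of_inv_mul {K K₁ K₂ : ℂ × ℂ → ℂ} {m : ℂ → ℂ → ℂ} {k : ℂ → ℂ}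
    (hK : Tempered (axesMeasure true true) K) (hK₁ : Tempered (axesMeasure true true) K₁)
    (hK₂ : Tempered (axesMeasure true false) K₂)
    (hm : ∀ a, a ≠ 0 → ContDiff ℝ 1 (m a)) (hKm : ∀ a b, K (a, b) = k a * (b⁻¹ * m a b))
    (hK₁m : ∀ a b, a ≠ 0 → b ≠ 0 → K₁ (a, b) = k a * (b⁻¹ * wd I 1 I (m a) b))
    (hK₂m : ∀ a, a ≠ 0 → K₂ (a, 0) = k a * (Real.pi * m a 0)) :
    KernelWd I (0, 1) (0, I) (axesMeasure true true) K (axesMeasure true true) K₁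
      (axesMeasure true false) K₂ := by
  refine kernelWd_snd hK hK₁ hK₂ ?_
  filter_upwards [ae_ne_zero_volume] with a ha ψ hψ hc
  have h := integral_inv_mul_mul_wd (hm a ha) hψ hc
  have e : ∫ b, K₁ (a, b) * ψ b ∂(axisMeasure true)
      = k a * ∫ b, b⁻¹ * wd I 1 I (m a) b * ψ b := by
    rw [← integral_const_mul]
    refine integral_congr_ae ?_
    filter_upwards [ae_ne_zero_volume] with b hb
    rw [hK₁m a b ha hb]
    ring
  rw [e]
  simp_rw [hKm, mul_assoc] at h ⊢
  simp only [axisMeasure, integral_const_mul, integral_dirac]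
  rw [h, hK₂m a ha]
  ring

theorem kernelWd_kerW_fst :
    KernelWd (-I) (1, 0) (I, 0) (axesMeasure true true) kerW (axesMeasure true true) kerY
      (axesMeasure true true) (fun _ => 0) := by
  refine kernelWd_fst_of_contDiff (k := fun b => kerConst * b⁻¹)
    (m := fun b a => (Real.log (‖a‖ ^ 2 + ‖b‖ ^ 2) : ℂ)) tempered_kerW tempered_kerY
    (fun b hb => contDiff_log_normSq_add (by have := norm_pos_iff.2 hb; positivity))
    (fun a b => by simp only [kerW, nsq]; ring) (fun a b hb => ?_)
  have := norm_pos_iff.2 hb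
  rw [wd_log_normSq_add (by positivity), kerY, ofReal_nsq_fst]
  simp only [neg_mul, I_mul_I]
  ring

/-- For fixed `b ≠ 0`, `∂̄` of `ā / (|a|² + |b|²)` is `|b|² / n²`, and the factor `b` of `|b|²`
cancels the `b⁻¹` in front. -/
theorem kernelWd_kerY_fst :
    KernelWd I (1, 0) (I, 0) (axesMeasure true true) kerY (axesMeasure true true) kerZ
      (axesMeasure true true) (fun _ => 0) := by
  refine kernelWd_fst_of_contDiff (k := fun b => kerConst * b⁻¹)
    (m := fun b => regInv (‖b‖ ^ 2)) tempered_kerY tempered_kerZ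
    (fun b hb => contDiff_regInv (by have := norm_pos_iff.2 hb; positivity))
    (fun a b => by simp only [kerY, regInv, ofReal_nsq_fst]; ring) (fun a b hb => ?_)
  have := norm_pos_iff.2 hb
  rw [wd_regInv (by positivity), kerZ, ofReal_nsq_fst]
  have e : ((‖b‖ ^ 2 : ℝ) : ℂ) = b * (starRingEnd ℂ) b := by
    rw [mul_conj, normSq_eq_norm_sq]
  dsimp only
  rw [e]
  field_simp

theorem contDiff_inv_add {ε : ℝ} (hε : 0 < ε) :
    ContDiff ℝ 1 (fun a : ℂ => (a * (starRingEnd ℂ) a + ε)⁻¹) :=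
  ((contDiff_id.mul contDiff_conj).add contDiff_const).inv fun a => mul_conj_add_ne_zero hε a

theorem wd_inv_add {ε : ℝ} (hε : 0 < ε) (a : ℂ) :
    wd I 1 I (fun a : ℂ => (a * (starRingEnd ℂ) a + ε)⁻¹) a
      = - a * ((a * (starRingEnd ℂ) a + ε)⁻¹) ^ 2 := by
  have h1 : DifferentiableAt ℝ (fun a : ℂ => (starRingEnd ℂ) a) a := differentiable_conj a
  have h2 : DifferentiableAt ℝ (fun a : ℂ => a * (starRingEnd ℂ) a + (ε : ℂ)) a := by fun_prop
  rw [wd_inv h2 (mul_conj_add_ne_zero hε a), wd_mul_conj_add, div_eq_mul_inv,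
    ← inv_pow]
  simp only [I_mul_I]
  ring

theorem kernelWd_kerV_fst :
    KernelWd I (1, 0) (I, 0) (axesMeasure true true) kerV (axesMeasure true true)
      (fun η => kerConst * (-η.1 * ((nsq η : ℂ)⁻¹) ^ 2)) (axesMeasure true true) (fun _ => 0) := by
  refine kernelWd_fst_of_contDiff (k := fun _ => kerConst)
    (m := fun b a => (a * (starRingEnd ℂ) a + ((‖b‖ ^ 2 : ℝ) : ℂ))⁻¹) tempered_kerV
    (tempered_sq (by fun_prop) fun η => Or.inl (norm_neg _))
    (fun b hb => contDiff_inv_add (by have := norm_pos_iff.2 hb; positivity))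
    (fun a b => by simp only [kerV, ofReal_nsq_fst]) (fun a b hb => ?_)
  have := norm_pos_iff.2 hb
  rw [wd_inv_add (by positivity), ofReal_nsq_fst]

theorem kernelWd_kerV_snd :
    KernelWd I (0, 1) (0, I) (axesMeasure true true) kerV (axesMeasure true true)
      (fun η => kerConst * (-η.2 * ((nsq η : ℂ)⁻¹) ^ 2)) (axesMeasure true true) (fun _ => 0) := by
  refine kernelWd_snd_of_contDiff (k := fun _ => kerConst)
    (m := fun a b => (b * (starRingEnd ℂ) b + ((‖a‖ ^ 2 : ℝ) : ℂ))⁻¹) tempered_kerV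
    (tempered_sq (by fun_prop) fun η => Or.inr (norm_neg _))
    (fun b hb => contDiff_inv_add (by have := norm_pos_iff.2 hb; positivity))
    (fun a b => by simp only [kerV, ofReal_nsq_snd]) (fun a b ha => ?_)
  have := norm_pos_iff.2 ha
  rw [wd_inv_add (by positivity), ofReal_nsq_snd]

/-- The derivative of the logarithm is `b / n`, whose `b` cancels `1/b` and gives `kerV`. The pole
`1/b` gives the mass `π log |a|² / (2π²)` on `b = 0`, which is `2 kerG`. -/
theorem kernelWd_kerW_snd :
    KernelWd I (0, 1) (0, I) (axesMeasure true true) kerW (axesMeasure true true) kerV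
      (axesMeasure true false) (fun η => 2 * kerG η) := by
  refine kernelWd_snd_of_inv_mul (k := fun _ => kerConst)
    (m := fun a b => (Real.log (‖b‖ ^ 2 + ‖a‖ ^ 2) : ℂ)) tempered_kerW tempered_kerV
    (tempered_kerG.const_mul 2)
    (fun a ha => contDiff_log_normSq_add (by have := norm_pos_iff.2 ha; positivity))
    (fun a b => by simp only [kerW, nsq, add_comm]) (fun a b ha hb => ?_) (fun a ha => ?_)
  · have := norm_pos_iff.2 ha
    rw [wd_log_normSq_add (by positivity), kerV, ofReal_nsq_snd]
    simp only [I_mul_I]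
    field_simp
    norm_num
    ring
  · simp only [kerG, kerConst, norm_zero, ne_eq, OfNat.ofNat_ne_zero, not_false_eq_true, zero_pow,
      zero_add]
    have : (Real.pi : ℂ) ≠ 0 := by exact_mod_cast Real.pi_ne_zero
    field_simp
    norm_num

/-- The pole at `b = 0` leaves `π ā / (2π² |a|²) = 1 / (2π a)`, half of the Cauchy kernel in the
first variable. -/
theorem kernelWd_kerY_snd :
    KernelWd I (0, 1) (0, I) (axesMeasure true true) kerY (axesMeasure true true)
      (fun η => kerConst * (-(starRingEnd ℂ) η.1 * ((nsq η : ℂ)⁻¹) ^ 2))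
      (axesMeasure true false) (fun η => (1 / 2 : ℂ) * kerT true false η) := by
  have hc : Measurable (fun a : ℂ => (starRingEnd ℂ) a) := continuous_conj.measurable
  refine kernelWd_snd_of_inv_mul (k := fun a => kerConst * (starRingEnd ℂ) a)
    (m := fun a b => (b * (starRingEnd ℂ) b + ((‖a‖ ^ 2 : ℝ) : ℂ))⁻¹) tempered_kerY
    (tempered_sq (by fun_prop) fun η => Or.inl (by rw [norm_neg, RCLike.norm_conj]))
    ((tempered_kerT _ _).const_mul _)
    (fun a ha => contDiff_inv_add (by have := norm_pos_iff.2 ha; positivity))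
    (fun a b => by simp only [kerY, ofReal_nsq_snd]; ring) (fun a b ha hb => ?_) (fun a ha => ?_)
  · have := norm_pos_iff.2 ha
    rw [wd_inv_add (by positivity), ofReal_nsq_snd]
    field_simp
  · have h1 : (Real.pi : ℂ) ≠ 0 := by exact_mod_cast Real.pi_ne_zero
    have h2 : (starRingEnd ℂ) a ≠ 0 := by simpa using ha
    have e : ((‖a‖ ^ 2 : ℝ) : ℂ) = a * (starRingEnd ℂ) a := by
      rw [mul_conj, normSq_eq_norm_sq]
    simp only [kerT, cauchyKer, kerConst, zero_mul, zero_add, e]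
    field_simp

end KernelDerivatives

/-! ### Odd extension of Schwartz functions across the real axes. -/

section OddExtension

open Complex

/-- The product of the upper half-planes in `ℂ × ℂ`. -/
def quadrant : Set (ℂ × ℂ) := {z | 0 < z.1.im ∧ 0 < z.2.im}

/-- Reflection into the closed upper half-plane, or the identity. -/
noncomputable def foldIm : Bool → ℂ → ℂ
  | true => fun a => ⟨a.re, |a.im|⟩
  | false => fun a => a

/-- The sign of the imaginary part, or `1`. -/
noncomputable def signIm : Bool → ℂ → ℂ
  | true => fun a => if 0 < a.im then 1 else if a.im < 0 then -1 else 0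
  | false => fun _ => 1

/-- The extension of `φ` from the upper half-plane which is odd in the selected variables. -/
noncomputable def oddExt (s₁ s₂ : Bool) (φ : ℂ × ℂ → ℂ) (ζ : ℂ × ℂ) : ℂ :=
  signIm s₁ ζ.1 * signIm s₂ ζ.2 * φ (foldIm s₁ ζ.1, foldIm s₂ ζ.2)

theorem norm_foldIm (s : Bool) (a : ℂ) : ‖foldIm s a‖ = ‖a‖ := by
  cases s
  · rfl
  · simp only [foldIm, Complex.norm_def, Complex.normSq_apply, abs_mul_abs_self]

theorem norm_signIm_le (s : Bool) (a : ℂ) : ‖signIm s a‖ ≤ 1 := by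
  cases s
  · simp [signIm]
  · simp only [signIm]
    split_ifs <;> simp

theorem measurable_foldIm (s : Bool) : Measurable (foldIm s) := by
  cases s
  · exact measurable_id
  · have e : foldIm true = fun a => (a.re : ℂ) + (|a.im| : ℝ) * I := by
      ext a
      rw [← mk_eq_add_mul_I]; rfl
    rw [e]
    fun_prop

theorem continuous_foldIm (s : Bool) : Continuous (foldIm s) := by
  cases s
  · exact continuous_id
  · have e : foldIm true = fun a => (a.re : ℂ) + (|a.im| : ℝ) * I := by
      ext a
      rw [← mk_eq_add_mul_I]; rfl
    rw [e]
    fun_prop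

theorem measurable_signIm (s : Bool) : Measurable (signIm s) := by
  cases s
  · exact measurable_const
  · exact Measurable.ite (measurableSet_lt measurable_const measurable_im) measurable_const
      (Measurable.ite (measurableSet_lt measurable_im measurable_const) measurable_const
        measurable_const)

theorem rapid_oddExt (s₁ s₂ : Bool) (φ : 𝓢(ℂ × ℂ, ℂ)) : Rapid (oddExt s₁ s₂ φ) := by
  have m1 := measurable_foldIm s₁
  have m2 := measurable_foldIm s₂
  have m3 := measurable_signIm s₁
  have m4 := measurable_signIm s₂
  have m5 := φ.continuous.measurable
  refine ⟨by unfold oddExt; fun_prop, fun k =>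
    ⟨2 ^ k * (Finset.Iic (k, 0)).sup (fun m => SchwartzMap.seminorm ℝ m.1 m.2) φ, fun ζ => ?_⟩⟩
  have h := SchwartzMap.one_add_le_sup_seminorm_apply (𝕜 := ℝ) (m := (k, 0)) le_rfl le_rfl φ
    (foldIm s₁ ζ.1, foldIm s₂ ζ.2)
  rw [norm_iteratedFDeriv_zero, Prod.norm_mk, norm_foldIm, norm_foldIm] at h
  refine le_trans ?_ h
  have e : ‖ζ‖ = max ‖ζ.1‖ ‖ζ.2‖ := rfl
  rw [e, oddExt, norm_mul, norm_mul]
  gcongr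
  have h1 := norm_signIm_le s₁ ζ.1
  have h2 := norm_signIm_le s₂ ζ.2
  calc _ ≤ 1 * 1 * ‖φ (foldIm s₁ ζ.1, foldIm s₂ ζ.2)‖ := by gcongr
    _ = _ := by ring

theorem continuousAt_signIm {s : Bool} {a : ℂ} (h : s = true → a.im ≠ 0) :
    ContinuousAt (signIm s) a := by
  cases s
  · exact continuousAt_const
  · rcases lt_or_gt_of_ne (h rfl) with h | h
    · have : ∀ᶠ b in 𝓝 a, b.im < 0 := continuous_im.continuousAt.eventually_lt_const h
      refine (continuousAt_const (y := (-1 : ℂ))).congr ?_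
      filter_upwards [this] with b hb
      simp [signIm, hb, hb.le.not_gt]
    · have : ∀ᶠ b in 𝓝 a, 0 < b.im := continuous_im.continuousAt.eventually_const_lt h
      refine (continuousAt_const (y := (1 : ℂ))).congr ?_
      filter_upwards [this] with b hb
      simp [signIm, hb]

theorem continuousAt_oddExt {s₁ s₂ : Bool} {φ : ℂ × ℂ → ℂ} (hφ : Continuous φ) {ζ : ℂ × ℂ}
    (h₁ : s₁ = true → ζ.1.im ≠ 0) (h₂ : s₂ = true → ζ.2.im ≠ 0) :
    ContinuousAt (oddExt s₁ s₂ φ) ζ := by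
  have c1 := continuous_foldIm s₁
  have c2 := continuous_foldIm s₂
  have h3 := ContinuousAt.comp' (f := fun ζ : ℂ × ℂ => ζ.1) (continuousAt_signIm h₁) (by fun_prop)
  have h4 := ContinuousAt.comp' (f := fun ζ : ℂ × ℂ => ζ.2) (continuousAt_signIm h₂) (by fun_prop)
  unfold oddExt
  exact (h3.mul h4).mul (by fun_prop)

theorem ae_im_sub_ne_zero (s : Bool) (z : ℂ) :
    ∀ᵐ a ∂(axisMeasure s), s = true → (z - a).im ≠ 0 := by
  cases s
  · simp
  · have h := (Measure.quasiMeasurePreserving_snd.comp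
      volume_preserving_equiv_real_prod.quasiMeasurePreserving).ae
      (compl_mem_ae_iff.2 (measure_singleton (μ := (volume : Measure ℝ)) z.im))
    filter_upwards [h] with a ha _
    rw [sub_im, sub_ne_zero]
    exact fun h => ha h.symm

theorem ae_continuousAt_oddExt (s₁ s₂ : Bool) {φ : ℂ × ℂ → ℂ} (hφ : Continuous φ) (z : ℂ × ℂ) :
    ∀ᵐ η ∂(axesMeasure s₁ s₂), ContinuousAt (oddExt s₁ s₂ φ) (z - η) := by
  have h1 : ∀ᵐ η ∂(axesMeasure s₁ s₂), s₁ = true → (z.1 - η.1).im ≠ 0 :=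
    Measure.quasiMeasurePreserving_fst.ae (ae_im_sub_ne_zero s₁ z.1)
  have h2 : ∀ᵐ η ∂(axesMeasure s₁ s₂), s₂ = true → (z.2 - η.2).im ≠ 0 :=
    Measure.quasiMeasurePreserving_snd.ae (ae_im_sub_ne_zero s₂ z.2)
  filter_upwards [h1, h2] with η h1 h2
  exact continuousAt_oddExt hφ h1 h2

/-- The directional derivative of a Schwartz function. -/
noncomputable def dirDeriv (e : ℂ × ℂ) (φ : 𝓢(ℂ × ℂ, ℂ)) : 𝓢(ℂ × ℂ, ℂ) :=
  LineDeriv.lineDerivOp e φ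

theorem dirDeriv_apply (e : ℂ × ℂ) (φ : 𝓢(ℂ × ℂ, ℂ)) (z : ℂ × ℂ) :
    dirDeriv e φ z = fderiv ℝ φ z e := rfl

theorem foldIm_add (s : Bool) (a v : ℂ) (t : ℝ) (h : s = true → v.im = 0) :
    foldIm s (a + t • v) = foldIm s a + t • v := by
  cases s
  · rfl
  · apply Complex.ext <;> simp [foldIm, h rfl]

theorem signIm_add (s : Bool) (a v : ℂ) (t : ℝ) (h : s = true → v.im = 0) :
    signIm s (a + t • v) = signIm s a := by
  cases s
  · rfl
  · simp [signIm, h rfl]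

/-- In a direction without imaginary part in the reflected variables, both the sign and the fold
commute with the translation, so the derivative passes to `φ`. -/
theorem hasLineDerivAt_oddExt {s₁ s₂ : Bool} {e : ℂ × ℂ} (h₁ : s₁ = true → e.1.im = 0)
    (h₂ : s₂ = true → e.2.im = 0) (φ : 𝓢(ℂ × ℂ, ℂ)) (z : ℂ × ℂ) :
    HasLineDerivAt ℝ (oddExt s₁ s₂ φ) (oddExt s₁ s₂ (dirDeriv e φ) z) z e := by
  have h := ((φ.hasFDerivAt (foldIm s₁ z.1, foldIm s₂ z.2)).hasLineDerivAt e)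
  rw [HasLineDerivAt] at h ⊢
  have h' := h.const_mul (signIm s₁ z.1 * signIm s₂ z.2)
  refine h'.congr_of_eventuallyEq (Eventually.of_forall fun t => ?_)
  simp only [oddExt, Prod.fst_add, Prod.snd_add, Prod.smul_fst, Prod.smul_snd]
  rw [signIm_add _ _ _ _ h₁, signIm_add _ _ _ _ h₂, foldIm_add _ _ _ _ h₁, foldIm_add _ _ _ _ h₂]
  rfl

theorem oddExt_fst_of_pos (s t s₂ : Bool) (φ : ℂ × ℂ → ℂ) {ζ : ℂ × ℂ} (h : 0 < ζ.1.im) :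
    oddExt s s₂ φ ζ = oddExt t s₂ φ ζ := by
  have h1 : ∀ s, signIm s ζ.1 = 1 := fun s => by cases s <;> simp [signIm, h]
  have h2 : ∀ s, foldIm s ζ.1 = ζ.1 := fun s => by
    cases s
    · rfl
    · apply Complex.ext <;> simp [foldIm, h.le]
  simp only [oddExt, h1, h2]

theorem oddExt_snd_of_pos (s t s₁ : Bool) (φ : ℂ × ℂ → ℂ) {ζ : ℂ × ℂ} (h : 0 < ζ.2.im) :
    oddExt s₁ s φ ζ = oddExt s₁ t φ ζ := by
  have h1 : ∀ s, signIm s ζ.2 = 1 := fun s => by cases s <;> simp [signIm, h]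
  have h2 : ∀ s, foldIm s ζ.2 = ζ.2 := fun s => by
    cases s
    · rfl
    · apply Complex.ext <;> simp [foldIm, h.le]
  simp only [oddExt, h1, h2]

theorem oddExt_conj_fst (s : Bool) (φ : ℂ × ℂ → ℂ) (a b : ℂ) :
    oddExt true s φ ((starRingEnd ℂ) a, b) = - oddExt true s φ (a, b) := by
  have h1 : signIm true ((starRingEnd ℂ) a) = - signIm true a := by
    simp only [signIm, conj_im]
    rcases lt_trichotomy a.im 0 with h | h | h
    · simp [h, h.le.not_gt]
    · simp [h]
    · simp [h, h.le.not_gt]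
  have h2 : foldIm true ((starRingEnd ℂ) a) = foldIm true a := by
    apply Complex.ext <;> simp [foldIm]
  simp only [oddExt, h1, h2]
  ring

theorem oddExt_congr {φ ψ : ℂ × ℂ → ℂ}
    (h : ∀ z : ℂ × ℂ, 0 ≤ z.1.im → 0 ≤ z.2.im → φ z = ψ z) :
    oddExt true true φ = oddExt true true ψ := by
  ext ζ
  simp only [oddExt]
  rw [h _ (by simp [foldIm]) (by simp [foldIm])]

theorem oddExt_swap (s₁ s₂ : Bool) (φ : ℂ × ℂ → ℂ) (ζ : ℂ × ℂ) :
    oddExt s₁ s₂ φ ζ.swap = oddExt s₂ s₁ (fun z => φ z.swap) ζ := by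
  simp only [oddExt, Prod.fst_swap, Prod.snd_swap, Prod.swap_prod_mk]
  ring

end OddExtension

/-! ### Operators acting on odd extensions. -/

section Operators

open Complex

theorem isOpen_quadrant : IsOpen quadrant :=
  (isOpen_lt continuous_const (continuous_im.comp continuous_fst)).inter
    (isOpen_lt continuous_const (continuous_im.comp continuous_snd))

theorem convex_quadrant : Convex ℝ quadrant := by
  intro x hx y hy a b ha hb hab
  have key : ∀ p q : ℝ, 0 < p → 0 < q → 0 < a * p + b * q := fun p q hp hq => by
    rcases ha.eq_or_lt with rfl | ha
    · have : b = 1 := by linarith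
      subst this; simpa using hq
    · have := mul_pos ha hp
      have := mul_nonneg hb hq.le
      linarith
  constructor
  · simpa using key _ _ hx.1 hy.1
  · simpa using key _ _ hx.2 hy.2

theorem quadrant_nonempty : quadrant.Nonempty := ⟨(I, I), by simp [quadrant]⟩

/-- The operator with kernel `K` acting on odd extensions. -/
noncomputable def op (s₁ s₂ : Bool) (K : ℂ × ℂ → ℂ) (φ : 𝓢(ℂ × ℂ, ℂ)) : ℂ × ℂ → ℂ :=
  conv (axesMeasure s₁ s₂) K (oddExt s₁ s₂ φ)

variable {s₁ s₂ : Bool} {K : ℂ × ℂ → ℂ}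

theorem continuous_op (hK : Tempered (axesMeasure s₁ s₂) K) (φ : 𝓢(ℂ × ℂ, ℂ)) :
    Continuous (op s₁ s₂ K φ) :=
  continuous_iff_continuousAt.2 fun z =>
    continuousAt_conv hK (rapid_oddExt s₁ s₂ φ) (ae_continuousAt_oddExt s₁ s₂ φ.continuous z)

theorem weakDir_op (hK : Tempered (axesMeasure s₁ s₂) K) {e : ℂ × ℂ}
    (h₁ : s₁ = true → e.1.im = 0) (h₂ : s₂ = true → e.2.im = 0) (φ : 𝓢(ℂ × ℂ, ℂ)) :
    WeakDir quadrant e (op s₁ s₂ K φ) (op s₁ s₂ K (dirDeriv e φ)) := fun ψ hψ hc _ =>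
  weakDir_conv hK (rapid_oddExt s₁ s₂ φ) (rapid_oddExt s₁ s₂ _) (hasLineDerivAt_oddExt h₁ h₂ φ)
    ψ hψ hc (Set.subset_univ _)

/-- When differentiation has replaced Lebesgue measure by a Dirac mass in the first variable, the
density is only seen at `z.1`, in the upper half-plane, where extended and original functions agree.
The reflection flag may then be dropped. -/
theorem conv_oddExt_fst {t s : Bool} {K : ℂ × ℂ → ℂ} {φ : 𝓢(ℂ × ℂ, ℂ)} {z : ℂ × ℂ}
    (hz : z ∈ quadrant) : conv (axesMeasure t s) K (oddExt true s φ) z = op t s K φ z := by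
  cases t
  · refine integral_congr_ae ?_
    have h : ∀ᵐ η ∂(axesMeasure false s), η.1 = 0 :=
      Measure.quasiMeasurePreserving_fst.ae ((ae_dirac_iff (measurableSet_singleton 0)).2 rfl)
    filter_upwards [h] with η hη
    rw [oddExt_fst_of_pos true false]
    simpa [hη] using hz.1
  · rfl

theorem conv_oddExt_snd {t s : Bool} {K : ℂ × ℂ → ℂ} {φ : 𝓢(ℂ × ℂ, ℂ)} {z : ℂ × ℂ}
    (hz : z ∈ quadrant) : conv (axesMeasure s t) K (oddExt s true φ) z = op s t K φ z := by
  cases t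
  · refine integral_congr_ae ?_
    have h : ∀ᵐ η ∂(axesMeasure s false), η.2 = 0 :=
      Measure.quasiMeasurePreserving_snd.ae ((ae_dirac_iff (measurableSet_singleton 0)).2 rfl)
    filter_upwards [h] with η hη
    rw [oddExt_snd_of_pos true false]
    simpa [hη] using hz.2
  · rfl

theorem integral_mul_congr_of_tsupport {U : Set (ℂ × ℂ)} {F G φ : ℂ × ℂ → ℂ}
    (h : ∀ z ∈ U, F z = G z) (hs : tsupport φ ⊆ U) : ∫ z, F z * φ z = ∫ z, G z * φ z := by
  congr 1
  ext z
  by_cases hz : z ∈ tsupport φ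
  · rw [h z (hs hz)]
  · simp [image_eq_zero_of_notMem_tsupport hz]

theorem weakWd_op_fst {c : ℂ} {s t u : Bool} {K K₁ K₂ : ℂ × ℂ → ℂ}
    (hw : KernelWd c (1, 0) (I, 0) (axesMeasure true s) K (axesMeasure t s) K₁
      (axesMeasure u s) K₂)
    (hK : Tempered (axesMeasure true s) K) (hK₁ : Tempered (axesMeasure t s) K₁)
    (hK₂ : Tempered (axesMeasure u s) K₂) (φ : 𝓢(ℂ × ℂ, ℂ)) :
    WeakWd quadrant c (1, 0) (I, 0) (op true s K φ)
      (fun z => op t s K₁ φ z + op u s K₂ φ z) := by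
  intro ψ hψ hc hs
  have h := weakWd_conv hw hK hK₁ hK₂ (rapid_oddExt true s φ) ψ hψ hc (Set.subset_univ _)
  rw [integral_mul_congr_of_tsupport (G := fun z => op t s K₁ φ z + op u s K₂ φ z)
    (fun z hz => by rw [conv_oddExt_fst hz, conv_oddExt_fst hz]) hs] at h
  exact h

theorem weakWd_op_snd {c : ℂ} {s t u : Bool} {K K₁ K₂ : ℂ × ℂ → ℂ}
    (hw : KernelWd c (0, 1) (0, I) (axesMeasure s true) K (axesMeasure s t) K₁
      (axesMeasure s u) K₂)
    (hK : Tempered (axesMeasure s true) K) (hK₁ : Tempered (axesMeasure s t) K₁)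
    (hK₂ : Tempered (axesMeasure s u) K₂) (φ : 𝓢(ℂ × ℂ, ℂ)) :
    WeakWd quadrant c (0, 1) (0, I) (op s true K φ)
      (fun z => op s t K₁ φ z + op s u K₂ φ z) := by
  intro ψ hψ hc hs
  have h := weakWd_conv hw hK hK₁ hK₂ (rapid_oddExt s true φ) ψ hψ hc (Set.subset_univ _)
  rw [integral_mul_congr_of_tsupport (G := fun z => op s t K₁ φ z + op s u K₂ φ z)
    (fun z hz => by rw [conv_oddExt_snd hz, conv_oddExt_snd hz]) hs] at h
  exact h

theorem op_zero_kernel (φ : 𝓢(ℂ × ℂ, ℂ)) (z : ℂ × ℂ) : op s₁ s₂ (fun _ => 0) φ z = 0 := by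
  simp [op, conv]

theorem op_const_mul (k : ℂ) (φ : 𝓢(ℂ × ℂ, ℂ)) (z : ℂ × ℂ) :
    op s₁ s₂ (fun η => k * K η) φ z = k * op s₁ s₂ K φ z := by
  simp only [op, conv, mul_assoc, integral_const_mul]

theorem op_add (hK : Tempered (axesMeasure s₁ s₂) K) (φ ψ : 𝓢(ℂ × ℂ, ℂ)) (z : ℂ × ℂ) :
    op s₁ s₂ K (φ + ψ) z = op s₁ s₂ K φ z + op s₁ s₂ K ψ z := by
  simp only [op, conv]
  rw [← integral_add (hK.conv_integrable (rapid_oddExt _ _ φ) z)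
    (hK.conv_integrable (rapid_oddExt _ _ ψ) z)]
  congr 1
  ext η
  simp only [oddExt, add_apply]
  ring

theorem op_smul (k : ℂ) (φ : 𝓢(ℂ × ℂ, ℂ)) (z : ℂ × ℂ) :
    op s₁ s₂ K (k • φ) z = k * op s₁ s₂ K φ z := by
  simp only [op, conv]
  rw [← integral_const_mul]
  congr 1
  ext η
  simp only [oddExt, smul_apply, smul_eq_mul]
  ring

theorem op_kerT_false_false (φ : 𝓢(ℂ × ℂ, ℂ)) (z : ℂ × ℂ) :
    op false false (kerT false false) φ z = φ z := by
  simp only [op, conv, axesMeasure, axisMeasure, Measure.dirac_prod_dirac, integral_dirac]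
  simp [kerT, cauchyKer, oddExt, signIm, foldIm]

end Operators

/-! ### Derivatives and regularity of the operators. -/

section OperatorDerivatives

open Complex

theorem WeakGrad.wd_fst {U : Set (ℂ × ℂ)} {F X₁ Y₁ X₂ Y₂ : ℂ × ℂ → ℂ}
    (h : WeakGrad U F X₁ Y₁ X₂ Y₂) (hU : IsOpen U) {z : ℂ × ℂ} (hz : z ∈ U) (c : ℂ) :
    wd c (1, 0) (I, 0) F z = (1 / 2 : ℂ) * (X₁ z + c * Y₁ z) := by
  simp [wd, (h.hasFDerivAt hU hz).fderiv, gradCLM_apply]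

theorem WeakGrad.wd_snd {U : Set (ℂ × ℂ)} {F X₁ Y₁ X₂ Y₂ : ℂ × ℂ → ℂ}
    (h : WeakGrad U F X₁ Y₁ X₂ Y₂) (hU : IsOpen U) {z : ℂ × ℂ} (hz : z ∈ U) (c : ℂ) :
    wd c (0, 1) (0, I) F z = (1 / 2 : ℂ) * (X₂ z + c * Y₂ z) := by
  simp [wd, (h.hasFDerivAt hU hz).fderiv, gradCLM_apply]

theorem WeakGrad.contDiffOn_one {U : Set (ℂ × ℂ)} {F X₁ Y₁ X₂ Y₂ : ℂ × ℂ → ℂ}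
    (h : WeakGrad U F X₁ Y₁ X₂ Y₂) (hU : IsOpen U) : ContDiffOn ℝ 1 F U := by
  have := h.contDiffOn_succ hU (n := 0) (contDiffOn_zero.2 h.contX₁.continuousOn)
    (contDiffOn_zero.2 h.contY₁.continuousOn) (contDiffOn_zero.2 h.contX₂.continuousOn)
    (contDiffOn_zero.2 h.contY₂.continuousOn)
  simpa using this

/-- The operator with the product of Cauchy kernels in the selected variables. -/
noncomputable abbrev opT (s₁ s₂ : Bool) (φ : 𝓢(ℂ × ℂ, ℂ)) : ℂ × ℂ → ℂ :=
  op s₁ s₂ (kerT s₁ s₂) φ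

theorem continuous_opT (s₁ s₂ : Bool) (φ : 𝓢(ℂ × ℂ, ℂ)) : Continuous (opT s₁ s₂ φ) :=
  continuous_op (tempered_kerT s₁ s₂) φ

theorem weakWd_op_fst_zero {c : ℂ} {s t u : Bool} {K K₁ : ℂ × ℂ → ℂ}
    (hw : KernelWd c (1, 0) (I, 0) (axesMeasure true s) K (axesMeasure t s) K₁
      (axesMeasure u s) (fun _ => 0))
    (hK : Tempered (axesMeasure true s) K) (hK₁ : Tempered (axesMeasure t s) K₁)
    (φ : 𝓢(ℂ × ℂ, ℂ)) :
    WeakWd quadrant c (1, 0) (I, 0) (op true s K φ) (op t s K₁ φ) := by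
  have h := weakWd_op_fst hw hK hK₁ (tempered_zero _ _) φ
  simpa only [op_zero_kernel, add_zero] using h

theorem weakWd_op_snd_zero {c : ℂ} {s t u : Bool} {K K₁ : ℂ × ℂ → ℂ}
    (hw : KernelWd c (0, 1) (0, I) (axesMeasure s true) K (axesMeasure s t) K₁
      (axesMeasure s u) (fun _ => 0))
    (hK : Tempered (axesMeasure s true) K) (hK₁ : Tempered (axesMeasure s t) K₁)
    (φ : 𝓢(ℂ × ℂ, ℂ)) :
    WeakWd quadrant c (0, 1) (0, I) (op s true K φ) (op s t K₁ φ) := by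
  have h := weakWd_op_snd hw hK hK₁ (tempered_zero _ _) φ
  simpa only [op_zero_kernel, add_zero] using h

/-- The derivative of `opT s₁ s₂ φ` with respect to `y₁`. -/
noncomputable def opTY₁ : Bool → Bool → 𝓢(ℂ × ℂ, ℂ) → ℂ × ℂ → ℂ
  | true, s₂, φ => fun z => I⁻¹ * (2 * opT false s₂ φ z - opT true s₂ (dirDeriv (1, 0) φ) z)
  | false, s₂, φ => opT false s₂ (dirDeriv (I, 0) φ)

/-- The derivative of `opT s₁ s₂ φ` with respect to `y₂`. -/
noncomputable def opTY₂ : Bool → Bool → 𝓢(ℂ × ℂ, ℂ) → ℂ × ℂ → ℂ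
  | s₁, true, φ => fun z => I⁻¹ * (2 * opT s₁ false φ z - opT s₁ true (dirDeriv (0, 1) φ) z)
  | s₁, false, φ => opT s₁ false (dirDeriv (0, I) φ)

theorem weakDir_opT_fst (s₁ s₂ : Bool) (φ : 𝓢(ℂ × ℂ, ℂ)) :
    WeakDir quadrant (I, 0) (opT s₁ s₂ φ) (opTY₁ s₁ s₂ φ) := by
  cases s₁
  · exact weakDir_op (tempered_kerT _ _) (by simp) (by simp) φ
  · exact WeakDir.of_wd I_ne_zero (continuous_opT _ _ _) (continuous_opT _ _ _)
      (continuous_opT _ _ _) (weakDir_op (tempered_kerT _ _) (by simp) (by simp) φ)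
      (weakWd_op_fst_zero (kernelWd_kerT_fst s₂) (tempered_kerT _ _) (tempered_kerT _ _) φ)

theorem weakDir_opT_snd (s₁ s₂ : Bool) (φ : 𝓢(ℂ × ℂ, ℂ)) :
    WeakDir quadrant (0, I) (opT s₁ s₂ φ) (opTY₂ s₁ s₂ φ) := by
  cases s₂
  · exact weakDir_op (tempered_kerT _ _) (by simp) (by simp) φ
  · exact WeakDir.of_wd I_ne_zero (continuous_opT _ _ _) (continuous_opT _ _ _)
      (continuous_opT _ _ _) (weakDir_op (tempered_kerT _ _) (by simp) (by simp) φ)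
      (weakWd_op_snd_zero (kernelWd_kerT_snd s₁) (tempered_kerT _ _) (tempered_kerT _ _) φ)

theorem weakGrad_opT (s₁ s₂ : Bool) (φ : 𝓢(ℂ × ℂ, ℂ)) :
    WeakGrad quadrant (opT s₁ s₂ φ) (opT s₁ s₂ (dirDeriv (1, 0) φ)) (opTY₁ s₁ s₂ φ)
      (opT s₁ s₂ (dirDeriv (0, 1) φ)) (opTY₂ s₁ s₂ φ) where
  cont := continuous_opT _ _ _
  contX₁ := continuous_opT _ _ _
  contX₂ := continuous_opT _ _ _
  contY₁ := by
    have := continuous_opT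
    cases s₁ <;> simp only [opTY₁] <;> fun_prop
  contY₂ := by
    have := continuous_opT
    cases s₂ <;> simp only [opTY₂] <;> fun_prop
  weakX₁ := weakDir_op (tempered_kerT _ _) (by simp) (by simp) φ
  weakX₂ := weakDir_op (tempered_kerT _ _) (by simp) (by simp) φ
  weakY₁ := weakDir_opT_fst _ _ _
  weakY₂ := weakDir_opT_snd _ _ _

/-- All four partial derivatives of an `opT` are combinations of further `opT`s of Schwartz
functions. Quantifying over both flags and over `φ` therefore closes the induction. -/
theorem contDiffOn_opT_nat (n : ℕ) : ∀ (s₁ s₂ : Bool) (φ : 𝓢(ℂ × ℂ, ℂ)),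
    ContDiffOn ℝ n (opT s₁ s₂ φ) (closure quadrant) := by
  induction n with
  | zero => exact fun s₁ s₂ φ => contDiffOn_zero.2 (continuous_opT _ _ _).continuousOn
  | succ n ih =>
    intro s₁ s₂ φ
    rw [Nat.cast_succ]
    refine (weakGrad_opT s₁ s₂ φ).contDiffOn_closure_succ isOpen_quadrant convex_quadrant
      quadrant_nonempty (ih _ _ _) ?_ (ih _ _ _) ?_
    · cases s₁
      · exact ih _ _ _
      · exact contDiffOn_const.mul ((contDiffOn_const.mul (ih _ _ _)).sub (ih _ _ _))
    · cases s₂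
      · exact ih _ _ _
      · exact contDiffOn_const.mul ((contDiffOn_const.mul (ih _ _ _)).sub (ih _ _ _))

theorem contDiffOn_opT (s₁ s₂ : Bool) (φ : 𝓢(ℂ × ℂ, ℂ)) :
    ContDiffOn ℝ ∞ (opT s₁ s₂ φ) (closure quadrant) :=
  contDiffOn_infty.2 fun n => contDiffOn_opT_nat n s₁ s₂ φ

/-- The Schwartz function `(∂_{e₁} φ + i ∂_{e₂} φ) / 2`. -/
noncomputable def dbarS (e₁ e₂ : ℂ × ℂ) (φ : 𝓢(ℂ × ℂ, ℂ)) : 𝓢(ℂ × ℂ, ℂ) :=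
  (1 / 2 : ℂ) • (dirDeriv e₁ φ + I • dirDeriv e₂ φ)

theorem dbarS_apply (e₁ e₂ : ℂ × ℂ) (φ : 𝓢(ℂ × ℂ, ℂ)) (z : ℂ × ℂ) :
    dbarS e₁ e₂ φ z = wd I e₁ e₂ φ z := by
  simp only [dbarS, wd, smul_apply, add_apply, smul_eq_mul, dirDeriv_apply]

theorem op_dbarS {s₁ s₂ : Bool} {K : ℂ × ℂ → ℂ} (hK : Tempered (axesMeasure s₁ s₂) K)
    (e₁ e₂ : ℂ × ℂ) (φ : 𝓢(ℂ × ℂ, ℂ)) (z : ℂ × ℂ) :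
    op s₁ s₂ K (dbarS e₁ e₂ φ) z
      = (1 / 2 : ℂ) * (op s₁ s₂ K (dirDeriv e₁ φ) z + I * op s₁ s₂ K (dirDeriv e₂ φ) z) := by
  rw [dbarS, op_smul, op_add hK, op_smul]

theorem wd_opT_fst (s : Bool) (φ : 𝓢(ℂ × ℂ, ℂ)) {z : ℂ × ℂ} (hz : z ∈ quadrant) :
    wd I (1, 0) (I, 0) (opT true s φ) z = opT false s φ z := by
  rw [(weakGrad_opT true s φ).wd_fst isOpen_quadrant hz]
  simp only [opTY₁]
  field_simp [I_ne_zero]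
  ring

theorem wd_opT_snd_false (s : Bool) (φ : 𝓢(ℂ × ℂ, ℂ)) {z : ℂ × ℂ} (hz : z ∈ quadrant) :
    wd I (0, 1) (0, I) (opT s false φ) z = opT s false (dbarS (0, 1) (0, I) φ) z := by
  rw [(weakGrad_opT s false φ).wd_snd isOpen_quadrant hz]
  cases s <;> exact (op_dbarS (tempered_kerT _ false) _ _ φ z).symm

theorem weakGrad_kerG (φ : 𝓢(ℂ × ℂ, ℂ)) :
    WeakGrad quadrant (op true false kerG φ) (op true false kerG (dirDeriv (1, 0) φ))
      (fun z => (-I)⁻¹ * (2 * ((1 / 4 : ℂ) * opT true false φ z)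
        - op true false kerG (dirDeriv (1, 0) φ) z))
      (op true false kerG (dirDeriv (0, 1) φ)) (op true false kerG (dirDeriv (0, I) φ)) where
  cont := continuous_op tempered_kerG _
  contX₁ := continuous_op tempered_kerG _
  contX₂ := continuous_op tempered_kerG _
  contY₁ := by
    have := continuous_op tempered_kerG (dirDeriv (1, 0) φ)
    have := continuous_opT true false φ
    fun_prop
  contY₂ := continuous_op tempered_kerG _
  weakX₁ := weakDir_op tempered_kerG (by simp) (by simp) φ
  weakX₂ := weakDir_op tempered_kerG (by simp) (by simp) φ
  weakY₁ := by
    have h := weakWd_op_fst_zero kernelWd_kerG tempered_kerG ((tempered_kerT _ _).const_mul _) φ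
    have e : op true false (fun η => (1 / 4 : ℂ) * kerT true false η) φ
        = fun z => (1 / 4 : ℂ) * opT true false φ z := funext fun z => op_const_mul _ _ _
    rw [e] at h
    exact WeakDir.of_wd (neg_ne_zero.2 I_ne_zero) (continuous_op tempered_kerG _)
      (continuous_op tempered_kerG _) (continuous_const.mul (continuous_opT _ _ _))
      (weakDir_op tempered_kerG (by simp) (by simp) φ) h
  weakY₂ := weakDir_op tempered_kerG (by simp) (by simp) φ

/-- Assembling the gradient of an operator with a kernel on all of `ℂ²`. -/
theorem weakGrad_op {c₁ c₂ : ℂ} (hc₁ : c₁ ≠ 0) (hc₂ : c₂ ≠ 0) {K : ℂ × ℂ → ℂ}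
    (hK : Tempered (axesMeasure true true) K) {φ : 𝓢(ℂ × ℂ, ℂ)} {H₁ H₂ : ℂ × ℂ → ℂ}
    (hH₁ : Continuous H₁) (hH₂ : Continuous H₂)
    (h₁ : WeakWd quadrant c₁ (1, 0) (I, 0) (op true true K φ) H₁)
    (h₂ : WeakWd quadrant c₂ (0, 1) (0, I) (op true true K φ) H₂) :
    WeakGrad quadrant (op true true K φ) (op true true K (dirDeriv (1, 0) φ))
      (fun z => c₁⁻¹ * (2 * H₁ z - op true true K (dirDeriv (1, 0) φ) z))
      (op true true K (dirDeriv (0, 1) φ))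
      (fun z => c₂⁻¹ * (2 * H₂ z - op true true K (dirDeriv (0, 1) φ) z)) where
  cont := continuous_op hK _
  contX₁ := continuous_op hK _
  contX₂ := continuous_op hK _
  contY₁ := by
    have := continuous_op hK (dirDeriv (1, 0) φ)
    fun_prop
  contY₂ := by
    have := continuous_op hK (dirDeriv (0, 1) φ)
    fun_prop
  weakX₁ := weakDir_op hK (by simp) (by simp) φ
  weakX₂ := weakDir_op hK (by simp) (by simp) φ
  weakY₁ := WeakDir.of_wd hc₁ (continuous_op hK _) (continuous_op hK _) hH₁
    (weakDir_op hK (by simp) (by simp) φ) h₁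
  weakY₂ := WeakDir.of_wd hc₂ (continuous_op hK _) (continuous_op hK _) hH₂
    (weakDir_op hK (by simp) (by simp) φ) h₂

theorem contDiffOn_one_kerV (φ : 𝓢(ℂ × ℂ, ℂ)) : ContDiffOn ℝ 1 (op true true kerV φ) quadrant :=
  (weakGrad_op I_ne_zero I_ne_zero tempered_kerV
    (continuous_op (tempered_sq (by fun_prop) fun _ => Or.inl (norm_neg _)) φ)
    (continuous_op (tempered_sq (by fun_prop) fun _ => Or.inr (norm_neg _)) φ)
    (weakWd_op_fst_zero kernelWd_kerV_fst tempered_kerV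
      (tempered_sq (by fun_prop) fun _ => Or.inl (norm_neg _)) φ)
    (weakWd_op_snd_zero kernelWd_kerV_snd tempered_kerV
      (tempered_sq (by fun_prop) fun _ => Or.inr (norm_neg _)) φ)).contDiffOn_one isOpen_quadrant

theorem contDiffOn_one_kerY (φ : 𝓢(ℂ × ℂ, ℂ)) :
    ContDiffOn ℝ 1 (op true true kerY φ) quadrant := by
  have hc : Measurable (fun a : ℂ => (starRingEnd ℂ) a) := continuous_conj.measurable
  have ht : Tempered (axesMeasure true true)
      (fun η => kerConst * (-(starRingEnd ℂ) η.1 * ((nsq η : ℂ)⁻¹) ^ 2)) :=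
    tempered_sq (by fun_prop) fun η => Or.inl (by rw [norm_neg, RCLike.norm_conj])
  have ht' : Tempered (axesMeasure true false) (fun η => (1 / 2 : ℂ) * kerT true false η) :=
    (tempered_kerT _ _).const_mul _
  exact (weakGrad_op I_ne_zero I_ne_zero tempered_kerY (continuous_op tempered_kerZ φ)
    ((continuous_op ht φ).add (continuous_op ht' φ))
    (weakWd_op_fst_zero kernelWd_kerY_fst tempered_kerY tempered_kerZ φ)
    (weakWd_op_snd kernelWd_kerY_snd tempered_kerY ht ht' φ)).contDiffOn_one isOpen_quadrant

theorem weakGrad_kerW (φ : 𝓢(ℂ × ℂ, ℂ)) :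
    WeakGrad quadrant (op true true kerW φ) (op true true kerW (dirDeriv (1, 0) φ))
      (fun z => (-I)⁻¹ * (2 * op true true kerY φ z - op true true kerW (dirDeriv (1, 0) φ) z))
      (op true true kerW (dirDeriv (0, 1) φ))
      (fun z => I⁻¹ * (2 * (op true true kerV φ z + 2 * op true false kerG φ z)
        - op true true kerW (dirDeriv (0, 1) φ) z)) := by
  have h := weakWd_op_snd kernelWd_kerW_snd tempered_kerW tempered_kerV
    (tempered_kerG.const_mul 2) φ
  simp only [op_const_mul] at h
  exact weakGrad_op (neg_ne_zero.2 I_ne_zero) I_ne_zero tempered_kerW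
    (continuous_op tempered_kerY φ)
    ((continuous_op tempered_kerV φ).add (continuous_const.mul (continuous_op tempered_kerG φ)))
    (weakWd_op_fst_zero kernelWd_kerW_fst tempered_kerW tempered_kerY φ) h

theorem contDiffOn_two_kerG (φ : 𝓢(ℂ × ℂ, ℂ)) :
    ContDiffOn ℝ 2 (op true false kerG φ) quadrant := by
  have h1 : ∀ φ, ContDiffOn ℝ 1 (op true false kerG φ) quadrant := fun φ =>
    (weakGrad_kerG φ).contDiffOn_one isOpen_quadrant
  have h2 : ContDiffOn ℝ 1 (opT true false φ) quadrant :=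
    (weakGrad_opT true false φ).contDiffOn_one isOpen_quadrant
  have := (weakGrad_kerG φ).contDiffOn_succ isOpen_quadrant (n := 1) (by simpa using h1 _)
    (by
      simp only [Nat.cast_one]
      exact contDiffOn_const.mul ((contDiffOn_const.mul (contDiffOn_const.mul h2)).sub (h1 _)))
    (by simpa using h1 _) (by simpa using h1 _)
  rwa [Nat.cast_one, one_add_one_eq_two] at this

/-- The gradient consists of `kerW`, `kerY`, `kerV` and `kerG` operators, all of class `C¹` on the
quadrant. -/
theorem contDiffOn_two_kerW (φ : 𝓢(ℂ × ℂ, ℂ)) :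
    ContDiffOn ℝ 2 (op true true kerW φ) quadrant := by
  have h1 : ∀ φ, ContDiffOn ℝ 1 (op true true kerW φ) quadrant := fun φ =>
    (weakGrad_kerW φ).contDiffOn_one isOpen_quadrant
  have h2 : ContDiffOn ℝ 1 (op true false kerG φ) quadrant :=
    (weakGrad_kerG φ).contDiffOn_one isOpen_quadrant
  have := (weakGrad_kerW φ).contDiffOn_succ isOpen_quadrant (n := 1) (by simpa using h1 _)
    (by
      simp only [Nat.cast_one]
      exact contDiffOn_const.mul ((contDiffOn_const.mul (contDiffOn_one_kerY φ)).sub (h1 _)))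
    (by simpa using h1 _)
    (by
      simp only [Nat.cast_one]
      exact contDiffOn_const.mul ((contDiffOn_const.mul
        ((contDiffOn_one_kerV φ).add (contDiffOn_const.mul h2))).sub (h1 _)))
  rwa [Nat.cast_one, one_add_one_eq_two] at this

/-- The first component of the solution of the `∂̄`-Neumann problem, in terms of the first
component of the data. -/
noncomputable def neumannFst (φ : 𝓢(ℂ × ℂ, ℂ)) (z : ℂ × ℂ) : ℂ :=
  -2 * op true false kerG φ z + op true true kerW (dbarS (0, 1) (0, I) φ) z

theorem contDiffOn_neumannFst (φ : 𝓢(ℂ × ℂ, ℂ)) : ContDiffOn ℝ 2 (neumannFst φ) quadrant :=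
  (contDiffOn_const.mul (contDiffOn_two_kerG φ)).add (contDiffOn_two_kerW _)

theorem continuous_neumannFst (φ : 𝓢(ℂ × ℂ, ℂ)) : Continuous (neumannFst φ) :=
  (continuous_const.mul (continuous_op tempered_kerG φ)).add (continuous_op tempered_kerW _)

theorem wd_neumannFst (c : ℂ) (e₁ e₂ : ℂ × ℂ) (φ : 𝓢(ℂ × ℂ, ℂ)) {z : ℂ × ℂ} (hz : z ∈ quadrant) :
    wd c e₁ e₂ (neumannFst φ) z = -2 * wd c e₁ e₂ (op true false kerG φ) z
      + wd c e₁ e₂ (op true true kerW (dbarS (0, 1) (0, I) φ)) z := by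
  have h1 := ((weakGrad_kerG φ).hasFDerivAt isOpen_quadrant hz).differentiableAt
  have h2 := ((weakGrad_kerW (dbarS (0, 1) (0, I) φ)).hasFDerivAt isOpen_quadrant
    hz).differentiableAt
  unfold neumannFst
  rw [wd_add (h1.const_mul _) h2, wd_mul (differentiableAt_const _) h1, wd_const]
  ring

/-- The mass `2 kerG` produced by `kerW` is cancelled by the term `-2 kerG`, because `kerG` acts in
the first variable only and commutes with `∂̄` in the second. -/
theorem wd_neumannFst_snd (φ : 𝓢(ℂ × ℂ, ℂ)) {z : ℂ × ℂ} (hz : z ∈ quadrant) :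
    wd I (0, 1) (0, I) (neumannFst φ) z = op true true kerV (dbarS (0, 1) (0, I) φ) z := by
  rw [wd_neumannFst _ _ _ _ hz, (weakGrad_kerG φ).wd_snd isOpen_quadrant hz,
    (weakGrad_kerW _).wd_snd isOpen_quadrant hz, ← op_dbarS tempered_kerG]
  field_simp [I_ne_zero]
  ring

theorem wd_neumannFst_fst (φ : 𝓢(ℂ × ℂ, ℂ)) {z : ℂ × ℂ} (hz : z ∈ quadrant) :
    wd (-I) (1, 0) (I, 0) (neumannFst φ) z
      = -(1 / 2 : ℂ) * opT true false φ z + op true true kerY (dbarS (0, 1) (0, I) φ) z := by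
  rw [wd_neumannFst _ _ _ _ hz, (weakGrad_kerG φ).wd_fst isOpen_quadrant hz,
    (weakGrad_kerW _).wd_fst isOpen_quadrant hz]
  have : -I ≠ 0 := neg_ne_zero.2 I_ne_zero
  field_simp
  ring

end OperatorDerivatives

/-! ### Decay and boundary vanishing from antisymmetry. -/

section Estimates

open Complex

/-- For `B ≤ A` the quotient of the arguments is at most `(A / B)²`, and `log x ≤ x - 1` finishes.
The bound is uniform in `β`, so it serves `kerW` with `β = ‖b‖` and `kerG` with `β = 0`. -/
theorem abs_log_sub_log_le {A B β : ℝ} (hA : 0 < A) (hB : 0 < B) :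
    |Real.log (A ^ 2 + β ^ 2) - Real.log (B ^ 2 + β ^ 2)| ≤ 2 * |A - B| * (A⁻¹ + B⁻¹) := by
  wlog h : B ≤ A generalizing A B
  · have := this hB hA (le_of_not_ge h)
    rwa [abs_sub_comm, abs_sub_comm A, add_comm A⁻¹]
  have h1 : B ^ 2 ≤ A ^ 2 := by gcongr
  have h2 : Real.log (B ^ 2 + β ^ 2) ≤ Real.log (A ^ 2 + β ^ 2) :=
    Real.log_le_log (by positivity) (by linarith)
  rw [abs_of_nonneg (by linarith), abs_of_nonneg (by linarith),
    ← Real.log_div (by positivity) (by positivity)]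
  have h3 : (A ^ 2 + β ^ 2) / (B ^ 2 + β ^ 2) ≤ (A / B) ^ 2 := by
    rw [div_pow, div_le_div_iff₀ (by positivity) (by positivity)]
    nlinarith [mul_nonneg (sq_nonneg β) (sub_nonneg.2 h1)]
  calc Real.log ((A ^ 2 + β ^ 2) / (B ^ 2 + β ^ 2)) ≤ Real.log ((A / B) ^ 2) :=
        Real.log_le_log (by positivity) h3
    _ = 2 * Real.log (A / B) := by rw [Real.log_pow]; norm_num
    _ ≤ 2 * (A / B - 1) := by gcongr; exact Real.log_le_sub_one_of_pos (by positivity)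
    _ = 2 * (A - B) * B⁻¹ := by field_simp
    _ ≤ 2 * (A - B) * (A⁻¹ + B⁻¹) := by
        have : 0 ≤ A - B := by linarith
        gcongr
        have := inv_pos.2 hA
        linarith

/-- Pointwise form of the estimate `∫ |η|⁻¹ (1 + |z - η|)⁻⁴ dη ≤ C (1 + |z|)⁻¹`. -/
theorem inv_norm_mul_decay_le (z η : ℂ) :
    ‖η‖⁻¹ * ((1 + ‖z - η‖) ^ 4)⁻¹
      ≤ (1 + ‖z‖)⁻¹ * (8 * singDecay η + 2 * singDecay (z - η)) := by
  have hz : 0 < 1 + ‖z‖ := by positivity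
  set w := 1 + ‖z - η‖ with hw
  have hw1 : 1 ≤ w := by rw [hw]; linarith [norm_nonneg (z - η)]
  have hs : (w ^ 3)⁻¹ ≤ singDecay (z - η) := by
    have := one_le_sing (z - η)
    unfold singDecay
    rw [← hw]
    have h0 : 0 ≤ (w ^ 3)⁻¹ := by positivity
    nlinarith
  have hs4 : (w ^ 4)⁻¹ ≤ (w ^ 3)⁻¹ :=
    inv_anti₀ (by positivity) (pow_le_pow_right₀ hw1 (by norm_num))
  have hn := singDecay_nonneg η
  -- Multiplying by `1 + ‖z‖ ≤ w + ‖η‖` costs either one power of `w` or the factor `‖η‖⁻¹`, hence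
  -- the two terms below.
  have htri : 1 + ‖z‖ ≤ w + ‖η‖ := by
    have := norm_add_le (z - η) η
    rw [sub_add_cancel] at this
    linarith
  -- The `8` is `(1 + 1)³`, the largest value of the weight `(1 + ‖η‖)³` on the unit disc.
  have hinv : ‖η‖⁻¹ * (w ^ 3)⁻¹ ≤ 8 * singDecay η + (w ^ 3)⁻¹ := by
    have h0 : (w ^ 3)⁻¹ ≤ 1 := inv_le_one_of_one_le₀ (one_le_pow₀ hw1)
    have h0' : 0 ≤ (w ^ 3)⁻¹ := by positivity
    rcases le_total 1 ‖η‖ with h | h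
    · have := inv_le_one_of_one_le₀ h
      nlinarith
    · have h1 : ‖η‖⁻¹ ≤ 8 * singDecay η := by
        refine (inv_norm_le_sing η).trans ?_
        unfold singDecay
        have h2 : (1 : ℝ) / 8 ≤ ((1 + ‖η‖) ^ 3)⁻¹ := by
          rw [one_div]
          gcongr
          calc (1 + ‖η‖) ^ 3 ≤ (1 + 1) ^ 3 := by gcongr
            _ = 8 := by norm_num
        have := one_le_sing η
        nlinarith
      have : 0 ≤ ‖η‖⁻¹ := by positivity
      nlinarith
  rw [← div_eq_inv_mul (8 * singDecay η + 2 * singDecay (z - η)) (1 + ‖z‖), le_div_iff₀ hz]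
  rcases eq_or_ne η 0 with rfl | hη
  · simp only [norm_zero, inv_zero, zero_mul]
    have := singDecay_nonneg (z - 0)
    positivity
  have hη' : 0 < ‖η‖ := norm_pos_iff.2 hη
  calc ‖η‖⁻¹ * (w ^ 4)⁻¹ * (1 + ‖z‖) ≤ ‖η‖⁻¹ * (w ^ 4)⁻¹ * (w + ‖η‖) := by gcongr
    _ = ‖η‖⁻¹ * (w ^ 3)⁻¹ + (w ^ 4)⁻¹ := by
        have : 0 < w := by linarith
        field_simp
    _ ≤ _ := by linarith

/-- Reflection in the horizontal line through `z`, written in the variable `η = z - ζ`. -/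
noncomputable def reflPt (z η : ℂ) : ℂ := z - (starRingEnd ℂ) (z - η)

theorem measurePreserving_conj :
    MeasurePreserving (fun a : ℂ => (starRingEnd ℂ) a) volume volume :=
  conjLIE.measurePreserving

theorem measurePreserving_reflPt (z : ℂ) : MeasurePreserving (reflPt z) volume volume := by
  have h1 := Measure.measurePreserving_sub_left (volume : Measure ℂ) z
  exact h1.comp (measurePreserving_conj.comp h1)

theorem norm_sub_reflPt (z η : ℂ) : ‖z - reflPt z η‖ = ‖z - η‖ := by
  rw [reflPt, sub_sub_cancel, RCLike.norm_conj]

theorem abs_norm_sub_norm_reflPt_le (z η : ℂ) : |‖η‖ - ‖reflPt z η‖| ≤ 2 * ‖z - η‖ := by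
  refine (abs_norm_sub_norm_le _ _).trans ?_
  have e : η - reflPt z η = (starRingEnd ℂ) (z - η) - (z - η) := by rw [reflPt]; ring
  rw [e]
  refine (norm_sub_le _ _).trans ?_
  rw [RCLike.norm_conj]
  linarith

/-- Averages the integral with its image under `ζ₁ ↦ conj ζ₁`, where `ζ = z - η`; the density
changes sign. Only differences of kernel values survive, and for logarithms these decay. -/
theorem op_eq_half_integral {s : Bool} {K : ℂ × ℂ → ℂ} (hK : Tempered (axesMeasure true s) K)
    (φ : 𝓢(ℂ × ℂ, ℂ)) (z : ℂ × ℂ) :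
    op true s K φ z = (1 / 2 : ℂ) * ∫ η, (K η - K (reflPt z.1 η.1, η.2))
      * oddExt true s φ (z - η) ∂(axesMeasure true s) := by
  have hmp : MeasurePreserving (fun η : ℂ × ℂ => (reflPt z.1 η.1, η.2)) (axesMeasure true s)
      (axesMeasure true s) :=
    (measurePreserving_reflPt z.1).prod (MeasurePreserving.id (axisMeasure s))
  have hemb : MeasurableEmbedding (fun η : ℂ × ℂ => (reflPt z.1 η.1, η.2)) := by
    have hi : Function.LeftInverse (fun η : ℂ × ℂ => (reflPt z.1 η.1, η.2))
        (fun η : ℂ × ℂ => (reflPt z.1 η.1, η.2)) := fun η => by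
      ext <;> simp [reflPt]
    have hm : Measurable (fun η : ℂ × ℂ => (reflPt z.1 η.1, η.2)) := hmp.measurable
    exact (MeasurableEquiv.mk ⟨_, _, hi, hi⟩ hm hm).measurableEmbedding
  have i1 := hK.conv_integrable (rapid_oddExt true s φ) z
  have e : ∀ η : ℂ × ℂ, oddExt true s φ (z - (reflPt z.1 η.1, η.2)) = - oddExt true s φ (z - η) := by
    intro η
    rw [← Prod.mk.eta (p := z - η), ← oddExt_conj_fst]
    congr 1
    ext1 <;> simp [reflPt]
  have i2 : Integrable (fun η => K (reflPt z.1 η.1, η.2) * oddExt true s φ (z - η))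
      (axesMeasure true s) := by
    have := (hmp.integrable_comp_emb hemb).2 i1
    refine this.neg.congr (ae_of_all _ fun η => ?_)
    simp only [Pi.neg_apply, Function.comp_apply, e]
    ring
  have h2 := hmp.integral_comp hemb (fun η => K η * oddExt true s φ (z - η))
  simp only [e, mul_neg, integral_neg] at h2
  simp_rw [sub_mul]
  rw [integral_sub i1 i2]
  simp only [op, conv]
  linear_combination (-1 / 2 : ℂ) * h2

/-- On the real axis the reflection is `a ↦ ā`, under which the kernel is even, so the
antisymmetrised kernel vanishes. -/
theorem op_eq_zero_of_im_eq_zero {s : Bool} {K : ℂ × ℂ → ℂ}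
    (hK : Tempered (axesMeasure true s) K)
    (hsymm : ∀ a b, K ((starRingEnd ℂ) a, b) = K (a, b)) (φ : 𝓢(ℂ × ℂ, ℂ)) {z : ℂ × ℂ}
    (hz : z.1.im = 0) : op true s K φ z = 0 := by
  rw [op_eq_half_integral hK]
  have e : ∀ η : ℂ × ℂ, K (reflPt z.1 η.1, η.2) = K η := fun η => by
    have h : reflPt z.1 η.1 = (starRingEnd ℂ) η.1 := by
      rw [reflPt, map_sub, conj_eq_iff_im.2 hz, sub_sub_cancel]
    rw [h, hsymm]
  simp [e]

/-- Operators whose kernel gains one power from the oddness of the density decay like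
`(1 + |z₁|)⁻¹ (1 + |z₂|)⁻¹`. -/
theorem exists_op_bound {s : Bool} {K : ℂ × ℂ → ℂ} (hK : Tempered (axesMeasure true s) K)
    {q : ℂ → ℝ} (hq0 : ∀ b, 0 ≤ q b) {B : ℂ → ℂ → ℝ} {C₂ : ℝ}
    (hq : ∀ z, ∀ᵐ b ∂(axisMeasure s), q b * ((1 + ‖z - b‖) ^ 4)⁻¹ ≤ (1 + ‖z‖)⁻¹ * B z b)
    (hBi : ∀ z, Integrable (B z) (axisMeasure s)) (hBC : ∀ z, ∫ b, B z b ∂(axisMeasure s) ≤ C₂)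
    (hKq : ∀ z a b, a ≠ 0 → reflPt z a ≠ 0 → (s = true → b ≠ 0) →
      ‖K (a, b) - K (reflPt z a, b)‖
        ≤ 4 * (1 + ‖z - a‖) * (‖a‖⁻¹ + ‖reflPt z a‖⁻¹) * q b) (φ : 𝓢(ℂ × ℂ, ℂ)) :
    ∃ C, 0 ≤ C ∧ ∀ z, ‖op true s K φ z‖ ≤ C * ((1 + ‖z.1‖)⁻¹ * (1 + ‖z.2‖)⁻¹) := by
  -- Nine powers: one pays for the factor `1 + ‖z - a‖` in `hKq`, and four in each variable feed the
  -- one-variable estimates.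
  obtain ⟨D, hD0, hD⟩ := (rapid_oddExt true s φ).exists_decay 9
  let S := ∫ a, singDecay a
  have hS : 0 ≤ S := integral_nonneg singDecay_nonneg
  let A : ℂ → ℂ → ℝ := fun z a =>
    (8 * singDecay a + 2 * singDecay (z - a))
      + (8 * singDecay (reflPt z a) + 2 * singDecay (z - reflPt z a))
  have hi1 : ∀ z : ℂ, Integrable (fun a => 8 * singDecay a + 2 * singDecay (z - a)) := fun z =>
    (integrable_singDecay.const_mul 8).add ((integrable_singDecay.comp_sub_left z).const_mul 2)
  have hemb : ∀ z, MeasurableEmbedding (reflPt z) := fun z => by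
    have hi : Function.LeftInverse (reflPt z) (reflPt z) := fun η => by simp [reflPt]
    exact (MeasurableEquiv.mk ⟨_, _, hi, hi⟩ (measurePreserving_reflPt z).measurable
      (measurePreserving_reflPt z).measurable).measurableEmbedding
  have hi2 : ∀ z : ℂ, Integrable
      (fun a => 8 * singDecay (reflPt z a) + 2 * singDecay (z - reflPt z a)) := fun z =>
    ((measurePreserving_reflPt z).integrable_comp_emb (hemb z)).2 (hi1 z)
  have hint1 : ∀ z : ℂ, ∫ a, (8 * singDecay a + 2 * singDecay (z - a)) = 10 * S := fun z => by
    rw [integral_add (integrable_singDecay.const_mul 8)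
      ((integrable_singDecay.comp_sub_left z).const_mul 2), integral_const_mul,
      integral_const_mul, integral_sub_left_eq_self]
    ring
  have hA : ∀ z, ∫ a, A z a = 20 * S := fun z => by
    have := (measurePreserving_reflPt z).integral_comp (hemb z)
      (fun a => 8 * singDecay a + 2 * singDecay (z - a))
    rw [integral_add (hi1 z) (hi2 z), this, hint1]
    ring
  have hA0 : ∀ z a, 0 ≤ A z a := fun z a => by
    have := singDecay_nonneg
    have h1 := this a
    have h2 := this (z - a)
    have h3 := this (reflPt z a)
    have h4 := this (z - reflPt z a)
    positivity
  -- The constant is `1/2 · 4 · 20`: the antisymmetrisation, the factor in `hKq`, and the mass `20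
  -- S` of `A`.
  refine ⟨40 * D * S * |C₂|, by positivity, fun z => ?_⟩
  rw [op_eq_half_integral hK, norm_mul]
  have hAi : Integrable (A z.1) (axisMeasure true) := (hi1 z.1).add (hi2 z.1)
  have hbound : Integrable (fun η : ℂ × ℂ => (4 * D * ((1 + ‖z.1‖)⁻¹ * (1 + ‖z.2‖)⁻¹))
      * (A z.1 η.1 * B z.2 η.2)) (axesMeasure true s) :=
    (hAi.mul_prod (hBi z.2)).const_mul _
  have hle := norm_integral_le_of_norm_le (f := fun η => (K η - K (reflPt z.1 η.1, η.2))
      * oddExt true s φ (z - η)) hbound ?_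
  · have e : ∫ η : ℂ × ℂ, (4 * D * ((1 + ‖z.1‖)⁻¹ * (1 + ‖z.2‖)⁻¹))
        * (A z.1 η.1 * B z.2 η.2) ∂(axesMeasure true s)
        = (4 * D * ((1 + ‖z.1‖)⁻¹ * (1 + ‖z.2‖)⁻¹))
          * (20 * S * ∫ b, B z.2 b ∂(axisMeasure s)) := by
      rw [integral_const_mul, axesMeasure, integral_prod_mul]
      congr 2
      exact hA z.1
    rw [e] at hle
    have hn : ‖(1 / 2 : ℂ)‖ = 1 / 2 := by simp
    rw [hn]
    have hp : 0 ≤ (1 + ‖z.1‖)⁻¹ * (1 + ‖z.2‖)⁻¹ := by positivity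
    calc _ ≤ 1 / 2 * ((4 * D * ((1 + ‖z.1‖)⁻¹ * (1 + ‖z.2‖)⁻¹)) * (20 * S * |C₂|)) := by
          gcongr
          refine hle.trans ?_
          gcongr
          exact (hBC _).trans (le_abs_self _)
      _ = _ := by ring
  · have h1 : ∀ᵐ η ∂(axesMeasure true s), q η.2 * ((1 + ‖z.2 - η.2‖) ^ 4)⁻¹
        ≤ (1 + ‖z.2‖)⁻¹ * B z.2 η.2 :=
      Measure.quasiMeasurePreserving_snd.ae (hq z.2)
    have h2 : ∀ᵐ η ∂(axesMeasure true s), reflPt z.1 η.1 ≠ 0 :=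
      Measure.quasiMeasurePreserving_fst.ae
        ((measurePreserving_reflPt z.1).quasiMeasurePreserving.ae ae_ne_zero_volume)
    have h4 : ∀ᵐ η ∂(axesMeasure true s), s = true → η.2 ≠ 0 := by
      cases s
      · simp
      · exact (ae_snd_ne_zero true).mono fun η h _ => h
    filter_upwards [h1, h2, ae_fst_ne_zero s, h4] with η h1 h2 h3 h4
    have hk := hKq z.1 η.1 η.2 h3 h2 h4
    have hd : ‖oddExt true s φ (z - η)‖ ≤ D * ((1 + ‖z.1 - η.1‖)⁻¹ * ((1 + ‖z.1 - η.1‖) ^ 4)⁻¹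
        * ((1 + ‖z.2 - η.2‖) ^ 4)⁻¹) := by
      refine (hD (z - η)).trans ?_
      gcongr
      have n1 : ‖z.1 - η.1‖ ≤ ‖z - η‖ := norm_fst_le (z - η)
      have n2 : ‖z.2 - η.2‖ ≤ ‖z - η‖ := norm_snd_le (z - η)
      rw [← mul_inv, ← mul_inv]
      gcongr
      calc (1 + ‖z.1 - η.1‖) * (1 + ‖z.1 - η.1‖) ^ 4 * (1 + ‖z.2 - η.2‖) ^ 4
          ≤ (1 + ‖z - η‖) * (1 + ‖z - η‖) ^ 4 * (1 + ‖z - η‖) ^ 4 := by gcongr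
        _ = _ := by ring
    have a1 := inv_norm_mul_decay_le z.1 η.1
    have a2 := inv_norm_mul_decay_le z.1 (reflPt z.1 η.1)
    rw [norm_sub_reflPt] at a2
    have hq1 := hq0 η.2
    have hx : 0 < 1 + ‖z.1 - η.1‖ := by positivity
    have ha3 : (‖η.1‖⁻¹ + ‖reflPt z.1 η.1‖⁻¹) * ((1 + ‖z.1 - η.1‖) ^ 4)⁻¹
        ≤ (1 + ‖z.1‖)⁻¹ * A z.1 η.1 := by
      simp only [A]
      rw [add_mul, mul_add]
      exact add_le_add a1 a2
    have := hA0 z.1 η.1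
    rw [norm_mul]
    calc _ ≤ (4 * (1 + ‖z.1 - η.1‖) * (‖η.1‖⁻¹ + ‖reflPt z.1 η.1‖⁻¹) * q η.2)
          * (D * ((1 + ‖z.1 - η.1‖)⁻¹ * ((1 + ‖z.1 - η.1‖) ^ 4)⁻¹
            * ((1 + ‖z.2 - η.2‖) ^ 4)⁻¹)) := by gcongr
      _ = 4 * D * (((‖η.1‖⁻¹ + ‖reflPt z.1 η.1‖⁻¹) * ((1 + ‖z.1 - η.1‖) ^ 4)⁻¹)
          * (q η.2 * ((1 + ‖z.2 - η.2‖) ^ 4)⁻¹)) := by field_simp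
      _ ≤ 4 * D * (((1 + ‖z.1‖)⁻¹ * A z.1 η.1) * ((1 + ‖z.2‖)⁻¹ * B z.2 η.2)) := by
          gcongr
      _ = _ := by ring

theorem exists_op_bound_true {K : ℂ × ℂ → ℂ} (hK : Tempered (axesMeasure true true) K)
    (hKq : ∀ z a b, a ≠ 0 → reflPt z a ≠ 0 → b ≠ 0 →
      ‖K (a, b) - K (reflPt z a, b)‖
        ≤ 4 * (1 + ‖z - a‖) * (‖a‖⁻¹ + ‖reflPt z a‖⁻¹) * ‖b‖⁻¹) (φ : 𝓢(ℂ × ℂ, ℂ)) :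
    ∃ C, 0 ≤ C ∧ ∀ z, ‖op true true K φ z‖ ≤ C * ((1 + ‖z.1‖)⁻¹ * (1 + ‖z.2‖)⁻¹) := by
  refine exists_op_bound hK (q := fun b => ‖b‖⁻¹) (fun b => by positivity)
    (B := fun z b => 8 * singDecay b + 2 * singDecay (z - b)) (C₂ := 10 * ∫ a, singDecay a)
    (fun z => ae_of_all _ fun b => inv_norm_mul_decay_le z b) (fun z => ?_) (fun z => ?_)
    (fun z a b ha hr hb => hKq z a b ha hr (hb rfl)) φ
  · exact (integrable_singDecay.const_mul 8).add
      ((integrable_singDecay.comp_sub_left z).const_mul 2)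
  · simp only [axisMeasure]
    rw [integral_add (integrable_singDecay.const_mul 8)
      ((integrable_singDecay.comp_sub_left z).const_mul 2), integral_const_mul,
      integral_const_mul, integral_sub_left_eq_self]
    linarith

/-- No cancellation is needed: `|a| |b| ≤ n` already bounds each of the two kernel values. -/
theorem exists_bound_kerV (φ : 𝓢(ℂ × ℂ, ℂ)) :
    ∃ C, 0 ≤ C ∧ ∀ z, ‖op true true kerV φ z‖ ≤ C * ((1 + ‖z.1‖)⁻¹ * (1 + ‖z.2‖)⁻¹) := by
  refine exists_op_bound_true tempered_kerV (fun z a b ha hr hb => ?_) φ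
  have key : ∀ a : ℂ, a ≠ 0 → ‖kerV (a, b)‖ ≤ ‖a‖⁻¹ * ‖b‖⁻¹ := fun a ha => by
    have h1 := norm_pos_iff.2 ha
    have h2 := norm_pos_iff.2 hb
    have h3 : ‖a‖ * ‖b‖ ≤ nsq (a, b) := by
      simp only [nsq]
      nlinarith [sq_nonneg (‖a‖ - ‖b‖), mul_pos h1 h2]
    rw [kerV, norm_mul, norm_inv, norm_ofReal_nsq, ← mul_inv]
    calc _ ≤ 1 * (‖a‖ * ‖b‖)⁻¹ :=
          mul_le_mul norm_kerConst_le (inv_anti₀ (by positivity) h3)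
            (inv_nonneg.2 (nsq_nonneg _)) zero_le_one
      _ = _ := one_mul _
  have hx : 0 ≤ (‖a‖⁻¹ + ‖reflPt z a‖⁻¹) * ‖b‖⁻¹ := by positivity
  calc _ ≤ ‖kerV (a, b)‖ + ‖kerV (reflPt z a, b)‖ := norm_sub_le _ _
    _ ≤ ‖a‖⁻¹ * ‖b‖⁻¹ + ‖reflPt z a‖⁻¹ * ‖b‖⁻¹ := add_le_add (key _ ha) (key _ hr)
    _ = 1 * ((‖a‖⁻¹ + ‖reflPt z a‖⁻¹) * ‖b‖⁻¹) := by ring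
    _ ≤ (4 * (1 + ‖z - a‖)) * ((‖a‖⁻¹ + ‖reflPt z a‖⁻¹) * ‖b‖⁻¹) := by
        gcongr
        linarith [norm_nonneg (z - a)]
    _ = _ := by ring

theorem exists_bound_kerW (φ : 𝓢(ℂ × ℂ, ℂ)) :
    ∃ C, 0 ≤ C ∧ ∀ z, ‖op true true kerW φ z‖ ≤ C * ((1 + ‖z.1‖)⁻¹ * (1 + ‖z.2‖)⁻¹) := by
  refine exists_op_bound_true tempered_kerW (fun z a b ha hr hb => ?_) φ
  have h1 := abs_log_sub_log_le (β := ‖b‖) (norm_pos_iff.2 ha) (norm_pos_iff.2 hr)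
  have h2 := abs_norm_sub_norm_reflPt_le z a
  have e : kerW (a, b) - kerW (reflPt z a, b) = kerConst * (b⁻¹ *
      ((Real.log (‖a‖ ^ 2 + ‖b‖ ^ 2) - Real.log (‖reflPt z a‖ ^ 2 + ‖b‖ ^ 2) : ℝ) : ℂ)) := by
    simp only [kerW, nsq]; push_cast; ring
  rw [e, norm_mul, norm_mul, norm_inv, norm_real, Real.norm_eq_abs]
  calc _ ≤ 1 * (‖b‖⁻¹ * (2 * (2 * ‖z - a‖) * (‖a‖⁻¹ + ‖reflPt z a‖⁻¹))) := by
        gcongr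
        · exact norm_kerConst_le
        · exact h1.trans (by gcongr)
    _ ≤ 1 * (‖b‖⁻¹ * (2 * (2 * (1 + ‖z - a‖)) * (‖a‖⁻¹ + ‖reflPt z a‖⁻¹))) := by
        gcongr
        linarith
    _ = _ := by ring

theorem exists_bound_kerG (φ : 𝓢(ℂ × ℂ, ℂ)) :
    ∃ C, 0 ≤ C ∧ ∀ z, ‖op true false kerG φ z‖ ≤ C * ((1 + ‖z.1‖)⁻¹ * (1 + ‖z.2‖)⁻¹) := by
  refine exists_op_bound tempered_kerG (q := fun b => 1) (fun b => zero_le_one)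
    (B := fun z b => 1) (C₂ := 1) (fun z => ?_) (fun z => ?_) (fun z => ?_)
    (fun z a b ha hr hb => ?_) φ
  -- The measure in the second variable is the Dirac mass, so only `b = 0` counts and the Schwartz
  -- decay alone gives `(1 + ‖z‖)⁻¹`.
  · refine (ae_dirac_iff ?_).2 ?_
    · exact measurableSet_le (by fun_prop) measurable_const
    · rw [sub_zero, one_mul, mul_one]
      gcongr
      exact le_self_pow₀ (by linarith [norm_nonneg z]) (by norm_num)
  · exact integrable_dirac (by simp)
  · simp [axisMeasure]
  · have h1 := abs_log_sub_log_le (β := 0) (norm_pos_iff.2 ha) (norm_pos_iff.2 hr)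
    have h2 := abs_norm_sub_norm_reflPt_le z a
    have e : kerG (a, b) - kerG (reflPt z a, b) = (4 * (Real.pi : ℂ))⁻¹ *
        ((Real.log (‖a‖ ^ 2 + 0 ^ 2) - Real.log (‖reflPt z a‖ ^ 2 + 0 ^ 2) : ℝ) : ℂ) := by
      simp only [kerG]; push_cast; ring_nf
    have hc : ‖(4 * (Real.pi : ℂ))⁻¹‖ ≤ 1 := by
      rw [norm_inv, norm_mul, norm_real, Real.norm_of_nonneg Real.pi_pos.le]
      refine inv_le_one_of_one_le₀ ?_
      have := Real.two_le_pi
      simp only [norm_ofNat]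
      linarith
    rw [e, norm_mul, norm_real, Real.norm_eq_abs]
    calc _ ≤ 1 * (2 * (2 * ‖z - a‖) * (‖a‖⁻¹ + ‖reflPt z a‖⁻¹)) := by
          gcongr
          exact h1.trans (by gcongr)
      _ ≤ 1 * (2 * (2 * (1 + ‖z - a‖)) * (‖a‖⁻¹ + ‖reflPt z a‖⁻¹)) := by
          gcongr
          linarith
      _ = _ := by ring

end Estimates

/-! ### Norms of functions with product decay. -/

section Decay

theorem integrable_prod_decay_rpow {E F : Type*} [NormedAddCommGroup E] [NormedSpace ℝ E]
    [FiniteDimensional ℝ E] [MeasurableSpace E] [BorelSpace E] [NormedAddCommGroup F]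
    [NormedSpace ℝ F] [FiniteDimensional ℝ F] [MeasurableSpace F] [BorelSpace F]
    (μ : Measure E) [μ.IsAddHaarMeasure] (ν : Measure F) [ν.IsAddHaarMeasure] [SFinite ν] {r : ℝ}
    (hE : (Module.finrank ℝ E : ℝ) < r) (hF : (Module.finrank ℝ F : ℝ) < r) :
    Integrable (fun s : E × F => ‖(1 + ‖s.1‖)⁻¹ * (1 + ‖s.2‖)⁻¹‖ ^ r) (μ.prod ν) := by
  refine ((integrable_one_add_norm (μ := μ) hE).mul_prod
    (integrable_one_add_norm (μ := ν) hF)).congr (ae_of_all _ fun s => ?_)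
  have h1 : 0 ≤ (1 + ‖s.1‖)⁻¹ := by positivity
  have h2 : 0 ≤ (1 + ‖s.2‖)⁻¹ := by positivity
  simp only
  rw [Real.norm_of_nonneg (mul_nonneg h1 h2), Real.mul_rpow h1 h2,
    Real.inv_rpow (by positivity), Real.inv_rpow (by positivity), Real.rpow_neg (by positivity),
    Real.rpow_neg (by positivity)]

/-- Each factor to the power `p` is integrable once `p` exceeds its dimension. Dimensions `2, 2`
serve the whole space and `1, 2` the slices. -/
theorem memLp_prod_decay {E F : Type*} [NormedAddCommGroup E] [NormedSpace ℝ E]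
    [FiniteDimensional ℝ E] [MeasurableSpace E] [BorelSpace E] [NormedAddCommGroup F]
    [NormedSpace ℝ F] [FiniteDimensional ℝ F] [MeasurableSpace F] [BorelSpace F]
    (μ : Measure E) [μ.IsAddHaarMeasure] (ν : Measure F) [ν.IsAddHaarMeasure] [SFinite ν]
    {p : ℝ≥0∞} (hp : 2 < p) (hp' : p < ⊤)
    (hE : Module.finrank ℝ E ≤ 2) (hF : Module.finrank ℝ F ≤ 2) :
    MemLp (fun s : E × F => (1 + ‖s.1‖)⁻¹ * (1 + ‖s.2‖)⁻¹) p (μ.prod ν) := by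
  have hr : (2 : ℝ) < p.toReal := by
    have := (ENNReal.toReal_lt_toReal (by simp) hp'.ne).2 hp
    simpa using this
  have hm : Measurable (fun s : E × F => (1 + ‖s.1‖)⁻¹ * (1 + ‖s.2‖)⁻¹) := by fun_prop
  refine (integrable_norm_rpow_iff hm.aestronglyMeasurable (by positivity) hp'.ne).1 ?_
  have hE' : (Module.finrank ℝ E : ℝ) ≤ 2 := by exact_mod_cast hE
  have hF' : (Module.finrank ℝ F : ℝ) ≤ 2 := by exact_mod_cast hF
  exact integrable_prod_decay_rpow μ ν (hE'.trans_lt hr) (hF'.trans_lt hr)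

theorem memLp_of_prod_decay {F : ℂ × ℂ → ℂ} (hF : Continuous F) {C : ℝ}
    (hC : ∀ z, ‖F z‖ ≤ C * ((1 + ‖z.1‖)⁻¹ * (1 + ‖z.2‖)⁻¹)) {p : ℝ≥0∞} (hp : 2 < p)
    (hp' : p < ⊤) : MemLp F p volume :=
  ((memLp_prod_decay volume volume hp hp' Complex.finrank_real_complex.le
    Complex.finrank_real_complex.le).const_mul C).mono' hF.aestronglyMeasurable (ae_of_all _ hC)

theorem tendsto_eLpNorm_zero_of_dominated {α E : Type*} [MeasurableSpace α] {μ : Measure α}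
    [NormedAddCommGroup E] {l : Filter ℝ} [l.IsCountablyGenerated] {F : ℝ → α → E} {G : α → ℝ}
    {p : ℝ≥0∞} (hp : p ≠ 0) (hp' : p ≠ ⊤) (hF : ∀ y, AEStronglyMeasurable (F y) μ)
    (hG : MemLp G p μ) (h : ∀ y, ∀ᵐ x ∂μ, ‖F y x‖ ≤ G x)
    (hlim : ∀ᵐ x ∂μ, Tendsto (fun y => F y x) l (𝓝 0)) :
    Tendsto (fun y => eLpNorm (F y) p μ) l (𝓝 0) := by
  have hr : 0 < p.toReal := ENNReal.toReal_pos hp hp'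
  simp_rw [eLpNorm_eq_lintegral_rpow_enorm_toReal hp hp']
  have h1 : Tendsto (fun y => ∫⁻ x, ‖F y x‖ₑ ^ p.toReal ∂μ) l (𝓝 (∫⁻ _, 0 ∂μ)) := by
    refine tendsto_lintegral_filter_of_dominated_convergence' (fun x => ‖G x‖ₑ ^ p.toReal)
      (Eventually.of_forall fun y => (hF y).enorm.pow_const _)
      (Eventually.of_forall fun y => ?_) ?_ ?_
    · filter_upwards [h y] with x hx
      gcongr
      rw [← ofReal_norm, ← ofReal_norm]
      exact ENNReal.ofReal_le_ofReal (hx.trans (le_abs_self _))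
    · exact (lintegral_rpow_enorm_lt_top_of_eLpNorm_lt_top hp hp' hG.2).ne
    · filter_upwards [hlim] with x hx
      have := hx.enorm
      rw [enorm_zero] at this
      simpa [hr] using this.ennrpow_const p.toReal
  simp only [lintegral_zero] at h1
  simpa [hr] using h1.ennrpow_const (1 / p.toReal)

theorem tendsto_eLpNorm_slice {F : ℂ × ℂ → ℂ} (hF : Continuous F) {C : ℝ} (hC0 : 0 ≤ C)
    (hC : ∀ z, ‖F z‖ ≤ C * ((1 + ‖z.1‖)⁻¹ * (1 + ‖z.2‖)⁻¹))
    (h0 : ∀ z : ℂ × ℂ, z.1.im = 0 → F z = 0) {q : ℝ≥0∞} (hq : 2 < q) (hq' : q < ⊤) :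
    Tendsto (fun y : ℝ => eLpNorm (fun s : ℝ × ℂ => F ((s.1 : ℂ) + y * Complex.I, s.2)) q
      (volume.restrict {s | 0 < s.2.im})) (𝓝[>] 0) (𝓝 0) := by
  have hG : MemLp (fun s : ℝ × ℂ => C * ((1 + ‖s.1‖)⁻¹ * (1 + ‖s.2‖)⁻¹)) q volume :=
    (memLp_prod_decay volume volume hq hq' (by simp) Complex.finrank_real_complex.le).const_mul C
  refine tendsto_eLpNorm_zero_of_dominated (by positivity) hq'.ne (fun y => ?_) (hG.restrict _)
    (fun y => ae_of_all _ fun s => ?_) (ae_of_all _ fun s => ?_)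
  · exact Continuous.aestronglyMeasurable (by fun_prop)
  · refine (hC _).trans ?_
    gcongr
    -- `|x| ≤ |x + iy|` makes the majorant independent of the height `y`.
    have := Complex.abs_re_le_norm ((s.1 : ℂ) + y * Complex.I)
    simpa using this
  · have hc : Continuous fun y : ℝ => F ((s.1 : ℂ) + y * Complex.I, s.2) := by fun_prop
    have := hc.tendsto 0
    rw [h0 (_, _) (by simp)] at this
    exact this.mono_left nhdsWithin_le_nhds

end Decay

/-! ### Exchange of the two variables. -/

section Swap

open Complex

/-- A Schwartz function composed with the exchange of the two variables. -/
noncomputable def swapS (φ : 𝓢(ℂ × ℂ, ℂ)) : 𝓢(ℂ × ℂ, ℂ) :=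
  SchwartzMap.compCLMOfContinuousLinearEquiv ℝ (ContinuousLinearEquiv.prodComm ℝ ℂ ℂ) φ

theorem swapS_apply (φ : 𝓢(ℂ × ℂ, ℂ)) (z : ℂ × ℂ) : swapS φ z = φ z.swap := rfl

theorem op_swap (s₁ s₂ : Bool) (K : ℂ × ℂ → ℂ) (φ : 𝓢(ℂ × ℂ, ℂ)) (z : ℂ × ℂ) :
    op s₁ s₂ K φ z.swap = op s₂ s₁ (fun η => K η.swap) (swapS φ) z := by
  simp only [op, conv, axesMeasure]
  rw [← integral_prod_swap]
  congr 1
  ext η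
  rw [← Prod.swap_sub, oddExt_swap]
  rfl

theorem kerV_swap (η : ℂ × ℂ) : kerV η.swap = kerV η := by
  simp only [kerV, nsq, Prod.fst_swap, Prod.snd_swap, add_comm]

theorem kerT_swap (s₁ s₂ : Bool) (η : ℂ × ℂ) : kerT s₁ s₂ η.swap = kerT s₂ s₁ η := by
  simp only [kerT, Prod.fst_swap, Prod.snd_swap, mul_comm]

theorem op_kerV_swap (φ : 𝓢(ℂ × ℂ, ℂ)) (z : ℂ × ℂ) :
    op true true kerV φ z.swap = op true true kerV (swapS φ) z := by
  simp only [op_swap, kerV_swap]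

theorem opT_swap (s₁ s₂ : Bool) (φ : 𝓢(ℂ × ℂ, ℂ)) (z : ℂ × ℂ) :
    opT s₁ s₂ φ z.swap = opT s₂ s₁ (swapS φ) z := by
  simp only [opT, op_swap, kerT_swap]

/-- `ā / (b n) + b̄ / (a n) = (|a|² + |b|²) / (a b n) = 1 / (a b)`. This turns the two components of
`w` into the Cauchy solution. -/
theorem kerY_add_kerY_swap {η : ℂ × ℂ} (h1 : η.1 ≠ 0) (h2 : η.2 ≠ 0) :
    kerY η + kerY η.swap = (1 / 2 : ℂ) * kerT true true η := by
  have e1 : (starRingEnd ℂ) η.1 * η.1 = (‖η.1‖ : ℂ) ^ 2 := by rw [conj_mul']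
  have e2 : (starRingEnd ℂ) η.2 * η.2 = (‖η.2‖ : ℂ) ^ 2 := by rw [conj_mul']
  have hn : (nsq η : ℂ) ≠ 0 := by
    have : 0 < nsq η := by
      have := norm_pos_iff.2 h1
      unfold nsq; positivity
    exact_mod_cast this.ne'
  have hs : nsq η.swap = nsq η := by simp only [nsq, Prod.fst_swap, Prod.snd_swap, add_comm]
  have hpi : (Real.pi : ℂ) ≠ 0 := by exact_mod_cast Real.pi_ne_zero
  have hn' : (nsq η : ℂ) = (starRingEnd ℂ) η.1 * η.1 + (starRingEnd ℂ) η.2 * η.2 := by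
    rw [e1, e2, nsq]; push_cast; ring
  simp only [kerY, kerT, cauchyKer, kerConst, hs, Prod.fst_swap, Prod.snd_swap]
  field_simp
  rw [hn']
  ring

theorem op_kerY_add_swap (φ : 𝓢(ℂ × ℂ, ℂ)) (z : ℂ × ℂ) :
    op true true kerY φ z + op true true kerY (swapS φ) z.swap
      = (1 / 2 : ℂ) * opT true true φ z := by
  have e : swapS (swapS φ) = φ := by ext z; simp [swapS_apply]
  have hm : MeasurePreserving (Prod.swap : ℂ × ℂ → ℂ × ℂ) (axesMeasure true true)
      (axesMeasure true true) := Measure.measurePreserving_swap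
  rw [op_swap, e]
  have i1 := tempered_kerY.conv_integrable (rapid_oddExt true true φ) z
  have i2 : Integrable (fun η => kerY η.swap * oddExt true true φ (z - η))
      (axesMeasure true true) := by
    have := tempered_kerY.conv_integrable (rapid_oddExt true true (swapS φ)) z.swap
    have := hm.integrable_comp_of_integrable this
    refine this.congr (ae_of_all _ fun η => ?_)
    simp only [Function.comp_apply]
    rw [← Prod.swap_sub, oddExt_swap]
    simp only [swapS_apply, Prod.swap_swap]
  simp only [opT, op, conv]
  rw [← integral_add i1 i2, ← integral_const_mul]
  refine integral_congr_ae ?_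
  filter_upwards [ae_fst_ne_zero true, ae_snd_ne_zero true] with η h1 h2
  rw [← add_mul, kerY_add_kerY_swap h1 h2, mul_assoc]

end Swap

/-! ### Bounds and boundary values of the Neumann solution. -/

section NeumannBounds

open Complex

theorem exists_bound_neumannFst (φ : 𝓢(ℂ × ℂ, ℂ)) :
    ∃ C, 0 ≤ C ∧ ∀ z, ‖neumannFst φ z‖ ≤ C * ((1 + ‖z.1‖)⁻¹ * (1 + ‖z.2‖)⁻¹) := by
  obtain ⟨C₁, h₁, hC₁⟩ := exists_bound_kerG φ
  obtain ⟨C₂, h₂, hC₂⟩ := exists_bound_kerW (dbarS (0, 1) (0, I) φ)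
  refine ⟨2 * C₁ + C₂, by positivity, fun z => (norm_add_le _ _).trans ?_⟩
  rw [norm_mul, norm_neg, norm_ofNat]
  linarith [hC₁ z, hC₂ z]

theorem neumannFst_eq_zero (φ : 𝓢(ℂ × ℂ, ℂ)) {z : ℂ × ℂ} (hz : z.1.im = 0) :
    neumannFst φ z = 0 := by
  rw [neumannFst, op_eq_zero_of_im_eq_zero tempered_kerG _ φ hz,
    op_eq_zero_of_im_eq_zero tempered_kerW _ _ hz, mul_zero, add_zero]
  all_goals intro a b; simp only [kerG, kerW, nsq, RCLike.norm_conj]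

theorem op_kerV_eq_zero (φ : 𝓢(ℂ × ℂ, ℂ)) {z : ℂ × ℂ} (hz : z.1.im = 0) :
    op true true kerV φ z = 0 :=
  op_eq_zero_of_im_eq_zero tempered_kerV
    (fun a b => by simp only [kerV, nsq, RCLike.norm_conj]) φ hz

end NeumannBounds

/-! ### Passage between `Fin 2 → ℂ` and `ℂ × ℂ`. -/

section Coordinates

open Complex

/-- The coordinates `(z_j, z_k)`, `k ≠ j`, of a point of `ℂ²`. -/
noncomputable def coordEquiv : Fin 2 → ((Fin 2 → ℂ) ≃L[ℝ] ℂ × ℂ)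
  | 0 => ContinuousLinearEquiv.finTwoArrow ℝ ℂ
  | 1 => (ContinuousLinearEquiv.finTwoArrow ℝ ℂ).trans (ContinuousLinearEquiv.prodComm ℝ ℂ ℂ)

theorem coordEquiv_apply {j k : Fin 2} (h : j ≠ k) (z : Fin 2 → ℂ) :
    coordEquiv j z = (z j, z k) := by
  fin_cases j <;> fin_cases k <;> first | exact absurd rfl h | rfl

theorem coordEquiv_swap {j k : Fin 2} (h : j ≠ k) (z : Fin 2 → ℂ) :
    (coordEquiv j z).swap = coordEquiv k z := by
  rw [coordEquiv_apply h, coordEquiv_apply h.symm, Prod.swap_prod_mk]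

theorem coordEquiv_single_self (j : Fin 2) (a : ℂ) : coordEquiv j (Pi.single j a) = (a, 0) := by
  fin_cases j <;> simp [coordEquiv]

theorem coordEquiv_single_other {j k : Fin 2} (h : j ≠ k) (a : ℂ) :
    coordEquiv j (Pi.single k a) = (0, a) := by
  rw [coordEquiv_apply h, Pi.single_eq_same, Pi.single_eq_of_ne h]

theorem coordEquiv_mem_quadrant (j : Fin 2) {z : Fin 2 → ℂ} :
    coordEquiv j z ∈ quadrant ↔ z ∈ halfPlanes := by
  fin_cases j <;> simp [coordEquiv, quadrant, halfPlanes, and_comm]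

theorem isOpen_halfPlanes : IsOpen halfPlanes := by
  have e : halfPlanes = coordEquiv 0 ⁻¹' quadrant := by
    ext z
    exact (coordEquiv_mem_quadrant 0).symm
  rw [e]
  exact isOpen_quadrant.preimage (coordEquiv 0).continuous

theorem mapsTo_closure_coordEquiv (j : Fin 2) :
    Set.MapsTo (coordEquiv j) (closure halfPlanes) (closure quadrant) :=
  Set.MapsTo.closure (fun _ hz => (coordEquiv_mem_quadrant j).2 hz) (coordEquiv j).continuous

theorem measurePreserving_coordEquiv (j : Fin 2) :
    MeasurePreserving (coordEquiv j) volume volume := by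
  have h := volume_preserving_finTwoArrow ℂ
  fin_cases j
  · exact h
  · exact Measure.measurePreserving_swap.comp h

theorem dzbar_comp_self (j : Fin 2) (F : ℂ × ℂ → ℂ) (z : Fin 2 → ℂ) :
    dzbar j (fun ζ => F (coordEquiv j ζ)) z = wd I (1, 0) (I, 0) F (coordEquiv j z) := by
  have h : fderiv ℝ (fun ζ => F (coordEquiv j ζ)) z
      = (fderiv ℝ F (coordEquiv j z)).comp (coordEquiv j : (Fin 2 → ℂ) →L[ℝ] ℂ × ℂ) :=
    (coordEquiv j).comp_right_fderiv
  rw [dzbar, wd, h]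
  simp [coordEquiv_single_self]

theorem dz_comp_self (j : Fin 2) (F : ℂ × ℂ → ℂ) (z : Fin 2 → ℂ) :
    dz j (fun ζ => F (coordEquiv j ζ)) z = wd (-I) (1, 0) (I, 0) F (coordEquiv j z) := by
  have h : fderiv ℝ (fun ζ => F (coordEquiv j ζ)) z
      = (fderiv ℝ F (coordEquiv j z)).comp (coordEquiv j : (Fin 2 → ℂ) →L[ℝ] ℂ × ℂ) :=
    (coordEquiv j).comp_right_fderiv
  rw [dz, wd, h]
  simp [coordEquiv_single_self, sub_eq_add_neg]

theorem dzbar_comp_other {j k : Fin 2} (hjk : j ≠ k) (F : ℂ × ℂ → ℂ) (z : Fin 2 → ℂ) :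
    dzbar k (fun ζ => F (coordEquiv j ζ)) z = wd I (0, 1) (0, I) F (coordEquiv j z) := by
  have h : fderiv ℝ (fun ζ => F (coordEquiv j ζ)) z
      = (fderiv ℝ F (coordEquiv j z)).comp (coordEquiv j : (Fin 2 → ℂ) →L[ℝ] ℂ × ℂ) :=
    (coordEquiv j).comp_right_fderiv
  rw [dzbar, wd, h]
  simp [coordEquiv_single_other hjk]

theorem dzbar_congr {U : Set (Fin 2 → ℂ)} (hU : IsOpen U) {F G : (Fin 2 → ℂ) → ℂ}
    (h : Set.EqOn F G U) (j : Fin 2) {z : Fin 2 → ℂ} (hz : z ∈ U) :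
    dzbar j F z = dzbar j G z := by
  rw [dzbar, dzbar, (h.eventuallyEq_of_mem (hU.mem_nhds hz)).fderiv_eq]

theorem dz_congr {U : Set (Fin 2 → ℂ)} (hU : IsOpen U) {F G : (Fin 2 → ℂ) → ℂ}
    (h : Set.EqOn F G U) (j : Fin 2) {z : Fin 2 → ℂ} (hz : z ∈ U) :
    dz j F z = dz j G z := by
  rw [dz, dz, (h.eventuallyEq_of_mem (hU.mem_nhds hz)).fderiv_eq]

theorem closure_quadrant : closure quadrant = {z | 0 ≤ z.1.im ∧ 0 ≤ z.2.im} := by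
  have e : quadrant = {a : ℂ | 0 < a.im} ×ˢ {a : ℂ | 0 < a.im} := rfl
  rw [e, closure_prod_eq, closure_setOfPred_lt_im]
  rfl

/-- A Schwartz function on `ℂ²` in the coordinates `(z_j, z_k)`. -/
noncomputable def coordS (j : Fin 2) (φ : 𝓢(Fin 2 → ℂ, ℂ)) : 𝓢(ℂ × ℂ, ℂ) :=
  SchwartzMap.compCLMOfContinuousLinearEquiv ℝ (coordEquiv j).symm φ

theorem coordS_apply (j : Fin 2) (φ : 𝓢(Fin 2 → ℂ, ℂ)) (z : Fin 2 → ℂ) :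
    coordS j φ (coordEquiv j z) = φ z := by
  simp [coordS]

end Coordinates

/-! ### The Neumann form and the Cauchy solution for closed data. -/

section Solution

open Complex

/-- The form whose components are obtained from `neumannFst`. -/
noncomputable def neumannForm (φ : Fin 2 → 𝓢(Fin 2 → ℂ, ℂ)) : Form01 :=
  fun z j => neumannFst (coordS j (φ j)) (coordEquiv j z)

/-- The Schwartz function `∂φ_j/∂z̄_k`, `k ≠ j`, in the coordinates `(z_j, z_k)`. -/
noncomputable def crossDeriv (φ : Fin 2 → 𝓢(Fin 2 → ℂ, ℂ)) (j : Fin 2) : 𝓢(ℂ × ℂ, ℂ) :=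
  dbarS (0, 1) (0, I) (coordS j (φ j))

theorem crossDeriv_apply (φ : Fin 2 → 𝓢(Fin 2 → ℂ, ℂ)) {j k : Fin 2} (h : j ≠ k)
    (z : Fin 2 → ℂ) : crossDeriv φ j (coordEquiv j z) = dzbar k (φ j) z := by
  rw [crossDeriv, dbarS_apply, ← dzbar_comp_other h]
  simp only [coordS_apply]

/-- The solution of `∂̄u = ∑ φ_j dz̄_j` by means of the solution operators of the half-planes. -/
noncomputable def dbarSol (φ : Fin 2 → 𝓢(Fin 2 → ℂ, ℂ)) (z : Fin 2 → ℂ) : ℂ :=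
  opT true false (coordS 0 (φ 0)) (coordEquiv 0 z)
    + opT true false (coordS 1 (φ 1)) (coordEquiv 1 z)
    - opT true true (crossDeriv φ 0) (coordEquiv 0 z)

/-- `∂φ_1/∂z̄_2 = ∂φ_2/∂z̄_1` in `Ω`. -/
def DbarClosed (φ : Fin 2 → 𝓢(Fin 2 → ℂ, ℂ)) : Prop :=
  ∀ z ∈ halfPlanes, dzbar 1 (φ 0) z = dzbar 0 (φ 1) z

variable {φ : Fin 2 → 𝓢(Fin 2 → ℂ, ℂ)}

theorem DbarClosed.dzbar_eq (hφ : DbarClosed φ) {j k : Fin 2} (h : j ≠ k) {z : Fin 2 → ℂ}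
    (hz : z ∈ halfPlanes) : dzbar k (φ j) z = dzbar j (φ k) z := by
  have := hφ z hz
  fin_cases j <;> fin_cases k <;> first | exact absurd rfl h | exact this | exact this.symm

/-- Closedness is known only on the open quadrant. It passes to the closure by continuity, and the
odd extension sees no other values. -/
theorem DbarClosed.oddExt_crossDeriv (hφ : DbarClosed φ) {j k : Fin 2} (h : j ≠ k) :
    oddExt true true (crossDeriv φ k) = oddExt true true (swapS (crossDeriv φ j)) := by
  refine oddExt_congr fun z h1 h2 => ?_
  have hz : z ∈ closure quadrant := by rw [closure_quadrant]; exact ⟨h1, h2⟩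
  refine Set.EqOn.closure (s := quadrant) (fun ζ hζ => ?_) (crossDeriv φ k).continuous
    (swapS (crossDeriv φ j)).continuous hz
  obtain ⟨x, rfl⟩ := (coordEquiv k).surjective ζ
  rw [swapS_apply, coordEquiv_swap h.symm, crossDeriv_apply φ h.symm, crossDeriv_apply φ h]
  exact hφ.dzbar_eq h.symm ((coordEquiv_mem_quadrant k).1 hζ)

theorem DbarClosed.op_crossDeriv (hφ : DbarClosed φ) {j k : Fin 2} (h : j ≠ k) (K : ℂ × ℂ → ℂ) :
    op true true K (crossDeriv φ k) = op true true K (swapS (crossDeriv φ j)) := by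
  rw [op, op, hφ.oddExt_crossDeriv h]

/-- These operators reflect one variable only, whereas closedness compares doubly odd extensions. On
the quadrant the missing reflection can be inserted, since the measure in that variable is a Dirac
mass. -/
theorem DbarClosed.opT_crossDeriv (hφ : DbarClosed φ) {j k : Fin 2} (h : j ≠ k)
    {z : Fin 2 → ℂ} (hz : z ∈ halfPlanes) :
    opT true false (crossDeriv φ k) (coordEquiv k z)
      = opT false true (crossDeriv φ j) (coordEquiv j z) := by
  have hz' := (coordEquiv_mem_quadrant k).2 hz
  rw [← coordEquiv_swap h.symm, opT_swap, opT, ← conv_oddExt_snd hz', hφ.oddExt_crossDeriv h,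
    conv_oddExt_snd hz']

/-- Closedness makes the definition symmetric in the two indices, so one computation handles both
components of `∂̄`. -/
theorem DbarClosed.dbarSol_eq (hφ : DbarClosed φ) {j k : Fin 2} (h : j ≠ k) (z : Fin 2 → ℂ) :
    dbarSol φ z = opT true false (coordS j (φ j)) (coordEquiv j z)
      + opT true false (coordS k (φ k)) (coordEquiv k z)
      - opT true true (crossDeriv φ j) (coordEquiv j z) := by
  have key : opT true true (crossDeriv φ 0) (coordEquiv 0 z)
      = opT true true (crossDeriv φ 1) (coordEquiv 1 z) := by
    have h01 : (0 : Fin 2) ≠ 1 := by decide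
    rw [opT, opT, hφ.op_crossDeriv h01, ← coordEquiv_swap h01.symm, ← opT, opT_swap]
  fin_cases j <;> fin_cases k
  · exact absurd rfl h
  · rfl
  · simp only [dbarSol, key]
    simp [add_comm]
  · exact absurd rfl h

theorem contDiffOn_dbarSol (φ : Fin 2 → 𝓢(Fin 2 → ℂ, ℂ)) :
    ContDiffOn ℝ ∞ (dbarSol φ) (closure halfPlanes) := by
  have h : ∀ s₁ s₂ ψ j, ContDiffOn ℝ ∞ (fun z => opT s₁ s₂ ψ (coordEquiv j z))
      (closure halfPlanes) := fun s₁ s₂ ψ j =>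
    (contDiffOn_opT s₁ s₂ ψ).comp (coordEquiv j).contDiff.contDiffOn (mapsTo_closure_coordEquiv j)
  exact ((h _ _ _ _).add (h _ _ _ _)).sub (h _ _ _ _)

theorem differentiableAt_opT (s₁ s₂ : Bool) (ψ : 𝓢(ℂ × ℂ, ℂ)) (j : Fin 2) {z : Fin 2 → ℂ}
    (hz : z ∈ halfPlanes) :
    DifferentiableAt ℝ (fun z => opT s₁ s₂ ψ (coordEquiv j z)) z := by
  have := ((weakGrad_opT s₁ s₂ ψ).hasFDerivAt isOpen_quadrant
    ((coordEquiv_mem_quadrant j).2 hz)).differentiableAt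
  exact this.comp z (coordEquiv j).differentiableAt

/-- `∂̄_j` turns the first term into `φ_j`. The second becomes `T_k (∂φ_k/∂z̄_j)` and the third `T_k
(∂φ_j/∂z̄_k)`; by closedness they cancel. -/
theorem DbarClosed.dzbar_dbarSol (hφ : DbarClosed φ) (j : Fin 2) {z : Fin 2 → ℂ}
    (hz : z ∈ halfPlanes) : dzbar j (dbarSol φ) z = φ j z := by
  obtain ⟨k, h⟩ : ∃ k, j ≠ k := by
    fin_cases j
    exacts [⟨1, by decide⟩, ⟨0, by decide⟩]
  have hj := (coordEquiv_mem_quadrant j).2 hz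
  have hk := (coordEquiv_mem_quadrant k).2 hz
  have d1 := differentiableAt_opT true false (coordS j (φ j)) j hz
  have d2 := differentiableAt_opT true false (coordS k (φ k)) k hz
  have d3 := differentiableAt_opT true true (crossDeriv φ j) j hz
  have e : dzbar j (dbarSol φ) z
      = dzbar j (fun z => opT true false (coordS j (φ j)) (coordEquiv j z)) z
        + dzbar j (fun z => opT true false (coordS k (φ k)) (coordEquiv k z)) z
        - dzbar j (fun z => opT true true (crossDeriv φ j) (coordEquiv j z)) z := by
    rw [show dbarSol φ = _ from funext (hφ.dbarSol_eq h)]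
    simp only [dzbar]
    rw [fderiv_fun_sub (d1.fun_add d2) d3, fderiv_fun_add d1 d2]
    simp only [sub_apply, add_apply]
    ring
  rw [e, dzbar_comp_self, dzbar_comp_self, dzbar_comp_other h.symm, wd_opT_fst _ _ hj,
    wd_opT_fst _ _ hj, wd_opT_snd_false _ _ hk, ← crossDeriv, hφ.opT_crossDeriv h hz,
    opT, op_kerT_false_false, coordS_apply]
  ring

theorem dzbar_neumannForm {j k : Fin 2} (h : j ≠ k) {z : Fin 2 → ℂ} (hz : z ∈ halfPlanes) :
    dzbar k (fun ζ => neumannForm φ ζ j) z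
      = op true true kerV (crossDeriv φ j) (coordEquiv j z) := by
  simp only [neumannForm]
  rw [dzbar_comp_other h, wd_neumannFst_snd _ ((coordEquiv_mem_quadrant j).2 hz), crossDeriv]

theorem DbarClosed.dbar₁_neumannForm (hφ : DbarClosed φ) {z : Fin 2 → ℂ} (hz : z ∈ halfPlanes)
    (j k : Fin 2) : dbar₁ (neumannForm φ) z j k = 0 := by
  rcases eq_or_ne j k with rfl | h
  · simp [dbar₁]
  · rw [dbar₁, dzbar_neumannForm h hz, dzbar_neumannForm h.symm hz, hφ.op_crossDeriv h,
      ← op_kerV_swap, coordEquiv_swap h.symm, sub_self]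

/-- The terms `-½ T_j φ_j` give the two single Cauchy transforms, and the two `kerY` terms combine
through `op_kerY_add_swap`, `crossDeriv φ 1` being the swap of `crossDeriv φ 0` on the closed
quadrant. -/
theorem DbarClosed.dbarStar₁_neumannForm (hφ : DbarClosed φ) {z : Fin 2 → ℂ}
    (hz : z ∈ halfPlanes) : dbarStar₁ (neumannForm φ) z = dbarSol φ z := by
  have h01 : (0 : Fin 2) ≠ 1 := by decide
  have h := op_kerY_add_swap (crossDeriv φ 0) (coordEquiv 0 z)
  rw [coordEquiv_swap h01, ← hφ.op_crossDeriv h01] at h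
  simp only [dbarStar₁, Fin.sum_univ_two, neumannForm]
  rw [dz_comp_self, dz_comp_self, wd_neumannFst_fst _ ((coordEquiv_mem_quadrant 0).2 hz),
    wd_neumannFst_fst _ ((coordEquiv_mem_quadrant 1).2 hz), ← crossDeriv, ← crossDeriv, dbarSol]
  linear_combination (-2 : ℂ) * h

theorem DbarClosed.boxLaplacian_neumannForm (hφ : DbarClosed φ) {z : Fin 2 → ℂ}
    (hz : z ∈ halfPlanes) (j : Fin 2) : boxLaplacian (neumannForm φ) z j = φ j z := by
  have h1 : dbar₀ (dbarStar₁ (neumannForm φ)) z j = φ j z := by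
    rw [dbar₀, dzbar_congr isOpen_halfPlanes (fun ζ hζ => hφ.dbarStar₁_neumannForm hζ) j hz,
      hφ.dzbar_dbarSol j hz]
  have h2 : dbarStar₂ (dbar₁ (neumannForm φ)) z j = 0 := by
    have : ∀ k, dz k (fun ζ => dbar₁ (neumannForm φ) ζ k j) z = 0 := fun k => by
      rw [dz_congr (G := fun _ => 0) isOpen_halfPlanes
        (fun ζ hζ => hφ.dbar₁_neumannForm hζ k j) k hz]
      simp [dz]
    simp [dbarStar₂, this]
  rw [boxLaplacian, h1, h2, add_zero]

theorem coordEquiv_slicePoint {j k : Fin 2} (h : j ≠ k) (y : ℝ) (s : ℝ × ℂ) :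
    coordEquiv j (slicePoint j y s) = ((s.1 : ℂ) + y * I, s.2) := by
  rw [coordEquiv_apply h]
  simp [slicePoint, h.symm]

theorem slicePoint_mem_halfPlanes (j : Fin 2) {y : ℝ} (hy : 0 < y) {s : ℝ × ℂ}
    (hs : 0 < s.2.im) : slicePoint j y s ∈ halfPlanes := by
  intro k
  simp only [slicePoint]
  split_ifs
  · simpa using hy
  · exact hs

theorem sliceNorm_congr {F G : (Fin 2 → ℂ) → ℂ} (h : Set.EqOn F G halfPlanes) (j : Fin 2)
    (q : ℝ≥0∞) {y : ℝ} (hy : 0 < y) : sliceNorm j q F y = sliceNorm j q G y := by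
  refine eLpNorm_congr_ae ?_
  refine (ae_restrict_iff' (measurableSet_lt measurable_const (by fun_prop))).2
    (ae_of_all _ fun s hs => ?_)
  exact h (slicePoint_mem_halfPlanes j hy hs)

theorem tendsto_sliceNorm {F : ℂ × ℂ → ℂ} (hF : Continuous F)
    (hC : ∃ C, 0 ≤ C ∧ ∀ z, ‖F z‖ ≤ C * ((1 + ‖z.1‖)⁻¹ * (1 + ‖z.2‖)⁻¹))
    (h0 : ∀ z : ℂ × ℂ, z.1.im = 0 → F z = 0) {j k : Fin 2} (h : j ≠ k) {q : ℝ≥0∞} (hq : 2 < q)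
    (hq' : q < ⊤) :
    Tendsto (sliceNorm j q fun z => F (coordEquiv j z)) (𝓝[>] 0) (𝓝 0) := by
  obtain ⟨C, hC0, hC⟩ := hC
  have := tendsto_eLpNorm_slice hF hC0 hC h0 hq hq'
  refine this.congr fun y => ?_
  simp only [sliceNorm, coordEquiv_slicePoint h]

theorem memLp_comp_coordEquiv {F : ℂ × ℂ → ℂ} (hF : Continuous F)
    (hC : ∃ C, 0 ≤ C ∧ ∀ z, ‖F z‖ ≤ C * ((1 + ‖z.1‖)⁻¹ * (1 + ‖z.2‖)⁻¹)) (j : Fin 2) {p : ℝ≥0∞}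
    (hp : 2 < p) (hp' : p < ⊤) :
    MemLp (fun z => F (coordEquiv j z)) p (volume.restrict halfPlanes) := by
  obtain ⟨C, -, hC⟩ := hC
  exact ((memLp_of_prod_decay hF hC hp hp').comp_measurePreserving
    (measurePreserving_coordEquiv j)).restrict _

theorem DbarClosed.isDbarNeumannSolution (hφ : DbarClosed φ) {f : Form01}
    (hf : ∀ z ∈ halfPlanes, ∀ j, f z j = φ j z) : IsDbarNeumannSolution f (neumannForm φ) where
  contDiffOn j := (contDiffOn_neumannFst (coordS j (φ j))).comp
    (coordEquiv j).contDiff.contDiffOn fun _ hz => (coordEquiv_mem_quadrant j).2 hz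
  box_eq z hz := funext fun j => by rw [hφ.boxLaplacian_neumannForm hz, hf z hz]
  memLp j p hp hp' := memLp_comp_coordEquiv (continuous_neumannFst _)
    (exists_bound_neumannFst _) j hp hp'
  memLp_dzbar j k h p hp hp' := by
    refine (memLp_comp_coordEquiv (continuous_op tempered_kerV (crossDeriv φ j))
      (exists_bound_kerV _) j hp hp').ae_eq ?_
    exact (ae_restrict_iff' isOpen_halfPlanes.measurableSet).2
      (ae_of_all _ fun z hz => (dzbar_neumannForm h hz).symm)
  boundary j q hq hq' := by
    obtain ⟨k, h⟩ : ∃ k, j ≠ k := by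
      fin_cases j
      exacts [⟨1, by decide⟩, ⟨0, by decide⟩]
    exact tendsto_sliceNorm (continuous_neumannFst _) (exists_bound_neumannFst _)
      (fun _ => neumannFst_eq_zero _) h hq (hq'.trans (by simp))
  boundary_dzbar j k h q hq hq' := by
    -- Vanishing was proved for the first coordinate; the symmetry of `kerV` moves it to `y_k = 0`
    -- by passing to the coordinates `(z_k, z_j)`.
    refine (tendsto_sliceNorm (continuous_op tempered_kerV (swapS (crossDeriv φ j)))
      (exists_bound_kerV _) (fun _ => op_kerV_eq_zero _) h.symm hq hq').congr' ?_
    filter_upwards [self_mem_nhdsWithin] with y hy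
    refine sliceNorm_congr (fun z hz => ?_) k q hy
    rw [dzbar_neumannForm h hz, ← op_kerV_swap, coordEquiv_swap h.symm]

end Solution

/-! ### The theorem. -/

theorem mainTheorem7 (f : Form01)
    (hf : ∀ j, IsSchwartzOn (closure halfPlanes) (fun z => f z j))
    (hclosed : ∀ z ∈ halfPlanes, dbar₁ f z = 0) :
    ∃ u : (Fin 2 → ℂ) → ℂ,
      ContDiffOn ℝ ∞ u (closure halfPlanes) ∧
      (∀ z ∈ halfPlanes, dbar₀ u z = f z) ∧
      ∃ w : Form01, IsDbarNeumannSolution f w ∧ ∀ z ∈ halfPlanes, u z = dbarStar₁ w z := by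
  choose φ hφ using hf
  have hf' : ∀ j, Set.EqOn (fun z => f z j) (φ j) halfPlanes := fun j =>
    (hφ j).mono subset_closure
  have hc : DbarClosed φ := fun z hz => by
    have h := congrFun (congrFun (hclosed z hz) 0) 1
    simp only [dbar₁, Pi.zero_apply] at h
    rw [dzbar_congr isOpen_halfPlanes (hf' 1) 0 hz, dzbar_congr isOpen_halfPlanes (hf' 0) 1 hz,
      sub_eq_zero] at h
    exact h.symm
  refine ⟨dbarSol φ, contDiffOn_dbarSol φ, fun z hz => funext fun j => ?_, neumannForm φ,
    hc.isDbarNeumannSolution fun z hz j => hf' j hz, fun z hz =>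
      (hc.dbarStar₁_neumannForm hz).symm⟩
  rw [dbar₀, hc.dzbar_dbarSol j hz]
  exact (hf' j hz).symm
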